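/- Let $M$ be a smooth (Hausdorff, second countable, finite-dimensional) manifold and $\pi:A\to M$ a smooth affine bundle of rank $>0$. Let $A^+\to M$ be the vector bundle whose fibre at $p$ is the space $\mathrm{Aff}(A_p,\mathbb R)$ of affine functions on $A_p$, let $\tilde 1\in\Gamma(A^+)$ be the section given by the constant function $1$, and let $\hat A=(A^+)^*$. A smooth function $a:A\to\mathbb R$ is called affine if it is affine on each fibre; it corresponds to the section $\tilde a\in\Gamma(A^+)$, $\tilde a(p)=a|_{A_p}$. Sections $X$ of $A^+$ define fibrewise linear functions $\iota_X$ on $\hat A$, and $A$ is regarded as the submanifold $\iota_{\tilde 1}^{-1}(1)$ of $\hat A$ by sending $q\in A_p$ to evaluation at $q$. A Jacobi structure on a manifold is a pair $(\Lambda,E)$ of a $2$-vector field and a vector field with $[\Lambda,\Lambda]=-2E\wedge\Lambda$ and $[E,\Lambda]=0$; here $[\cdot,\cdot]$ is the Schouten bracket that makes multivector fields a graded Lie algebra, extends the Lie bracket of vector fields, and satisfies $[P,Q\wedge R]=[P,Q]\wedge R+(-1)^{(p-1)q}Q\wedge[P,R]$ for $P,Q$ of degrees $p,q$. Its bracket is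 $\{f,g\}_{(\Lambda,E)}=\Lambda(df,dg)+fE(g)-gE(f)$. A Poisson structure is a $2$-vector field $\Lambda$ with $[\Lambda,\Lambda]=0$. A Jacobi structure on $A$ is called affine if its bracket is closed on affine functions; a Poisson structure on $\hat A$ is called linear if its bracket is closed on fibrewise linear functions. Let $([\![\cdot,\cdot]\!]^+,\rho^+)$ be a Lie algebroid structure on $A^+$. Then there exists a unique affine Jacobi structure $(\Lambda_A,E_A)$ on $A$ such that $$\widetilde{\{a,b\}}_{(\Lambda_A,E_A)}=[\![\tilde a,\tilde b]\!]^+\qquad\text{for all affine functions } a,b:A\to\mathbb R.$$ Moreover, there is a unique linear Poisson structure $\bar\Lambda$ on $\hat A$ with $\bar\Lambda(d\iota_X,d\iota_Y)=\iota_{[\![X,Y]\!]^+}$ for all $X,Y\in\Gamma(A^+)$. Let $E$ be the hamiltonian vector field of $\iota_{\tilde 1}$ with respect to $\bar\Lambda$, that is, $\alpha(E)=\bar\Lambda(d\iota_{\tilde 1},\alpha)$ for all covectors $\alpha$, and let $\Delta$ be the Liouville (Euler) vector field of $\hat A$. Then $(\bar\Lambda-\Delta\wedge E,\,E)$ is a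 Jacobi structure on $\hat A$, and $(\Lambda_A,E_A)$ is its restriction to $A\subset\hat A$: at the points of $A$, $\bar\Lambda-\Delta\wedge E$ and $E$ are the images of $\Lambda_A$ and $E_A$ under the differential of the inclusion. Here $(u\wedge v)(\alpha,\beta)=\alpha(u)\beta(v)-\alpha(v)\beta(u)$. -/

import Mathlib

open Bundle Set Manifold ContDiff

namespace AffineJacobi

noncomputable section

/-! ### Affine bundles -/

section AffineBundles

/-- A (topological) affine bundle over `B` with fibres `A x`, modelled on the vector spaces `V x`:
a locally trivial fibre bundle whose distinguished local trivializations are affine maps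
`A x → F` on the fibres. -/
class AffineBundle {B : Type*} [TopologicalSpace B]
    (F : Type*) [NormedAddCommGroup F] [NormedSpace ℝ F]
    (V : outParam (B → Type*)) [∀ x, AddCommGroup (V x)] [∀ x, Module ℝ (V x)]
    (A : B → Type*) [∀ x, AddTorsor (V x) (A x)]
    [TopologicalSpace (TotalSpace F A)] [∀ x, TopologicalSpace (A x)] [FiberBundle F A] :
    Prop where
  trivialization_affine : ∀ (e : Trivialization F (π F A)) [MemTrivializationAtlas e],
    ∀ x ∈ e.baseSet, ∃ φ : A x →ᵃ[ℝ] F, ∀ q : A x, (e ⟨x, q⟩).2 = φ q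

/-- The transition maps between the distinguished local trivializations are smooth. -/
class SmoothTransitions (EB : Type*) [NormedAddCommGroup EB] [NormedSpace ℝ EB]
    {B : Type*} [TopologicalSpace B] [ChartedSpace EB B]
    (F : Type*) [NormedAddCommGroup F] [NormedSpace ℝ F] (A : B → Type*)
    [TopologicalSpace (TotalSpace F A)] [∀ x, TopologicalSpace (A x)] [FiberBundle F A] :
    Prop where
  contMDiffOn_transition : ∀ (e e' : Trivialization F (π F A))
    [MemTrivializationAtlas e] [MemTrivializationAtlas e'],
    ContMDiffOn (𝓘(ℝ, EB).prod 𝓘(ℝ, F)) (𝓘(ℝ, EB).prod 𝓘(ℝ, F)) ∞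
      (e.toOpenPartialHomeomorph.symm ≫ₕ e'.toOpenPartialHomeomorph)
      (e.toOpenPartialHomeomorph.symm ≫ₕ e'.toOpenPartialHomeomorph).source

/-- The fibres of the vector bundle `A⁺`: affine functions `A x → ℝ`. -/
def AffDual {B : Type*} (_F : Type*) (V : B → Type*) [∀ x, AddCommGroup (V x)]
    [∀ x, Module ℝ (V x)] (A : B → Type*) [∀ x, AddTorsor (V x) (A x)] (x : B) : Type _ :=
  A x →ᵃ[ℝ] ℝ

/-- The model fibre of `A⁺`: the affine function `y ↦ c + l y` on `F` is the pair `(c, l)`. -/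
abbrev AffModel (F : Type*) [NormedAddCommGroup F] [NormedSpace ℝ F] : Type _ :=
  ℝ × (F →L[ℝ] ℝ)

/-- Affine functions on the model fibre as elements of `AffModel F`. -/
def modelEquiv (F : Type*) [NormedAddCommGroup F] [NormedSpace ℝ F] [FiniteDimensional ℝ F] :
    (F →ᵃ[ℝ] ℝ) ≃ₗ[ℝ] AffModel F :=
  (AffineMap.toConstProdLinearMap (k := ℝ) (V1 := F) (V2 := ℝ) ℝ).trans
    (LinearEquiv.prodCongr (LinearEquiv.refl ℝ ℝ) LinearMap.toContinuousLinearMap)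

theorem continuousOn_transition {B F : Type*} [TopologicalSpace B] [TopologicalSpace F]
    {A : B → Type*} [TopologicalSpace (TotalSpace F A)] (e e' : Trivialization F (π F A)) (y : F) :
    ContinuousOn (fun x => (e (e'.toOpenPartialHomeomorph.symm (x, y))).2)
      (e.baseSet ∩ e'.baseSet) := by
  refine continuous_snd.comp_continuousOn ?_
  refine e.continuousOn.comp (t := e.source) ?_ ?_
  · exact e'.toOpenPartialHomeomorph.continuousOn_symm.comp (by fun_prop) fun x hx => e'.mem_target.2 hx.2
  · intro x hx
    rw [e.mem_source]
    exact (e'.proj_symm_apply (x := (x, y)) (e'.mem_target.2 hx.2)) ▸ hx.1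

section Topological

variable {B : Type*} [TopologicalSpace B]
  (F : Type*) [NormedAddCommGroup F] [NormedSpace ℝ F]
  (V : B → Type*) [∀ x, AddCommGroup (V x)] [∀ x, Module ℝ (V x)]
  (A : B → Type*) [∀ x, AddTorsor (V x) (A x)]

instance (x : B) : AddCommGroup (AffDual F V A x) := inferInstanceAs (AddCommGroup (A x →ᵃ[ℝ] ℝ))

instance (x : B) : Module ℝ (AffDual F V A x) := inferInstanceAs (Module ℝ (A x →ᵃ[ℝ] ℝ))

instance (x : B) : FunLike (AffDual F V A x) (A x) ℝ :=
  inferInstanceAs (FunLike (A x →ᵃ[ℝ] ℝ) (A x) ℝ)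

variable [TopologicalSpace (TotalSpace F A)] [∀ x, TopologicalSpace (A x)] [FiberBundle F A]
  [AffineBundle F V A]

variable {F A} in
/-- A distinguished trivialization, restricted to a fibre, as an affine isomorphism. -/
def fiberEquiv (e : Trivialization F (π F A)) [MemTrivializationAtlas e] {x : B}
    (hx : x ∈ e.baseSet) : A x ≃ᵃ[ℝ] F :=
  AffineEquiv.ofBijective (φ := (AffineBundle.trivialization_affine (V := V) e x hx).choose) <| by
    have h := (AffineBundle.trivialization_affine (V := V) e x hx).choose_spec
    constructor
    · intro q q' hq
      rw [← h, ← h] at hq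
      have h1 : e ⟨x, q⟩ = e ⟨x, q'⟩ :=
        Prod.ext (by rw [e.coe_fst' hx, e.coe_fst' hx]) hq
      have h2 := e.injOn (e.mem_source.2 hx) (e.mem_source.2 hx) h1
      exact TotalSpace.mk_injective x h2
    · intro y
      have hy : (x, y) ∈ e.target := e.mem_target.2 hx
      generalize hp : e.toOpenPartialHomeomorph.symm (x, y) = p
      have h1 : p.proj = x := by rw [← hp]; exact e.proj_symm_apply hy
      have h2 : e p = (x, y) := by rw [← hp]; exact e.apply_symm_apply hy
      obtain ⟨x', q⟩ := p
      obtain rfl : x' = x := h1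
      exact ⟨q, by rw [← h, h2]⟩

variable {F A} in
theorem fiberEquiv_apply (e : Trivialization F (π F A)) [MemTrivializationAtlas e] {x : B}
    (hx : x ∈ e.baseSet) (q : A x) : fiberEquiv V e hx q = (e ⟨x, q⟩).2 :=
  ((AffineBundle.trivialization_affine (V := V) e x hx).choose_spec q).symm

variable {F A} in
theorem mk_fiberEquiv_symm (e : Trivialization F (π F A)) [MemTrivializationAtlas e] {x : B}
    (hx : x ∈ e.baseSet) (y : F) :
    (⟨x, (fiberEquiv V e hx).symm y⟩ : TotalSpace F A) =
      e.toOpenPartialHomeomorph.symm (x, y) := by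
  have hy : (x, y) ∈ e.target := e.mem_target.2 hx
  refine e.injOn (e.mem_source.2 hx) (e.map_target hy) ?_
  change e _ = e _
  rw [e.apply_symm_apply hy]
  refine Prod.ext (e.coe_fst' hx) ?_
  rw [← fiberEquiv_apply V e hx]
  simp

variable [FiniteDimensional ℝ F]

variable {F A} in
/-- The coordinates of affine functions on a fibre `A x` in a local trivialization of `A`. -/
def coordEquiv (e : Trivialization F (π F A)) [MemTrivializationAtlas e] {x : B}
    (hx : x ∈ e.baseSet) : AffDual F V A x ≃ₗ[ℝ] AffModel F :=
  LinearEquiv.trans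
    (show AffDual F V A x ≃ₗ[ℝ] (F →ᵃ[ℝ] ℝ) from
      { toFun := fun φ => AffineMap.comp (show A x →ᵃ[ℝ] ℝ from φ)
          (fiberEquiv V e hx).symm.toAffineMap
        invFun := fun φ => (AffineMap.comp φ (fiberEquiv V e hx).toAffineMap : A x →ᵃ[ℝ] ℝ)
        left_inv := fun φ => by
          refine AffineMap.ext (f := (_ : A x →ᵃ[ℝ] ℝ)) fun q => ?_
          exact congrArg (show A x →ᵃ[ℝ] ℝ from φ) ((fiberEquiv V e hx).symm_apply_apply q)
        right_inv := fun φ => by ext q; simp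
        map_add' := fun _ _ => rfl
        map_smul' := fun _ _ => rfl })
    (modelEquiv F)

variable {F A V} in
theorem coordEquiv_fst (e : Trivialization F (π F A)) [MemTrivializationAtlas e] {x : B}
    (hx : x ∈ e.baseSet) (φ : AffDual F V A x) :
    (coordEquiv V e hx φ).1 = φ ((fiberEquiv V e hx).symm 0) := rfl

variable {F A V} in
theorem coordEquiv_snd (e : Trivialization F (π F A)) [MemTrivializationAtlas e] {x : B}
    (hx : x ∈ e.baseSet) (φ : AffDual F V A x) (y : F) :
    (coordEquiv V e hx φ).2 y =
      φ ((fiberEquiv V e hx).symm y) - φ ((fiberEquiv V e hx).symm 0) := by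
  set ψ : F →ᵃ[ℝ] ℝ :=
    AffineMap.comp (show A x →ᵃ[ℝ] ℝ from φ) (fiberEquiv V e hx).symm.toAffineMap with hψ
  change ψ.linear y = ψ y - ψ 0
  rw [AffineMap.decomp' ψ]
  simp

variable {F A V} in
theorem coordEquiv_symm_apply (e : Trivialization F (π F A)) [MemTrivializationAtlas e] {x : B}
    (hx : x ∈ e.baseSet) (w : AffModel F) (q : A x) :
    ((coordEquiv V e hx).symm w) q = w.1 + w.2 (e ⟨x, q⟩).2 := by
  obtain ⟨φ, rfl⟩ := (coordEquiv V e hx).surjective w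
  rw [LinearEquiv.symm_apply_apply, coordEquiv_fst, coordEquiv_snd, ← fiberEquiv_apply V e hx]
  simp

/-- The topology of the finite-dimensional vector space of affine functions on `A x`. -/
instance (x : B) : TopologicalSpace (AffDual F V A x) :=
  TopologicalSpace.induced
    (coordEquiv V (trivializationAt F A x) (mem_baseSet_trivializationAt F A x)) inferInstance

instance (x : B) : IsTopologicalAddGroup (AffDual F V A x) :=
  topologicalAddGroup_induced
    (coordEquiv V (trivializationAt F A x) (mem_baseSet_trivializationAt F A x))

instance (x : B) : ContinuousSMul ℝ (AffDual F V A x) :=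
  continuousSMul_induced
    (coordEquiv V (trivializationAt F A x) (mem_baseSet_trivializationAt F A x))

theorem continuous_coordEquiv (x : B) : Continuous
    (coordEquiv V (trivializationAt F A x) (mem_baseSet_trivializationAt F A x)) :=
  continuous_induced_dom

open Classical in
variable {F A} in
/-- The local trivialization of `A⁺` induced by a distinguished local trivialization of `A`. -/
def affDualTriv (e : Trivialization F (π F A)) [MemTrivializationAtlas e] :
    Pretrivialization (AffModel F) (π (AffModel F) (AffDual F V A)) where
  toFun p := (p.1, if h : p.1 ∈ e.baseSet then coordEquiv V e h p.2 else 0)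
  invFun p := ⟨p.1, if h : p.1 ∈ e.baseSet then (coordEquiv V e h).symm p.2 else 0⟩
  source := π (AffModel F) (AffDual F V A) ⁻¹' e.baseSet
  target := e.baseSet ×ˢ univ
  map_source' p hp := ⟨hp, mem_univ _⟩
  map_target' p hp := hp.1
  left_inv' := by
    rintro ⟨x, φ⟩ (hx : x ∈ e.baseSet)
    simp [hx]
  right_inv' := by
    rintro ⟨x, w⟩ ⟨hx, -⟩
    replace hx : x ∈ e.baseSet := hx
    simp [hx]
  open_target := e.open_baseSet.prod isOpen_univ
  baseSet := e.baseSet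
  open_baseSet := e.open_baseSet
  source_eq := rfl
  target_eq := rfl
  proj_toFun _ _ := rfl

variable {F A V} in
theorem affDualTriv_apply (e : Trivialization F (π F A)) [MemTrivializationAtlas e] {x : B}
    (hx : x ∈ e.baseSet) (φ : AffDual F V A x) :
    affDualTriv V e ⟨x, φ⟩ = (x, coordEquiv V e hx φ) := by
  change (x, _) = _
  simp [hx]

variable {F A V} in
theorem affDualTriv_symm (e : Trivialization F (π F A)) [MemTrivializationAtlas e] {x : B}
    (hx : x ∈ e.baseSet) (w : AffModel F) :
    (affDualTriv V e).symm x w = (coordEquiv V e hx).symm w := by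
  have h : x ∈ (affDualTriv V e).baseSet := hx
  have h1 := (affDualTriv V e).mk_symm h w
  have h2 : (affDualTriv V e).toPartialEquiv.symm (x, w) =
      ⟨x, (coordEquiv V e hx).symm w⟩ := by
    change (⟨x, _⟩ : TotalSpace _ _) = _
    simp [hx]
  rw [h2] at h1
  exact TotalSpace.mk_injective x h1

open Classical in
variable {F A} in
/-- The coordinate changes of `A⁺`. -/
def affDualCoordChange (e e' : Trivialization F (π F A)) [MemTrivializationAtlas e]
    [MemTrivializationAtlas e'] (x : B) : AffModel F →L[ℝ] AffModel F :=
  if h : x ∈ e.baseSet ∩ e'.baseSet then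
    ((coordEquiv V e h.1).symm.trans (coordEquiv V e' h.2)).toLinearMap.toContinuousLinearMap
  else 0

variable {F A V} in
theorem affDualCoordChange_apply (e e' : Trivialization F (π F A)) [MemTrivializationAtlas e]
    [MemTrivializationAtlas e'] {x : B} (hx : x ∈ e.baseSet ∩ e'.baseSet) (w : AffModel F) :
    affDualCoordChange V e e' x w = (affDualTriv V e' ⟨x, (affDualTriv V e).symm x w⟩).2 := by
  rw [affDualTriv_symm e hx.1, affDualTriv_apply e' hx.2, affDualCoordChange, dif_pos hx]
  rfl

variable {F A V} in
theorem affDualCoordChange_fst (e e' : Trivialization F (π F A)) [MemTrivializationAtlas e]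
    [MemTrivializationAtlas e'] {x : B} (hx : x ∈ e.baseSet ∩ e'.baseSet) (w : AffModel F) :
    (affDualCoordChange V e e' x w).1 =
      w.1 + w.2 (e (e'.toOpenPartialHomeomorph.symm (x, 0))).2 := by
  rw [affDualCoordChange_apply e e' hx, affDualTriv_symm e hx.1, affDualTriv_apply e' hx.2,
    coordEquiv_fst, coordEquiv_symm_apply, mk_fiberEquiv_symm]

variable {F A V} in
theorem affDualCoordChange_snd (e e' : Trivialization F (π F A)) [MemTrivializationAtlas e]
    [MemTrivializationAtlas e'] {x : B} (hx : x ∈ e.baseSet ∩ e'.baseSet) (w : AffModel F)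
    (y : F) :
    (affDualCoordChange V e e' x w).2 y =
      w.2 (e (e'.toOpenPartialHomeomorph.symm (x, y))).2 -
        w.2 (e (e'.toOpenPartialHomeomorph.symm (x, 0))).2 := by
  rw [affDualCoordChange_apply e e' hx, affDualTriv_symm e hx.1, affDualTriv_apply e' hx.2,
    coordEquiv_snd, coordEquiv_symm_apply, coordEquiv_symm_apply, mk_fiberEquiv_symm,
    mk_fiberEquiv_symm]
  ring

theorem continuousOn_affDualCoordChange (e e' : Trivialization F (π F A))
    [MemTrivializationAtlas e] [MemTrivializationAtlas e'] :
    ContinuousOn (affDualCoordChange V e e') (e.baseSet ∩ e'.baseSet) := by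
  rw [continuousOn_clm_apply]
  intro w
  have h1 : ContinuousOn (fun x => (affDualCoordChange V e e' x w).1)
      (e.baseSet ∩ e'.baseSet) := by
    refine ContinuousOn.congr ?_ fun x hx => affDualCoordChange_fst e e' hx w
    exact continuousOn_const.add (w.2.continuous.comp_continuousOn (continuousOn_transition e e' 0))
  have h2 : ContinuousOn (fun x => (affDualCoordChange V e e' x w).2)
      (e.baseSet ∩ e'.baseSet) := by
    rw [continuousOn_clm_apply]
    intro y
    refine ContinuousOn.congr ?_ fun x hx => affDualCoordChange_snd e e' hx w y
    exact (w.2.continuous.comp_continuousOn (continuousOn_transition e e' y)).sub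
      (w.2.continuous.comp_continuousOn (continuousOn_transition e e' 0))
  exact h1.prodMk h2

/-- The vector bundle structure of `A⁺`. -/
def affDualPrebundle : VectorPrebundle ℝ (AffModel F) (AffDual F V A) where
  pretrivializationAtlas :=
    {e' | ∃ (e : Trivialization F (π F A)) (_ : MemTrivializationAtlas e), e' = affDualTriv V e}
  pretrivialization_linear' := by
    rintro _ ⟨e, he, rfl⟩
    refine ⟨fun x hx => ?_⟩
    constructor
    · intro φ ψ
      rw [affDualTriv_apply e hx, affDualTriv_apply e hx, affDualTriv_apply e hx]
      exact map_add _ _ _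
    · intro c φ
      rw [affDualTriv_apply e hx, affDualTriv_apply e hx]
      exact map_smul _ _ _
  pretrivializationAt x := affDualTriv V (trivializationAt F A x)
  mem_base_pretrivializationAt x := mem_baseSet_trivializationAt F A x
  pretrivialization_mem_atlas x := ⟨_, inferInstance, rfl⟩
  exists_coordChange := by
    rintro _ ⟨e, he, rfl⟩ _ ⟨e', he', rfl⟩
    exact ⟨affDualCoordChange V e e', continuousOn_affDualCoordChange F V A e e',
      fun x hx w => affDualCoordChange_apply e e' hx w⟩
  totalSpaceMk_isInducing x := by
    have h : affDualTriv V (trivializationAt F A x) ∘ TotalSpace.mk x =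
        fun φ : AffDual F V A x => (x, coordEquiv V (trivializationAt F A x)
          (mem_baseSet_trivializationAt F A x) φ) := by
      funext φ
      exact affDualTriv_apply _ _ φ
    rw [h]
    exact (isInducing_prodMkRight x).comp ⟨rfl⟩

instance : TopologicalSpace (TotalSpace (AffModel F) (AffDual F V A)) :=
  (affDualPrebundle F V A).totalSpaceTopology

instance : FiberBundle (AffModel F) (AffDual F V A) :=
  (affDualPrebundle F V A).toFiberBundle

instance : VectorBundle ℝ (AffModel F) (AffDual F V A) :=
  (affDualPrebundle F V A).toVectorBundle

end Topological

section Smooth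

variable {EB B : Type*} [NormedAddCommGroup EB] [NormedSpace ℝ EB]
  [TopologicalSpace B] [ChartedSpace EB B]

/-- A family of linear maps on a finite-dimensional space is smooth if all its applications are. -/
theorem contMDiffAt_clm_of_apply {G G' : Type*} [NormedAddCommGroup G] [NormedSpace ℝ G]
    [FiniteDimensional ℝ G] [NormedAddCommGroup G'] [NormedSpace ℝ G'] {f : B → G →L[ℝ] G'}
    {x₀ : B} (h : ∀ y, ContMDiffAt 𝓘(ℝ, EB) 𝓘(ℝ, G') ∞ (fun x => f x y) x₀) :
    ContMDiffAt 𝓘(ℝ, EB) 𝓘(ℝ, G →L[ℝ] G') ∞ f x₀ := by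
  let d := Module.finrank ℝ G
  have hd : d = Module.finrank ℝ (Fin d → ℝ) := (Module.finrank_fin_fun ℝ).symm
  let e₁ := ContinuousLinearEquiv.ofFinrankEq hd
  let e₂ := (e₁.arrowCongr (1 : G' ≃L[ℝ] G')).trans (ContinuousLinearEquiv.piRing (Fin d))
  rw [← Function.id_comp f, ← e₂.symm_comp_self]
  refine e₂.symm.contDiff.contMDiff.contMDiffAt.comp x₀ (f := e₂ ∘ f) ?_
  exact contMDiffAt_pi_space.mpr fun i => h _

theorem contMDiffOn_clm_of_apply {G G' : Type*} [NormedAddCommGroup G] [NormedSpace ℝ G]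
    [FiniteDimensional ℝ G] [NormedAddCommGroup G'] [NormedSpace ℝ G'] {f : B → G →L[ℝ] G'}
    {s : Set B} (hs : IsOpen s)
    (h : ∀ y, ContMDiffOn 𝓘(ℝ, EB) 𝓘(ℝ, G') ∞ (fun x => f x y) s) :
    ContMDiffOn 𝓘(ℝ, EB) 𝓘(ℝ, G →L[ℝ] G') ∞ f s := fun _ hx =>
  (contMDiffAt_clm_of_apply fun y =>
    (h y).contMDiffAt (hs.mem_nhds hx)).contMDiffWithinAt

variable (F : Type*) [NormedAddCommGroup F] [NormedSpace ℝ F] (A : B → Type*)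
  [TopologicalSpace (TotalSpace F A)] [∀ x, TopologicalSpace (A x)] [FiberBundle F A]

section Manifold

variable (EB B) in
/-- Local diffeomorphisms of `B × F`. -/
def diffeoGroupoid : StructureGroupoid (B × F) :=
  Pregroupoid.groupoid
    { property := fun f s => ContMDiffOn (𝓘(ℝ, EB).prod 𝓘(ℝ, F)) (𝓘(ℝ, EB).prod 𝓘(ℝ, F)) ∞ f s
      comp := fun {_ _ _ _} hf hg _ _ _ => hg.comp' hf
      id_mem := contMDiffOn_id
      locality := fun {f u} _ H x hx => by
        obtain ⟨v, hv, hxv, h⟩ := H x hx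
        exact (h.contMDiffAt ((‹IsOpen u›.inter hv).mem_nhds ⟨hx, hxv⟩)).contMDiffWithinAt
      congr := fun {f g u} _ h hf => hf.congr h }

variable [SmoothTransitions EB F A]

variable (EB) in
theorem hasGroupoid_diffeoGroupoid : HasGroupoid (TotalSpace F A) (diffeoGroupoid EB B F) where
  compatible := by
    rintro _ _ ⟨e, he, rfl⟩ ⟨e', he', rfl⟩
    have : MemTrivializationAtlas e := ⟨he⟩
    have : MemTrivializationAtlas e' := ⟨he'⟩
    rw [diffeoGroupoid, mem_groupoid_of_pregroupoid]
    exact ⟨SmoothTransitions.contMDiffOn_transition e e',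
      SmoothTransitions.contMDiffOn_transition e' e⟩

/-- The total space of a smooth affine bundle is a smooth manifold. -/
instance isManifold_totalSpace [IsManifold 𝓘(ℝ, EB) ∞ B] :
    IsManifold (𝓘(ℝ, EB).prod 𝓘(ℝ, F)) ∞ (TotalSpace F A) := by
  have := hasGroupoid_diffeoGroupoid EB F A
  refine { StructureGroupoid.HasGroupoid.comp (diffeoGroupoid EB B F) ?_ with }
  intro e he
  rw [diffeoGroupoid, mem_groupoid_of_pregroupoid] at he
  rw [isLocalStructomorphOn_contDiffGroupoid_iff]
  exact he

end Manifold

variable (V : B → Type*) [∀ x, AddCommGroup (V x)] [∀ x, Module ℝ (V x)]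
  [∀ x, AddTorsor (V x) (A x)] [AffineBundle F V A]

variable {F A} in
theorem contMDiffOn_transition [SmoothTransitions EB F A] (e e' : Trivialization F (π F A))
    [MemTrivializationAtlas e] [MemTrivializationAtlas e'] (y : F) :
    ContMDiffOn 𝓘(ℝ, EB) 𝓘(ℝ, F) ∞ (fun x => (e (e'.toOpenPartialHomeomorph.symm (x, y))).2)
      (e.baseSet ∩ e'.baseSet) := by
  refine (contMDiff_snd (I := 𝓘(ℝ, EB)) (J := 𝓘(ℝ, F)) (M := B)).comp_contMDiffOn ?_
  refine (SmoothTransitions.contMDiffOn_transition (EB := EB) e' e).comp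
    (f := fun x : B => (x, y)) (contMDiffOn_id.prodMk contMDiffOn_const) ?_
  intro x hx
  have h : (x, y) ∈ e'.target := e'.mem_target.2 hx.2
  refine ⟨h, ?_⟩
  change e'.toOpenPartialHomeomorph.symm (x, y) ∈ e.source
  rw [e.mem_source]
  exact (e'.proj_symm_apply h) ▸ hx.1

variable [FiniteDimensional ℝ F]

theorem contMDiffOn_affDualCoordChange [SmoothTransitions EB F A]
    (e e' : Trivialization F (π F A)) [MemTrivializationAtlas e] [MemTrivializationAtlas e'] :
    ContMDiffOn 𝓘(ℝ, EB) 𝓘(ℝ, AffModel F →L[ℝ] AffModel F) ∞ (affDualCoordChange V e e')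
      (e.baseSet ∩ e'.baseSet) := by
  apply contMDiffOn_clm_of_apply (e.open_baseSet.inter e'.open_baseSet)
  intro w
  have h1 : ContMDiffOn 𝓘(ℝ, EB) 𝓘(ℝ, ℝ) ∞ (fun x => (affDualCoordChange V e e' x w).1)
      (e.baseSet ∩ e'.baseSet) := by
    refine ContMDiffOn.congr ?_ fun x hx => affDualCoordChange_fst e e' hx w
    exact contMDiffOn_const.add
      (w.2.contMDiff.comp_contMDiffOn (contMDiffOn_transition e e' 0))
  have h2 : ContMDiffOn 𝓘(ℝ, EB) 𝓘(ℝ, F →L[ℝ] ℝ) ∞ (fun x => (affDualCoordChange V e e' x w).2)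
      (e.baseSet ∩ e'.baseSet) := by
    apply contMDiffOn_clm_of_apply (e.open_baseSet.inter e'.open_baseSet)
    intro y
    refine ContMDiffOn.congr ?_ fun x hx => affDualCoordChange_snd e e' hx w y
    exact (w.2.contMDiff.comp_contMDiffOn (contMDiffOn_transition e e' y)).sub
      (w.2.contMDiff.comp_contMDiffOn (contMDiffOn_transition e e' 0))
  exact h1.prodMk_space h2

instance [SmoothTransitions EB F A] :
    (affDualPrebundle F V A).IsContMDiff 𝓘(ℝ, EB) ∞ where
  exists_contMDiffCoordChange := by
    rintro _ ⟨e, he, rfl⟩ _ ⟨e', he', rfl⟩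
    exact ⟨affDualCoordChange V e e', contMDiffOn_affDualCoordChange F A V e e',
      fun x hx w => affDualCoordChange_apply e e' hx w⟩

/-- `A⁺` is a smooth vector bundle. -/
instance [SmoothTransitions EB F A] :
    ContMDiffVectorBundle ∞ (AffModel F) (AffDual F V A) 𝓘(ℝ, EB) :=
  (affDualPrebundle F V A).contMDiffVectorBundle 𝓘(ℝ, EB)

end Smooth

end AffineBundles

/-! ### Jacobi structures on a manifold -/

section Jacobi

variable {E H : Type*} [NormedAddCommGroup E] [NormedSpace ℝ E] [TopologicalSpace H]
  (I : ModelWithCorners ℝ E H) (N : Type*) [TopologicalSpace N] [ChartedSpace H N]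

/-- A smooth `2`-vector field: an alternating bilinear form on each cotangent space, such that
`Λ(df, dg)` is smooth for all smooth functions `f`, `g`. -/
@[ext]
structure BivectorField where
  toFun : ∀ x : N, (TangentSpace I x →L[ℝ] ℝ) →ₗ[ℝ] (TangentSpace I x →L[ℝ] ℝ) →ₗ[ℝ] ℝ
  alternating : ∀ x α, toFun x α α = 0
  smooth : ∀ f g : N → ℝ, ContMDiff I 𝓘(ℝ, ℝ) ∞ f → ContMDiff I 𝓘(ℝ, ℝ) ∞ g →
    ContMDiff I 𝓘(ℝ, ℝ) ∞ fun x => toFun x (mvfderiv I f x) (mvfderiv I g x)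

/-- Smooth vector fields. -/
abbrev VectorField [IsManifold I ∞ N] : Type _ := Cₛ^∞⟮I; E, (TangentSpace I : N → Type _)⟯

variable {I N}

namespace BivectorField

instance : CoeFun (BivectorField I N) fun _ =>
    ∀ x : N, (TangentSpace I x →L[ℝ] ℝ) →ₗ[ℝ] (TangentSpace I x →L[ℝ] ℝ) →ₗ[ℝ] ℝ := ⟨toFun⟩

/-- The function `Λ(df, dg)`. -/
def onFun (P : BivectorField I N) (f g : N → ℝ) (x : N) : ℝ :=
  P x (mvfderiv I f x) (mvfderiv I g x)

/-- The Schouten bracket of two `2`-vector fields, evaluated on exact forms: `[P, Q](df, dg, dh)`.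
The sign is that of the bracket which makes multivector fields a graded Lie algebra and extends
the Lie bracket of vector fields by `[P, Q ∧ R] = [P, Q] ∧ R + (-1)^((p-1)q) Q ∧ [P, R]`, so that
`[X₁ ∧ X₂, Y₁ ∧ Y₂] = ∑ (-1)^(i+j) [X_i, Y_j] ∧ X_{3-i} ∧ Y_{3-j}`. -/
def schouten (P Q : BivectorField I N) (f g h : N → ℝ) (x : N) : ℝ :=
  -(P.onFun (Q.onFun f g) h x + P.onFun (Q.onFun g h) f x + P.onFun (Q.onFun h f) g x
    + Q.onFun (P.onFun f g) h x + Q.onFun (P.onFun g h) f x + Q.onFun (P.onFun h f) g x)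

/-- Poisson structures: `[Λ, Λ] = 0`. -/
def IsPoisson (P : BivectorField I N) : Prop :=
  ∀ f g h : N → ℝ, ContMDiff I 𝓘(ℝ, ℝ) ∞ f → ContMDiff I 𝓘(ℝ, ℝ) ∞ g →
    ContMDiff I 𝓘(ℝ, ℝ) ∞ h → ∀ x, P.schouten P f g h x = 0

/-- `X` is the hamiltonian vector field `#_P(dh)` of `h`: `α(X) = P(dh, α)` for all covectors. -/
def IsHamiltonian (P : BivectorField I N) (h : N → ℝ) (X : ∀ x : N, TangentSpace I x) : Prop :=
  ∀ (x : N) (α : TangentSpace I x →L[ℝ] ℝ), α (X x) = P x (mvfderiv I h x) α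

end BivectorField

/-- The bivector `u ∧ v` evaluated on two covectors. -/
def wedgeAt {x : N} (u v : TangentSpace I x) (α β : TangentSpace I x →L[ℝ] ℝ) : ℝ :=
  α u * β v - α v * β u

section

variable [IsManifold I ∞ N]

/-- The derivative `X(f)` of a function along a vector field. -/
def along (X : VectorField I N) (f : N → ℝ) (x : N) : ℝ := mvfderiv I f x (X x)

/-- The Schouten bracket of a vector field and a `2`-vector field, that is, the Lie derivative
`𝓛_X P`, evaluated on exact forms: `[X, P](df, dg)`. -/
def schoutenVector (X : VectorField I N) (P : BivectorField I N) (f g : N → ℝ) (x : N) : ℝ :=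
  along X (P.onFun f g) x - P.onFun (along X f) g x - P.onFun f (along X g) x

/-- The `3`-vector field `X ∧ P`, evaluated on exact forms: `(X ∧ P)(df, dg, dh)`. -/
def wedge (X : VectorField I N) (P : BivectorField I N) (f g h : N → ℝ) (x : N) : ℝ :=
  along X f x * P.onFun g h x + along X g x * P.onFun h f x + along X h x * P.onFun f g x

end

variable (I N) in
/-- A Jacobi structure `(Λ, E)`: `[Λ, Λ] = -2 E ∧ Λ` and `[E, Λ] = 0`. -/
@[ext]
structure JacobiStructure [IsManifold I ∞ N] where
  biv : BivectorField I N
  vec : VectorField I N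
  schouten_biv_biv : ∀ f g h : N → ℝ, ContMDiff I 𝓘(ℝ, ℝ) ∞ f → ContMDiff I 𝓘(ℝ, ℝ) ∞ g →
    ContMDiff I 𝓘(ℝ, ℝ) ∞ h → ∀ x, biv.schouten biv f g h x = -2 * wedge vec biv f g h x
  schouten_vec_biv : ∀ f g : N → ℝ, ContMDiff I 𝓘(ℝ, ℝ) ∞ f → ContMDiff I 𝓘(ℝ, ℝ) ∞ g →
    ∀ x, schoutenVector vec biv f g x = 0

namespace JacobiStructure

variable [IsManifold I ∞ N]

/-- The Jacobi bracket `{f, g} = Λ(df, dg) + f E(g) - g E(f)`. -/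
def bracket (J : JacobiStructure I N) (f g : N → ℝ) (x : N) : ℝ :=
  J.biv.onFun f g x + f x * along J.vec g x - g x * along J.vec f x

/-- `J` is the restriction of `J'` along the inclusion `j` of a submanifold: the tensors of `J'` at
the points of the submanifold are the push-forwards of those of `J`. -/
def IsRestriction {E' H' N' : Type*} [NormedAddCommGroup E'] [NormedSpace ℝ E']
    [TopologicalSpace H'] {I' : ModelWithCorners ℝ E' H'} [TopologicalSpace N']
    [ChartedSpace H' N'] [IsManifold I' ∞ N'] (j : N → N') (J : JacobiStructure I N)
    (J' : JacobiStructure I' N') : Prop :=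
  ∀ x : N,
    (∀ α β : TangentSpace I' (j x) →L[ℝ] ℝ,
      J'.biv (j x) α β = J.biv x (α ∘L mfderiv I I' j x) (β ∘L mfderiv I I' j x)) ∧
    J'.vec (j x) = mfderiv I I' j x (J.vec x)

end JacobiStructure

end Jacobi

/-! ### Vector bundles and Lie algebroids -/

section LieAlgebroids

variable {EB : Type*} [NormedAddCommGroup EB] [NormedSpace ℝ EB]
  {B : Type*} [TopologicalSpace B] [ChartedSpace EB B]
  (G : Type*) [NormedAddCommGroup G] [NormedSpace ℝ G]
  (E : B → Type*) [∀ x, AddCommGroup (E x)] [∀ x, Module ℝ (E x)]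
  [∀ x, TopologicalSpace (E x)] [TopologicalSpace (TotalSpace G E)] [FiberBundle G E]
  [VectorBundle ℝ G E]

/-- Smooth global sections of a vector bundle over `B`. -/
abbrev Sections : Type _ := Cₛ^∞⟮𝓘(ℝ, EB); G, E⟯

variable {G E} in
/-- The product of a smooth function and a smooth section. -/
def mulSection (f : C^∞⟮𝓘(ℝ, EB), B; ℝ⟯) (X : Sections (EB := EB) G E) :
    Sections (EB := EB) G E :=
  ⟨fun x => f x • X x, f.contMDiff.smul_section X.contMDiff⟩

variable (EB) in
/-- A Lie algebroid structure on a smooth vector bundle over `B`: a Lie bracket of sections and a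
homomorphism of vector bundles to the tangent bundle (the anchor), subject to the Leibniz rule. -/
structure LieAlgebroid [IsManifold 𝓘(ℝ, EB) ∞ B] where
  bracket : Sections (EB := EB) G E →ₗ[ℝ] Sections (EB := EB) G E →ₗ[ℝ] Sections (EB := EB) G E
  bracket_self : ∀ X, bracket X X = 0
  jacobi : ∀ X Y Z,
    bracket X (bracket Y Z) = bracket (bracket X Y) Z + bracket Y (bracket X Z)
  anchor : ∀ x : B, E x →ₗ[ℝ] TangentSpace 𝓘(ℝ, EB) x
  anchor_smooth : ∀ X : Sections (EB := EB) G E,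
    ContMDiff 𝓘(ℝ, EB) 𝓘(ℝ, EB).tangent ∞
      fun x => (⟨x, anchor x (X x)⟩ : TangentBundle 𝓘(ℝ, EB) B)
  leibniz : ∀ (X Y : Sections (EB := EB) G E) (f : C^∞⟮𝓘(ℝ, EB), B; ℝ⟯) (x : B),
    bracket X (mulSection f Y) x =
      f x • bracket X Y x + mvfderiv 𝓘(ℝ, EB) f x (anchor x (X x)) • Y x

/-- The fibres of the dual vector bundle. -/
abbrev DualBundle : B → Type _ := fun x => E x →L[ℝ] Bundle.Trivial B ℝ x

/-- The total space of the dual vector bundle. -/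
abbrev DualSpace : Type _ := TotalSpace (G →L[ℝ] ℝ) (DualBundle E)

variable {G E} in
/-- The linear function `ι_X` on the dual bundle defined by a section `X`. -/
def linFun (X : Sections (EB := EB) G E) (ψ : DualSpace G E) : ℝ := ψ.2 (X ψ.1)

variable (EB) in
/-- Smooth functions on the total space that are linear along the fibres. -/
def IsLinearFunction (f : TotalSpace G E → ℝ) : Prop :=
  ContMDiff (𝓘(ℝ, EB).prod 𝓘(ℝ, G)) 𝓘(ℝ, ℝ) ∞ f ∧ ∀ x, IsLinearMap ℝ fun v : E x => f ⟨x, v⟩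

variable {G E} in
/-- A `2`-vector field on the total space is linear if it is closed on linear functions. -/
def BivectorField.IsLinear
    (P : BivectorField (𝓘(ℝ, EB).prod 𝓘(ℝ, G)) (TotalSpace G E)) : Prop :=
  ∀ f g : TotalSpace G E → ℝ, IsLinearFunction EB G E f → IsLinearFunction EB G E g →
    IsLinearFunction EB G E (P.onFun f g)

variable {G E} in
/-- The `2`-vector field on the dual bundle induces the bracket of the Lie algebroid:
`Λ(dι_X, dι_Y) = ι_[X, Y]`. -/
def LieAlgebroid.IsInducedBy [IsManifold 𝓘(ℝ, EB) ∞ B] (L : LieAlgebroid EB G E)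
    (P : BivectorField (𝓘(ℝ, EB).prod 𝓘(ℝ, G →L[ℝ] ℝ)) (DualSpace G E)) : Prop :=
  ∀ X Y : Sections (EB := EB) G E, P.onFun (linFun X) (linFun Y) = linFun (L.bracket X Y)

variable (EB) {G E} in
/-- The Liouville vector field of a vector bundle: its value at `v` is the velocity at `t = 1` of
the curve `t ↦ t v`. -/
def liouville (v : TotalSpace G E) : TangentSpace (𝓘(ℝ, EB).prod 𝓘(ℝ, G)) v :=
  mfderiv 𝓘(ℝ, ℝ) (𝓘(ℝ, EB).prod 𝓘(ℝ, G)) (fun t : ℝ => (⟨v.1, t • v.2⟩ : TotalSpace G E)) 1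
    (1 : ℝ)

end LieAlgebroids

/-! ### Affine functions and sections of `A⁺` -/

section AffineFunctions

variable {EB : Type*} [NormedAddCommGroup EB] [NormedSpace ℝ EB]
  {B : Type*} [TopologicalSpace B] [ChartedSpace EB B]
  {F : Type*} [NormedAddCommGroup F] [NormedSpace ℝ F]
  {V : B → Type*} [∀ x, AddCommGroup (V x)] [∀ x, Module ℝ (V x)]
  {A : B → Type*} [∀ x, AddTorsor (V x) (A x)]
  [TopologicalSpace (TotalSpace F A)] [∀ x, TopologicalSpace (A x)] [FiberBundle F A]

variable (EB V) in
/-- Smooth functions on `A` that are affine along the fibres. -/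
def IsAffineFunction (f : TotalSpace F A → ℝ) : Prop :=
  ContMDiff (𝓘(ℝ, EB).prod 𝓘(ℝ, F)) 𝓘(ℝ, ℝ) ∞ f ∧
    ∀ x, ∃ φ : AffDual F V A x, ∀ q : A x, f ⟨x, q⟩ = φ q

variable (EB F V A) in
theorem isAffineFunction_one : IsAffineFunction EB V (fun _ : TotalSpace F A => (1 : ℝ)) :=
  ⟨contMDiff_const, fun x => ⟨(AffineMap.const ℝ (A x) (1 : ℝ) : A x →ᵃ[ℝ] ℝ), fun _ => rfl⟩⟩

theorem contMDiffAt_trivialization_symm (x₀ : B) (y : F) :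
    ContMDiffAt 𝓘(ℝ, EB) (𝓘(ℝ, EB).prod 𝓘(ℝ, F)) ∞
      (fun x => (trivializationAt F A x₀).toOpenPartialHomeomorph.symm (x, y)) x₀ := by
  set e := trivializationAt F A x₀ with he
  have hx₀ : x₀ ∈ e.baseSet := mem_baseSet_trivializationAt F A x₀
  have hmem : ∀ᶠ x in nhds x₀, (x, y) ∈ e.target := by
    filter_upwards [e.open_baseSet.mem_nhds hx₀] with x hx using e.mem_target.2 hx
  have hp : (e.toOpenPartialHomeomorph.symm (x₀, y)).proj = x₀ :=
    e.proj_symm_apply (e.mem_target.2 hx₀)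
  rw [contMDiffAt_totalSpace, hp, ← he]
  constructor
  · refine contMDiffAt_id.congr_of_eventuallyEq ?_
    filter_upwards [hmem] with x hx using e.proj_symm_apply hx
  · refine (contMDiffAt_const (c := y)).congr_of_eventuallyEq ?_
    filter_upwards [hmem] with x hx
    exact congrArg Prod.snd (e.apply_symm_apply hx)

variable [AffineBundle F V A] [FiniteDimensional ℝ F]

/-- The section of `A⁺` associated with an affine function on `A`: its value at `x` is the
restriction of the function to the fibre `A x`. -/
def toSection {f : TotalSpace F A → ℝ} (hf : IsAffineFunction EB V f) :
    Sections (EB := EB) (AffModel F) (AffDual F V A) where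
  toFun x := (hf.2 x).choose
  contMDiff_toFun := by
    intro x₀
    rw [contMDiffAt_section]
    set e := trivializationAt F A x₀ with he
    have hx₀ : x₀ ∈ e.baseSet := mem_baseSet_trivializationAt F A x₀
    have hn := e.open_baseSet.mem_nhds hx₀
    have hs : ∀ y : F, ContMDiffAt 𝓘(ℝ, EB) 𝓘(ℝ, ℝ) ∞
        (fun x => f (e.toOpenPartialHomeomorph.symm (x, y))) x₀ := fun y =>
      (hf.1 _).comp x₀ (contMDiffAt_trivialization_symm x₀ y)
    have hv : ∀ x (hx : x ∈ e.baseSet) (y : F), (show AffDual F V A x from (hf.2 x).choose)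
        ((fiberEquiv V e hx).symm y) = f (e.toOpenPartialHomeomorph.symm (x, y)) := by
      intro x hx y
      rw [← mk_fiberEquiv_symm V e hx y]
      exact ((hf.2 x).choose_spec _).symm
    have h1 : ContMDiffAt 𝓘(ℝ, EB) 𝓘(ℝ, ℝ) ∞
        (fun x => (affDualTriv V e ⟨x, (hf.2 x).choose⟩).2.1) x₀ := by
      refine (hs 0).congr_of_eventuallyEq ?_
      filter_upwards [hn] with x hx
      rw [affDualTriv_apply e hx, coordEquiv_fst]
      exact hv x hx 0
    have h2 : ContMDiffAt 𝓘(ℝ, EB) 𝓘(ℝ, F →L[ℝ] ℝ) ∞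
        (fun x => (affDualTriv V e ⟨x, (hf.2 x).choose⟩).2.2) x₀ := by
      apply contMDiffAt_clm_of_apply
      intro y
      refine ((hs y).sub (hs 0)).congr_of_eventuallyEq ?_
      filter_upwards [hn] with x hx
      rw [affDualTriv_apply e hx, coordEquiv_snd]
      exact congrArg₂ (· - ·) (hv x hx y) (hv x hx 0)
    exact h1.prodMk_space h2

theorem toSection_apply {f : TotalSpace F A → ℝ} (hf : IsAffineFunction EB V f) (x : B)
    (q : A x) : toSection hf x q = f ⟨x, q⟩ :=
  ((hf.2 x).choose_spec q).symm

variable (EB F V A) in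
/-- The distinguished section of `A⁺` defined by the constant function `1`. -/
def oneSection : Sections (EB := EB) (AffModel F) (AffDual F V A) :=
  toSection (isAffineFunction_one EB F V A)

variable (F V A) in
/-- The vector hull `Â = (A⁺)*` of `A`. -/
abbrev Hull : Type _ := DualSpace (AffModel F) (AffDual F V A)

/-- Evaluation of affine functions at a point of `A`. -/
def evalAt {x : B} (q : A x) : AffDual F V A x →L[ℝ] ℝ where
  toFun φ := φ q
  map_add' _ _ := rfl
  map_smul' _ _ := rfl
  cont := by
    have h : ∀ φ : AffDual F V A x, φ q =
        (coordEquiv V (trivializationAt F A x) (mem_baseSet_trivializationAt F A x) φ).1 +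
        (coordEquiv V (trivializationAt F A x) (mem_baseSet_trivializationAt F A x) φ).2
          (trivializationAt F A x ⟨x, q⟩).2 := by
      intro φ
      rw [← coordEquiv_symm_apply _ (mem_baseSet_trivializationAt F A x), LinearEquiv.symm_apply_apply]
    have hc := continuous_coordEquiv F V A x
    refine Continuous.congr (hc.fst.add (hc.snd.clm_apply continuous_const)) fun φ => (h φ).symm

variable (F V A) in
/-- The inclusion of `A` in its vector hull. -/
def hullIncl (p : TotalSpace F A) : Hull F V A := ⟨p.1, evalAt p.2⟩

variable [SmoothTransitions EB F A] [IsManifold 𝓘(ℝ, EB) ∞ B]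

variable (V) in
/-- A Jacobi structure on `A` is affine if its bracket is closed on affine functions. -/
def JacobiStructure.IsAffine
    (J : JacobiStructure (𝓘(ℝ, EB).prod 𝓘(ℝ, F)) (TotalSpace F A)) : Prop :=
  ∀ a b : TotalSpace F A → ℝ, IsAffineFunction EB V a → IsAffineFunction EB V b →
    IsAffineFunction EB V (J.bracket a b)

/-- The bracket of affine functions corresponds to the bracket of sections of `A⁺`. -/
def JacobiStructure.Matches
    (J : JacobiStructure (𝓘(ℝ, EB).prod 𝓘(ℝ, F)) (TotalSpace F A))
    (L : LieAlgebroid EB (AffModel F) (AffDual F V A)) : Prop :=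
  ∀ (a b : TotalSpace F A → ℝ) (ha : IsAffineFunction EB V a) (hb : IsAffineFunction EB V b),
    ∃ hab : IsAffineFunction EB V (J.bracket a b),
      toSection hab = L.bracket (toSection ha) (toSection hb)

end AffineFunctions

end

end AffineJacobi

open AffineJacobi

namespace AffineJacobi

noncomputable section

open Filter Topology

/-! ### Coframes defined by functions -/

section NormedCoframe

variable {E : Type*} [NormedAddCommGroup E] [NormedSpace ℝ E]

/-! Tensors are tested on functions whose differentials span the cotangent spaces. On `Â` these are
the sums `ι_X + π^* f` (`surjective_fiberwiseAffineDiff`). Where some `ι_Z` is nonzero the functions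
`ι_X` alone suffice (`exists_mvfderiv_linFun_eq`). For `Z` the section `1`, which has no zeros, such
points form a dense set (`dense_linFun_ne_zero`) that contains `A`, where `ι_1 = 1`.

The Poisson tensor is prescribed on pairs `(X, f)` by `ι_[X,Y] + ρ(X)g - ρ(Y)f`. By the Leibniz rule
this depends only on the differentials of `ι_X + π^* f` and `ι_Y + π^* g`
(`LieAlgebroid.form_eq_zero`), so it descends to covectors. Density and continuity make it the only
bivector inducing the bracket.

The Jacobi equations are tensorial: at a critical point of one argument only second derivatives of
that argument survive, and they cancel because the Hessian is symmetric (`exists_hessian`,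
`BivectorField.cyclic_eq_zero`, `schoutenVector_eq_zero`). It is therefore enough to check them on
generators at the points of a dense set (`jacobi_equations_of_generators`). On the functions `ι_X`
one has `Δ(ι_X) = ι_X` and `E(ι_X) = ι_[1,X]`, and both equations for `(Λ - Δ ∧ E, E)` reduce to the
Jacobi identity of the Lie algebroid. The Poisson condition is the same computation with `E = 0`.

At a point of `A` the covectors that vanish on `A` are the multiples of `dι_1`, and these are
annihilated by `E` and by `Λ - Δ ∧ E`, because `E(ι_1) = 0` and `Δ(ι_1) = 1` there. Hence both
tensors restrict to `A` (`JacobiStructure.exists_restriction`). In the Jacobi bracket of `ι_X` and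
`ι_Y` the contribution of `Δ ∧ E` cancels the terms in `E`, which leaves `ι_[X,Y]`. Affine functions
are restrictions of linear ones, so the restricted structure has the required bracket. Since `{1, f}
= E(f)`, the brackets of affine functions determine the structure
(`JacobiStructure.ext_of_bracket`). -/

theorem sum_fderiv_symm {ι : Type*} [Fintype ι] {φ c : ι → E → ℝ} {f : E → ℝ} {z : E}
    (hφ : ∀ i, ContDiffAt ℝ ∞ (φ i) z) (hf : ContDiffAt ℝ ∞ f z)
    (hc : ∀ i, ContDiffAt ℝ ∞ (c i) z)
    (h : ∀ᶠ y in 𝓝 z, fderiv ℝ f y = ∑ i, c i y • fderiv ℝ (φ i) y) (h0 : ∀ i, c i z = 0)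
    (u v : E) :
    ∑ i, fderiv ℝ (c i) z u * fderiv ℝ (φ i) z v = ∑ i, fderiv ℝ (c i) z v * fderiv ℝ (φ i) z u := by
  -- As the `c i` vanish at `z`, differentiating `df = ∑ c_i dφ_i` there gives `D²f = ∑ dc_i ⊗
  -- dφ_i`; the claim is the symmetry of `D²f`.
  have hs := hf.isSymmSndFDerivAt (by simpa using ENat.LEInfty.out)
  have h1 : HasFDerivAt (fderiv ℝ f)
      (∑ i, (c i z • fderiv ℝ (fderiv ℝ (φ i)) z +
        (fderiv ℝ (c i) z).smulRight (fderiv ℝ (φ i) z))) z := by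
    refine HasFDerivAt.congr_of_eventuallyEq ?_ h
    refine HasFDerivAt.fun_sum fun i _ => ?_
    exact ((hc i).differentiableAt (by simp)).hasFDerivAt.smul
      (((hφ i).fderiv_right (m := ∞) (by simp)).differentiableAt (by simp)).hasFDerivAt
  have := hs u v
  rw [h1.fderiv] at this
  simpa [h0] using this

variable [FiniteDimensional ℝ E]

/-- If the differentials of the `φ i` span the dual space at `z`, the differential of a smooth
function is a combination of them near `z`, with smooth coefficients. -/
theorem exists_fderiv_eq_sum {ι : Type*} [Fintype ι] {φ : ι → E → ℝ} {f : E → ℝ} {z : E}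
    (hφ : ∀ i, ContDiffAt ℝ ∞ (φ i) z) (hf : ContDiffAt ℝ ∞ f z)
    (hs : ∀ α : E →L[ℝ] ℝ, ∃ a : ι → ℝ, ∑ i, a i • fderiv ℝ (φ i) z = α) :
    ∃ c : ι → E → ℝ, (∀ i, ContDiffAt ℝ ∞ (c i) z) ∧
      (∀ᶠ y in 𝓝 z, fderiv ℝ f y = ∑ i, c i y • fderiv ℝ (φ i) y) ∧
      (fderiv ℝ f z = 0 → ∀ i, c i z = 0) := by
  choose a ha using hs
  set T : E → (ι → ℝ) →L[ℝ] (E →L[ℝ] ℝ) := fun y =>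
    ∑ i, (ContinuousLinearMap.proj (R := ℝ) (φ := fun _ : ι => ℝ) i).smulRight
      (fderiv ℝ (φ i) y) with hT
  have hTa : ∀ y (w : ι → ℝ), T y w = ∑ i, w i • fderiv ℝ (φ i) y := by
    intro y w
    simp [hT]
  have hTs : ContDiffAt ℝ ∞ T z := by
    refine ContDiffAt.sum fun i _ => ?_
    have h := (hφ i).fderiv_right (m := ∞) (by simp)
    exact contDiffAt_const.smulRight h
  have hsurj : Function.Surjective (T z : (ι → ℝ) →ₗ[ℝ] (E →L[ℝ] ℝ)) := fun α =>
    ⟨a α, by simpa [hTa] using ha α⟩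
  obtain ⟨R, hR⟩ := (T z : (ι → ℝ) →ₗ[ℝ] (E →L[ℝ] ℝ)).exists_rightInverse_of_surjective
    (LinearMap.range_eq_top.2 hsurj)
  -- The right inverse is frozen at `z`. The map `T y ∘ R'` is the identity at `y = z`, hence
  -- invertible nearby, and `R' ((T y ∘ R')⁻¹ df)` solves for the coefficients smoothly. Being
  -- linear in `df`, it vanishes where `df` does. No independence of the `dφ_i` is needed.
  set R' : (E →L[ℝ] ℝ) →L[ℝ] (ι → ℝ) := LinearMap.toContinuousLinearMap R with hR'
  have hz : (T z) ∘L R' = ContinuousLinearMap.id ℝ (E →L[ℝ] ℝ) := by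
    ext1 α
    exact LinearMap.congr_fun hR α
  have hTR : ContDiffAt ℝ ∞ (fun y => (T y) ∘L R') z := hTs.clm_comp contDiffAt_const
  have hinv : ContDiffAt ℝ ∞ (fun y => ((T y) ∘L R').inverse) z := by
    have h1 := contDiffAt_map_inverse (n := ∞) (ContinuousLinearEquiv.refl ℝ (E →L[ℝ] ℝ))
    refine ContDiffAt.comp z (g := ContinuousLinearMap.inverse) ?_ hTR
    rw [hz]
    exact h1
  have hDf : ContDiffAt ℝ ∞ (fderiv ℝ f) z := hf.fderiv_right (by simp)
  have hc : ContDiffAt ℝ ∞ (fun y => R' (((T y) ∘L R').inverse (fderiv ℝ f y))) z :=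
    contDiffAt_const.clm_apply (hinv.clm_apply hDf)
  refine ⟨fun i y => R' (((T y) ∘L R').inverse (fderiv ℝ f y)) i, fun i => ?_, ?_, fun h i => ?_⟩
  · exact (contDiffAt_pi.1 hc) i
  · have h1 := ContinuousLinearEquiv.nhds (ContinuousLinearEquiv.refl ℝ (E →L[ℝ] ℝ))
    have h2 : ∀ᶠ y in 𝓝 z, (T y) ∘L R' ∈
        range (ContinuousLinearEquiv.toContinuousLinearMap (σ₁₂ := RingHom.id ℝ)
          (M₁ := E →L[ℝ] ℝ) (M₂ := E →L[ℝ] ℝ)) := by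
      refine hTR.continuousAt.eventually ?_
      beta_reduce
      rw [hz]
      exact h1
    filter_upwards [h2] with y hy
    obtain ⟨e, he⟩ := hy
    rw [← hTa, ← he]
    change _ = (T y ∘L R') _
    rw [← he]
    simp
  · simp [h]

end NormedCoframe

/-! ### Coframes on manifolds without boundary, read in extended charts. -/

section ManifoldCoframe

variable {E : Type*} [NormedAddCommGroup E] [NormedSpace ℝ E]
  {H : Type*} [TopologicalSpace H] {I : ModelWithCorners ℝ E H}
  {N : Type*} [TopologicalSpace N] [ChartedSpace H N]

theorem mvfderiv_comp_apply' {E' H' N' G : Type*} [NormedAddCommGroup E'] [NormedSpace ℝ E']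
    [TopologicalSpace H'] {I' : ModelWithCorners ℝ E' H'} [TopologicalSpace N'] [ChartedSpace H' N']
    [NormedAddCommGroup G] [NormedSpace ℝ G] {g : N' → G} {f : N → N'} {x : N}
    (hg : MDifferentiableAt I' 𝓘(ℝ, G) g (f x)) (hf : MDifferentiableAt I I' f x)
    (v : TangentSpace I x) :
    mvfderiv I (fun y => g (f y)) x v = mvfderiv I' g (f x) (mfderiv I I' f x v) :=
  mfderiv_comp_apply x hg hf v

theorem mvfderiv_comp_fderiv {G G' : Type*} [NormedAddCommGroup G] [NormedSpace ℝ G]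
    [NormedAddCommGroup G'] [NormedSpace ℝ G'] {g : G → G'} {f : N → G} {x : N}
    (hg : DifferentiableAt ℝ g (f x)) (hf : MDifferentiableAt I 𝓘(ℝ, G) f x)
    (v : TangentSpace I x) :
    mvfderiv I (fun y => g (f y)) x v = fderiv ℝ g (f x) (mvfderiv I f x v) := by
  have h := mfderiv_comp_apply x hg.mdifferentiableAt hf v
  rw [mfderiv_eq_fderiv] at h
  exact h

theorem mvfderiv_congr {G : Type*} [NormedAddCommGroup G] [NormedSpace ℝ G] {f g : N → G} {x : N}
    (h : f =ᶠ[𝓝 x] g) : mvfderiv I f x = mvfderiv I g x := by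
  ext1 v
  exact DFunLike.congr_fun (h.mfderiv_eq (I := I) (I' := 𝓘(ℝ, G))) v

theorem exists_equiv_mvfderiv_extChartAt [IsManifold I ∞ N] (x : N) :
    ∃ Ψ : TangentSpace I x ≃L[ℝ] E, ∀ v, mvfderiv I (extChartAt I x) x v = Ψ v := by
  have hM : IsManifold I 1 N := IsManifold.of_le (n := ∞) (by simp)
  obtain ⟨Ψ, hΨ⟩ := isInvertible_mfderiv_extChartAt (I := I) (mem_extChartAt_source (I := I) x)
  exact ⟨Ψ, fun v => (DFunLike.congr_fun hΨ v).symm⟩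

variable [I.Boundaryless]

theorem contDiffAt_comp_extChartAt_symm {f : N → ℝ} {x : N} (hf : ContMDiffAt I 𝓘(ℝ, ℝ) ∞ f x) :
    ContDiffAt ℝ ∞ (f ∘ (extChartAt I x).symm) (extChartAt I x x) := by
  have h := contMDiffAt_iff_source.1 hf
  rw [I.range_eq_univ, contMDiffWithinAt_univ] at h
  exact h.contDiffAt

variable [IsManifold I ∞ N]

/-- The chart stays the one at `x` while the point moves, because coefficients found in this chart
are later differentiated at `x`. -/
theorem eventually_mvfderiv_eq {f : N → ℝ} {x : N} (hf : ContMDiffAt I 𝓘(ℝ, ℝ) ∞ f x) :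
    ∀ᶠ y in 𝓝 x, ∀ v : TangentSpace I y, mvfderiv I f y v =
      fderiv ℝ (f ∘ (extChartAt I x).symm) (extChartAt I x y) (mvfderiv I (extChartAt I x) y v) := by
  have h1 : ∀ᶠ z in 𝓝 (extChartAt I x x),
      DifferentiableAt ℝ (f ∘ (extChartAt I x).symm) z := by
    -- Smoothness at a point gives each finite order on a neighbourhood, but not infinite order on a
    -- single one; order one is enough.
    have h2 := (contDiffAt_comp_extChartAt_symm hf).of_le (m := 1) (by simp)
    filter_upwards [h2.eventually (by simp)] with z hz
    exact hz.differentiableAt (by simp)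
  filter_upwards [(continuousAt_extChartAt (I := I) x).eventually h1,
    (isOpen_extChartAt_source (I := I) x).mem_nhds (mem_extChartAt_source (I := I) x)] with y hy hys v
  have h3 : f =ᶠ[𝓝 y] fun w => (f ∘ (extChartAt I x).symm) (extChartAt I x w) := by
    filter_upwards [(isOpen_extChartAt_source (I := I) x).mem_nhds hys] with w hw
    exact congrArg f ((extChartAt I x).left_inv hw).symm
  have h4 : MDifferentiableAt I 𝓘(ℝ, E) (extChartAt I x) y :=
    (contMDiffAt_extChartAt' (n := ∞) (by rwa [← extChartAt_source I x])).mdifferentiableAt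
      (by simp)
  rw [mvfderiv_congr h3, mvfderiv_comp_fderiv hy h4]

variable [FiniteDimensional ℝ E]

/-- If the differentials of the `φ i` span the cotangent space at `x`, the differential of a smooth
function `f` is a combination of them near `x`, with smooth coefficients. If `df = 0` at `x`, the
second derivative of `f` at `x` is read off from the coefficients. -/
theorem exists_mvfderiv_eq_sum {ι : Type*} [Fintype ι] {φ : ι → N → ℝ} {f : N → ℝ} {x : N}
    (hφ : ∀ i, ContMDiffAt I 𝓘(ℝ, ℝ) ∞ (φ i) x) (hf : ContMDiffAt I 𝓘(ℝ, ℝ) ∞ f x)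
    (hs : Submodule.span ℝ (range fun i => mvfderiv I (φ i) x) = ⊤) :
    ∃ c : ι → N → ℝ, (∀ i, ContMDiffAt I 𝓘(ℝ, ℝ) ∞ (c i) x) ∧
      (∀ᶠ y in 𝓝 x, mvfderiv I f y = ∑ i, c i y • mvfderiv I (φ i) y) ∧
      (mvfderiv I f x = 0 → (∀ i, c i x = 0) ∧
        ∀ u v : TangentSpace I x, ∑ i, mvfderiv I (c i) x u * mvfderiv I (φ i) x v =
          ∑ i, mvfderiv I (c i) x v * mvfderiv I (φ i) x u) := by
  obtain ⟨Ψ, hΨ⟩ := exists_equiv_mvfderiv_extChartAt (I := I) x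
  have hφ' := fun i => contDiffAt_comp_extChartAt_symm (hφ i)
  have hf' := contDiffAt_comp_extChartAt_symm hf
  have hev := eventually_all.2 fun i => eventually_mvfderiv_eq (hφ i)
  obtain ⟨c, hc, hcf, hc0⟩ := exists_fderiv_eq_sum hφ' hf' (by
    intro α
    have h1 : α.comp (Ψ : TangentSpace I x →L[ℝ] E) ∈
        Submodule.span ℝ (range fun i => mvfderiv I (φ i) x) := hs ▸ Submodule.mem_top
    obtain ⟨a, ha⟩ := (Submodule.mem_span_range_iff_exists_fun ℝ).1 h1
    refine ⟨a, ?_⟩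
    ext1 w
    have h2 := DFunLike.congr_fun ha (Ψ.symm w)
    simp only [sum_apply, smul_apply, hev.self_of_nhds, hΨ,
      Ψ.apply_symm_apply, ContinuousLinearMap.comp_apply, ContinuousLinearEquiv.coe_coe] at h2 ⊢
    exact h2)
  have hdc : ∀ i v, mvfderiv I (fun y => c i (extChartAt I x y)) x v =
      fderiv ℝ (c i) (extChartAt I x x) (mvfderiv I (extChartAt I x) x v) := fun i v =>
    mvfderiv_comp_fderiv ((hc i).differentiableAt (by simp))
      (mdifferentiableAt_extChartAt (mem_chart_source H x)) v
  refine ⟨fun i y => c i (extChartAt I x y), fun i =>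
    (hc i).contMDiffAt.comp x contMDiffAt_extChartAt, ?_, fun h0 => ?_⟩
  · filter_upwards [hev, eventually_mvfderiv_eq hf,
      (continuousAt_extChartAt (I := I) x).eventually hcf] with y h1 h2 h3
    ext1 w
    rw [h2, h3]
    simp only [sum_apply, smul_apply, h1]
  · have h1 : fderiv ℝ (f ∘ (extChartAt I x).symm) (extChartAt I x x) = 0 := by
      ext1 w
      have h2 := (eventually_mvfderiv_eq hf).self_of_nhds (Ψ.symm w)
      rw [h0, hΨ, Ψ.apply_symm_apply] at h2
      exact h2.symm
    refine ⟨hc0 h1, fun u v => ?_⟩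
    simp only [hdc, hev.self_of_nhds]
    exact sum_fderiv_symm hφ' hf' hc hcf (hc0 h1) _ _

end ManifoldCoframe

/-! ### Smoothness of tensors tested on functions -/

section Tensors

variable {E : Type*} [NormedAddCommGroup E] [NormedSpace ℝ E]
  {H : Type*} [TopologicalSpace H] {I : ModelWithCorners ℝ E H}
  {N : Type*} [TopologicalSpace N] [ChartedSpace H N]

instance [FiniteDimensional ℝ E] (x : N) : FiniteDimensional ℝ (TangentSpace I x) :=
  inferInstanceAs (FiniteDimensional ℝ E)

instance [FiniteDimensional ℝ E] (x : N) : FiniteDimensional ℝ (TangentSpace I x →L[ℝ] ℝ) :=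
  inferInstanceAs (FiniteDimensional ℝ (E →L[ℝ] ℝ))

theorem exists_apply_eq [FiniteDimensional ℝ E] (T : (E →L[ℝ] ℝ) →ₗ[ℝ] ℝ) :
    ∃ v : E, ∀ α, T α = α v := by
  let e : Module.Dual ℝ E ≃ₗ[ℝ] (E →L[ℝ] ℝ) := LinearMap.toContinuousLinearMap
  refine ⟨(Module.evalEquiv ℝ E).symm (T ∘ₗ e.toLinearMap), fun α => ?_⟩
  have h := Module.apply_evalEquiv_symm_apply ℝ E (e.symm α) (T ∘ₗ e.toLinearMap)
  have h1 : T α = (T ∘ₗ e.toLinearMap) (e.symm α) := by simp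
  rw [h1, ← h]
  rfl

theorem exists_tangent_apply_eq [FiniteDimensional ℝ E] {x : N}
    (T : (TangentSpace I x →L[ℝ] ℝ) →ₗ[ℝ] ℝ) : ∃ v : TangentSpace I x, ∀ α, T α = α v :=
  exists_apply_eq (E := E) T

theorem ext_of_covectors [FiniteDimensional ℝ E] {x : N} {u v : TangentSpace I x}
    (h : ∀ α : TangentSpace I x →L[ℝ] ℝ, α u = α v) : u = v := by
  refine eq_of_sub_eq_zero ((Module.forall_dual_apply_eq_zero_iff ℝ (V := E) _).1 fun φ => ?_)
  have h1 := h (LinearMap.toContinuousLinearMap φ : E →L[ℝ] ℝ)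
  have h2 : φ u = φ v := h1
  exact (map_sub φ u v).trans (sub_eq_zero.2 h2)

/-- A proper subspace of covectors is annihilated by a nonzero functional, which by reflexivity is
evaluation at a tangent vector. -/
theorem span_eq_top_of_separating [FiniteDimensional ℝ E] {x : N}
    {s : Set (TangentSpace I x →L[ℝ] ℝ)}
    (h : ∀ v : TangentSpace I x, (∀ α ∈ s, α v = 0) → v = 0) : Submodule.span ℝ s = ⊤ := by
  by_contra hs
  obtain ⟨T, hT, hTs⟩ := Submodule.exists_dual_map_eq_bot_of_lt_top (lt_top_iff_ne_top.2 hs)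
    inferInstance
  obtain ⟨v, hv⟩ := exists_tangent_apply_eq T
  have hv0 : v = 0 := h v fun α hα => by
    rw [← hv]
    exact (Submodule.mem_bot ℝ).1
      (hTs ▸ Submodule.mem_map_of_mem (Submodule.subset_span hα) : T α ∈ (⊥ : Submodule ℝ ℝ))
  exact hT (LinearMap.ext fun α => by rw [hv, hv0, map_zero]; rfl)

/-- The generating families used below are indexed by all sections or functions, whereas expansions
with smooth coefficients need a finite index. A linearly independent subfamily with the same span is
finite. -/
theorem exists_finite_coframe [FiniteDimensional ℝ E] {ι : Type*} {φ : ι → N → ℝ} {x : N}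
    (hs : Submodule.span ℝ (range fun i => mvfderiv I (φ i) x) = ⊤) :
    ∃ (n : ℕ) (a : Fin n → ι),
      Submodule.span ℝ (range fun k => mvfderiv I (φ (a k)) x) = ⊤ := by
  obtain ⟨κ, a, -, hsp, hli⟩ := exists_linearIndependent' ℝ fun i => mvfderiv I (φ i) x
  have := hli.finite
  obtain ⟨n, ⟨e⟩⟩ := Finite.exists_equiv_fin κ
  refine ⟨n, a ∘ e.symm, ?_⟩
  rw [← hs, ← hsp]
  congr 1
  exact e.symm.surjective.range_comp ((fun i => mvfderiv I (φ i) x) ∘ a)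

theorem contMDiffAt_sum_mul {ι : Type*} [Fintype ι] {c d : ι → N → ℝ} {x : N}
    (hc : ∀ i, ContMDiffAt I 𝓘(ℝ, ℝ) ∞ (c i) x) (hd : ∀ i, ContMDiffAt I 𝓘(ℝ, ℝ) ∞ (d i) x) :
    ContMDiffAt I 𝓘(ℝ, ℝ) ∞ (fun y => ∑ i, c i y * d i y) x :=
  contMDiffAt_finsetSum fun i _ => (hc i).mul (hd i)

theorem mvfderiv_sum_mul {ι : Type*} [Fintype ι] {c d : ι → N → ℝ} {x : N}
    (hc : ∀ i, ContMDiffAt I 𝓘(ℝ, ℝ) ∞ (c i) x) (hd : ∀ i, ContMDiffAt I 𝓘(ℝ, ℝ) ∞ (d i) x) :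
    mvfderiv I (fun y => ∑ i, c i y * d i y) x =
      ∑ i, (c i x • mvfderiv I (d i) x + d i x • mvfderiv I (c i) x) := by
  classical
  induction (Finset.univ : Finset ι) using Finset.induction_on with
  | empty => simpa using mvfderiv_const (I := I) (0 : ℝ)
  | insert i s hi ih =>
    have hcd : ∀ j, MDifferentiableAt I 𝓘(ℝ, ℝ) (fun y => c j y * d j y) x := fun j =>
      ((hc j).mul (hd j)).mdifferentiableAt (by simp)
    have hsum : MDifferentiableAt I 𝓘(ℝ, ℝ) (fun y => ∑ j ∈ s, c j y * d j y) x :=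
      (contMDiffAt_finsetSum (n := ∞) fun i _ => (hc i).mul (hd i)).mdifferentiableAt (by simp)
    simp only [Finset.sum_insert hi]
    rw [mvfderiv_fun_add (hcd i) hsum, ih, mvfderiv_fun_mul ((hc i).mdifferentiableAt (by simp))
      ((hd i).mdifferentiableAt (by simp))]

theorem contMDiffAt_of_dual {E' : Type*} [NormedAddCommGroup E'] [NormedSpace ℝ E']
    [FiniteDimensional ℝ E'] {f : N → E'} {x : N}
    (h : ∀ l : E' →L[ℝ] ℝ, ContMDiffAt I 𝓘(ℝ, ℝ) ∞ (fun y => l (f y)) x) :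
    ContMDiffAt I 𝓘(ℝ, E') ∞ f x := by
  let e : E' ≃L[ℝ] (Fin (Module.finrank ℝ E') → ℝ) :=
    ContinuousLinearEquiv.ofFinrankEq (Module.finrank_fin_fun ℝ).symm
  have h1 : ContMDiffAt I 𝓘(ℝ, Fin (Module.finrank ℝ E') → ℝ) ∞ (fun y => e (f y)) x :=
    contMDiffAt_pi_space.2 fun i =>
      h ((ContinuousLinearMap.proj (R := ℝ) (φ := fun _ => ℝ) i).comp e.toContinuousLinearMap)
  refine ((e.symm.contDiff.contMDiff (n := ∞)).contMDiffAt.comp x h1).congr_of_eventuallyEq ?_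
  filter_upwards with y
  simp

/-- Evaluation of covectors at a tangent vector. -/
def evalTangent {x : N} (u : TangentSpace I x) : (TangentSpace I x →L[ℝ] ℝ) →ₗ[ℝ] ℝ where
  toFun α := α u
  map_add' _ _ := rfl
  map_smul' _ _ := rfl

/-- The bivector `u ∧ v` as a bilinear form on covectors. -/
def wedgeForm {x : N} (u v : TangentSpace I x) :
    (TangentSpace I x →L[ℝ] ℝ) →ₗ[ℝ] (TangentSpace I x →L[ℝ] ℝ) →ₗ[ℝ] ℝ :=
  (evalTangent u).smulRight (evalTangent v) - (evalTangent v).smulRight (evalTangent u)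

theorem wedgeForm_apply {x : N} (u v : TangentSpace I x) (α β : TangentSpace I x →L[ℝ] ℝ) :
    wedgeForm u v α β = wedgeAt u v α β := rfl

variable [I.Boundaryless] [IsManifold I ∞ N] [FiniteDimensional ℝ E]

/-- A family of functionals on the cotangent spaces is smooth if it is smooth on functions whose
differentials span. -/
theorem contMDiffAt_apply_mvfderiv {T : ∀ y : N, (TangentSpace I y →L[ℝ] ℝ) →ₗ[ℝ] ℝ}
    {ι : Type*} {φ : ι → N → ℝ} {f : N → ℝ} {x : N}
    (hφ : ∀ i, ContMDiffAt I 𝓘(ℝ, ℝ) ∞ (φ i) x)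
    (hs : Submodule.span ℝ (range fun i => mvfderiv I (φ i) x) = ⊤)
    (hT : ∀ i, ContMDiffAt I 𝓘(ℝ, ℝ) ∞ (fun y => T y (mvfderiv I (φ i) y)) x)
    (hf : ContMDiffAt I 𝓘(ℝ, ℝ) ∞ f x) :
    ContMDiffAt I 𝓘(ℝ, ℝ) ∞ (fun y => T y (mvfderiv I f y)) x := by
  obtain ⟨n, a, ha⟩ := exists_finite_coframe hs
  obtain ⟨c, hc, hcf, -⟩ := exists_mvfderiv_eq_sum (fun k => hφ (a k)) hf ha
  refine (contMDiffAt_sum_mul hc fun k => hT (a k)).congr_of_eventuallyEq ?_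
  filter_upwards [hcf] with y hy
  rw [hy]
  simp

/-- The criterion for one argument is used twice: on the second slot with a generator in the first,
then on the first slot with `g` fixed. -/
theorem contMDiff_bilinear {P : ∀ y : N,
      (TangentSpace I y →L[ℝ] ℝ) →ₗ[ℝ] (TangentSpace I y →L[ℝ] ℝ) →ₗ[ℝ] ℝ}
    {ι : Type*} {φ : ι → N → ℝ}
    (hφ : ∀ i, ContMDiff I 𝓘(ℝ, ℝ) ∞ (φ i))
    (hs : ∀ x, Submodule.span ℝ (range fun i => mvfderiv I (φ i) x) = ⊤)
    (hP : ∀ i j, ContMDiff I 𝓘(ℝ, ℝ) ∞ fun y => P y (mvfderiv I (φ i) y) (mvfderiv I (φ j) y))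
    {f g : N → ℝ} (hf : ContMDiff I 𝓘(ℝ, ℝ) ∞ f) (hg : ContMDiff I 𝓘(ℝ, ℝ) ∞ g) :
    ContMDiff I 𝓘(ℝ, ℝ) ∞ fun y => P y (mvfderiv I f y) (mvfderiv I g y) := fun x =>
  contMDiffAt_apply_mvfderiv (T := fun y => (P y).flip (mvfderiv I g y)) (fun i => hφ i x) (hs x)
    (fun i => contMDiffAt_apply_mvfderiv (T := fun y => P y (mvfderiv I (φ i) y))
      (fun j => hφ j x) (hs x) (fun j => hP i j x) (hg x)) (hf x)

/-- In the trivialization at `x` the field becomes the derivative of the chart along `X`. A linear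
form `l` of it is the derivative of `l ∘ chart` along `X`, so the scalar criterion
`contMDiffAt_apply_mvfderiv` applies. -/
theorem contMDiff_vectorField {X : ∀ y : N, TangentSpace I y} {ι : Type*} {φ : ι → N → ℝ}
    (hφ : ∀ i, ContMDiff I 𝓘(ℝ, ℝ) ∞ (φ i))
    (hs : ∀ x, Submodule.span ℝ (range fun i => mvfderiv I (φ i) x) = ⊤)
    (hX : ∀ i, ContMDiff I 𝓘(ℝ, ℝ) ∞ fun y => mvfderiv I (φ i) y (X y)) :
    ContMDiff I I.tangent ∞ fun y => (⟨y, X y⟩ : TangentBundle I N) := by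
  intro x
  have hM : IsManifold I 1 N := IsManifold.of_le (n := ∞) (by simp)
  refine (contMDiffAt_section (F := E) (E := (TangentSpace I : N → Type _)) x).2 ?_
  have h1 : (fun y => (trivializationAt E (TangentSpace I) x ⟨y, X y⟩).2) =ᶠ[𝓝 x]
      fun y => mvfderiv I (extChartAt I x) y (X y) := by
    filter_upwards [(chartAt H x).open_source.mem_nhds (mem_chart_source H x)] with y hy
    have h2 := TangentBundle.continuousLinearMapAt_trivializationAt (I := I) hy
    rw [← Trivialization.continuousLinearMapAt_apply_of_mem ℝ _ (by simpa using hy)]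
    exact DFunLike.congr_fun h2 (X y)
  refine ContMDiffAt.congr_of_eventuallyEq ?_ h1
  refine contMDiffAt_of_dual fun l => ?_
  have h3 : ContMDiffAt I 𝓘(ℝ, ℝ) ∞ (fun y => l (extChartAt I x y)) x :=
    l.contDiff.contMDiff.contMDiffAt.comp x contMDiffAt_extChartAt
  refine (contMDiffAt_apply_mvfderiv (T := fun y => evalTangent (X y)) (fun i => hφ i x) (hs x)
    (fun i => hX i x) h3).congr_of_eventuallyEq ?_
  filter_upwards [(chartAt H x).open_source.mem_nhds (mem_chart_source H x)] with y hy
  have h4 := mvfderiv_comp_fderiv (g := l) (l.differentiableAt)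
    (mdifferentiableAt_extChartAt (I := I) hy) (X y)
  rw [l.fderiv] at h4
  exact h4.symm

/-- The second derivative of a function at a critical point. -/
theorem exists_hessian {ι : Type*} {φ : ι → N → ℝ} {f : N → ℝ} {x : N}
    (hφ : ∀ i, ContMDiffAt I 𝓘(ℝ, ℝ) ∞ (φ i) x)
    (hs : Submodule.span ℝ (range fun i => mvfderiv I (φ i) x) = ⊤)
    (hf : ContMDiffAt I 𝓘(ℝ, ℝ) ∞ f x) (h0 : mvfderiv I f x = 0) :
    ∃ h : TangentSpace I x → TangentSpace I x → ℝ, (∀ u v, h u v = h v u) ∧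
      ∀ (T : ∀ y : N, (TangentSpace I y →L[ℝ] ℝ) →ₗ[ℝ] ℝ),
        (∀ i, ContMDiffAt I 𝓘(ℝ, ℝ) ∞ (fun y => T y (mvfderiv I (φ i) y)) x) →
        ∀ v, (∀ α, T x α = α v) → ∀ u, mvfderiv I (fun y => T y (mvfderiv I f y)) x u = h u v := by
  obtain ⟨n, a, ha⟩ := exists_finite_coframe hs
  obtain ⟨c, hc, hcf, hc0⟩ := exists_mvfderiv_eq_sum (fun k => hφ (a k)) hf ha
  obtain ⟨hc0, hsymm⟩ := hc0 h0
  -- The Hessian is `∑ dc_i ⊗ dφ_i`, fixed before `T` is chosen. In the derivative of `T(df) = ∑ c_i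
  -- T(dφ_i)` at `x` the terms that differentiate `T(dφ_i)` carry the factor `c_i(x) = 0`.
  refine ⟨fun u v => ∑ i, mvfderiv I (c i) x u * mvfderiv I (φ (a i)) x v, hsymm, ?_⟩
  intro T hT v hv u
  have h1 : (fun y => T y (mvfderiv I f y)) =ᶠ[𝓝 x]
      fun y => ∑ i, c i y * T y (mvfderiv I (φ (a i)) y) := by
    filter_upwards [hcf] with y hy
    rw [hy]
    simp
  rw [mvfderiv_congr h1, mvfderiv_sum_mul hc fun i => hT (a i)]
  simp [hc0, hv, mul_comm]

end Tensors

/-! ### The Jacobi equations are tensorial -/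

section Calculus

variable {E : Type*} [NormedAddCommGroup E] [NormedSpace ℝ E]
  {H : Type*} [TopologicalSpace H] {I : ModelWithCorners ℝ E H}
  {N : Type*} [TopologicalSpace N] [ChartedSpace H N]

theorem BivectorField.apply_swap (P : BivectorField I N) {x : N}
    (α β : TangentSpace I x →L[ℝ] ℝ) : P x α β = -P x β α := by
  have h := P.alternating x (α + β)
  simp only [map_add, LinearMap.add_apply, P.alternating] at h
  linarith

theorem BivectorField.onFun_swap (P : BivectorField I N) (f g : N → ℝ) :
    P.onFun f g = fun x => -P.onFun g f x :=
  funext fun _ => P.apply_swap _ _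

theorem BivectorField.contMDiff_onFun (P : BivectorField I N) {f g : N → ℝ}
    (hf : ContMDiff I 𝓘(ℝ, ℝ) ∞ f) (hg : ContMDiff I 𝓘(ℝ, ℝ) ∞ g) :
    ContMDiff I 𝓘(ℝ, ℝ) ∞ (P.onFun f g) := P.smooth f g hf hg

theorem mvfderiv_fun_neg' {f : N → ℝ} {x : N} :
    mvfderiv I (fun y => -f y) x = -mvfderiv I f x := mvfderiv_neg

theorem mvfderiv_fun_sub' {f g : N → ℝ} (hf : ContMDiff I 𝓘(ℝ, ℝ) ∞ f)
    (hg : ContMDiff I 𝓘(ℝ, ℝ) ∞ g) (x : N) :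
    mvfderiv I (fun y => f y - g y) x = mvfderiv I f x - mvfderiv I g x :=
  mvfderiv_fun_sub ((hf x).mdifferentiableAt (by simp)) ((hg x).mdifferentiableAt (by simp))

theorem mvfderiv_fun_add' {f g : N → ℝ} (hf : ContMDiff I 𝓘(ℝ, ℝ) ∞ f)
    (hg : ContMDiff I 𝓘(ℝ, ℝ) ∞ g) (x : N) :
    mvfderiv I (fun y => f y + g y) x = mvfderiv I f x + mvfderiv I g x :=
  mvfderiv_fun_add ((hf x).mdifferentiableAt (by simp)) ((hg x).mdifferentiableAt (by simp))

theorem mvfderiv_fun_mul' {f g : N → ℝ} (hf : ContMDiff I 𝓘(ℝ, ℝ) ∞ f)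
    (hg : ContMDiff I 𝓘(ℝ, ℝ) ∞ g) (x : N) :
    mvfderiv I (fun y => f y * g y) x = f x • mvfderiv I g x + g x • mvfderiv I f x :=
  mvfderiv_fun_mul ((hf x).mdifferentiableAt (by simp)) ((hg x).mdifferentiableAt (by simp))

theorem BivectorField.onFun_sub (P : BivectorField I N) {f f' : N → ℝ}
    (hf : ContMDiff I 𝓘(ℝ, ℝ) ∞ f) (hf' : ContMDiff I 𝓘(ℝ, ℝ) ∞ f') (g : N → ℝ) :
    P.onFun (fun y => f y - f' y) g = fun x => P.onFun f g x - P.onFun f' g x := by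
  funext x
  simp [BivectorField.onFun, mvfderiv_fun_sub' hf hf']

theorem BivectorField.onFun_sub_right (P : BivectorField I N) {f f' : N → ℝ}
    (hf : ContMDiff I 𝓘(ℝ, ℝ) ∞ f) (hf' : ContMDiff I 𝓘(ℝ, ℝ) ∞ f') (g : N → ℝ) :
    P.onFun g (fun y => f y - f' y) = fun x => P.onFun g f x - P.onFun g f' x := by
  funext x
  simp [BivectorField.onFun, mvfderiv_fun_sub' hf hf']

variable [IsManifold I ∞ N]

theorem contMDiff_along (X : VectorField I N) {f : N → ℝ} (hf : ContMDiff I 𝓘(ℝ, ℝ) ∞ f) :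
    ContMDiff I 𝓘(ℝ, ℝ) ∞ (along X f) := by
  have h1 : ContMDiff I.tangent 𝓘(ℝ, ℝ).tangent ∞ (tangentMap I 𝓘(ℝ, ℝ) f) :=
    hf.contMDiff_tangentMap (by simp)
  have h2 := h1.comp X.contMDiff
  exact (contMDiff_snd_tangentBundle_modelSpace ℝ 𝓘(ℝ, ℝ)).comp h2

theorem along_sub (X : VectorField I N) {f f' : N → ℝ}
    (hf : ContMDiff I 𝓘(ℝ, ℝ) ∞ f) (hf' : ContMDiff I 𝓘(ℝ, ℝ) ∞ f') :
    along X (fun y => f y - f' y) = fun x => along X f x - along X f' x := by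
  funext x
  simp [along, mvfderiv_fun_sub' hf hf']

/-- The difference `[Λ, Λ] + 2 E ∧ Λ` of the two sides of the first Jacobi equation. -/
def jacobiDefect (P : BivectorField I N) (X : VectorField I N) (f g h : N → ℝ) (x : N) : ℝ :=
  P.schouten P f g h x + 2 * wedge X P f g h x

theorem jacobiDefect_cycle (P : BivectorField I N) (X : VectorField I N) (f g h : N → ℝ) (x : N) :
    jacobiDefect P X f g h x = jacobiDefect P X g h f x := by
  simp only [jacobiDefect, BivectorField.schouten, wedge]
  ring

theorem schoutenVector_swap (X : VectorField I N) (P : BivectorField I N) (f g : N → ℝ) (x : N) :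
    schoutenVector X P f g x = -schoutenVector X P g f x := by
  have h1 : along X (fun y => -P.onFun g f y) x = -along X (P.onFun g f) x := by
    simp [along, mvfderiv_fun_neg']
  simp only [schoutenVector]
  rw [P.onFun_swap f g, P.onFun_swap (along X f) g, P.onFun_swap f (along X g), h1]
  ring

variable [I.Boundaryless] [FiniteDimensional ℝ E]

/-- With `u = P(·, dg)`, `v = P(·, dh)` and `b` the Hessian of `f` at `x`, the three terms are `b(v,
u)`, `0` and `-b(u, v)`. This vanishing is what makes the Jacobiator a tensor. -/
theorem BivectorField.cyclic_eq_zero (P : BivectorField I N) {ι : Type*} {φ : ι → N → ℝ}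
    (hφ : ∀ i, ContMDiff I 𝓘(ℝ, ℝ) ∞ (φ i)) {x : N}
    (hs : Submodule.span ℝ (range fun i => mvfderiv I (φ i) x) = ⊤)
    {f g h : N → ℝ} (hf : ContMDiff I 𝓘(ℝ, ℝ) ∞ f) (hg : ContMDiff I 𝓘(ℝ, ℝ) ∞ g)
    (hh : ContMDiff I 𝓘(ℝ, ℝ) ∞ h) (h0 : mvfderiv I f x = 0) :
    P.onFun (P.onFun f g) h x + P.onFun (P.onFun g h) f x + P.onFun (P.onFun h f) g x = 0 := by
  obtain ⟨b, hb, hT⟩ := exists_hessian (fun i => hφ i x) hs (hf x) h0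
  obtain ⟨u, hu⟩ := exists_tangent_apply_eq ((P x).flip (mvfderiv I g x))
  obtain ⟨v, hv⟩ := exists_tangent_apply_eq ((P x).flip (mvfderiv I h x))
  have h1 := hT (fun y => (P y).flip (mvfderiv I g y))
    (fun i => P.contMDiff_onFun (hφ i) hg x) u hu v
  have h2 := hT (fun y => (P y).flip (mvfderiv I h y))
    (fun i => P.contMDiff_onFun (hφ i) hh x) v hv u
  have h3 : P.onFun (P.onFun f g) h x = b v u := (hv _).trans h1
  have h4 : P.onFun (P.onFun h f) g x = -b u v := by
    rw [P.onFun_swap h f]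
    have h5 : P.onFun (fun y => -P.onFun f h y) g x = -P.onFun (P.onFun f h) g x := by
      rw [BivectorField.onFun, mvfderiv_fun_neg', map_neg]
      rfl
    rw [h5]
    exact congrArg Neg.neg ((hu _).trans h2)
  have h5 : P.onFun (P.onFun g h) f x = 0 := by simp [BivectorField.onFun, h0]
  rw [h3, h4, h5, hb u v]
  ring

/-- With `u = P(·, dg)` and `b` the Hessian of `f` at `x`, the first two terms are `b(X, u)` and
`b(u, X)`, and the third contains `df = 0`. -/
theorem schoutenVector_eq_zero (X : VectorField I N) (P : BivectorField I N)
    {ι : Type*} {φ : ι → N → ℝ} (hφ : ∀ i, ContMDiff I 𝓘(ℝ, ℝ) ∞ (φ i)) {x : N}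
    (hs : Submodule.span ℝ (range fun i => mvfderiv I (φ i) x) = ⊤)
    {f g : N → ℝ} (hf : ContMDiff I 𝓘(ℝ, ℝ) ∞ f) (hg : ContMDiff I 𝓘(ℝ, ℝ) ∞ g)
    (h0 : mvfderiv I f x = 0) : schoutenVector X P f g x = 0 := by
  obtain ⟨b, hb, hT⟩ := exists_hessian (fun i => hφ i x) hs (hf x) h0
  obtain ⟨u, hu⟩ := exists_tangent_apply_eq ((P x).flip (mvfderiv I g x))
  have h1 := hT (fun y => (P y).flip (mvfderiv I g y))
    (fun i => P.contMDiff_onFun (hφ i) hg x) u hu (X x)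
  have h2 := hT (fun y => (⟨⟨fun α => α (X y), fun _ _ => rfl⟩,
    fun _ _ => rfl⟩ : (TangentSpace I y →L[ℝ] ℝ) →ₗ[ℝ] ℝ))
    (fun i => contMDiff_along X (hφ i) x) (X x) (fun _ => rfl) u
  have h3 : along X (P.onFun f g) x = b (X x) u := h1
  have h4 : P.onFun (along X f) g x = b u (X x) := (hu _).trans h2
  have h5 : P.onFun f (along X g) x = 0 := by simp [BivectorField.onFun, h0]
  rw [schoutenVector, h3, h4, h5, hb u]
  ring

/-- The Schouten part is additive in its first argument, so `cyclic_eq_zero` for `f - f'` handles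
it; the part `E ∧ Λ` involves only differentials at `x`. -/
theorem jacobiDefect_congr (P : BivectorField I N) (X : VectorField I N)
    {ι : Type*} {φ : ι → N → ℝ} (hφ : ∀ i, ContMDiff I 𝓘(ℝ, ℝ) ∞ (φ i)) {x : N}
    (hs : Submodule.span ℝ (range fun i => mvfderiv I (φ i) x) = ⊤)
    {f f' g h : N → ℝ} (hf : ContMDiff I 𝓘(ℝ, ℝ) ∞ f) (hf' : ContMDiff I 𝓘(ℝ, ℝ) ∞ f')
    (hg : ContMDiff I 𝓘(ℝ, ℝ) ∞ g) (hh : ContMDiff I 𝓘(ℝ, ℝ) ∞ h)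
    (hff : mvfderiv I f x = mvfderiv I f' x) :
    jacobiDefect P X f g h x = jacobiDefect P X f' g h x := by
  have h1 := P.cyclic_eq_zero hφ hs (hf.sub hf') hg hh (by
    rw [← sub_eq_zero.2 hff]; exact mvfderiv_fun_sub' hf hf' x)
  have e1 := P.onFun_sub hf hf' g
  have e2 := P.onFun_sub_right hf hf' h
  have e3 := P.onFun_sub (P.contMDiff_onFun hf hg) (P.contMDiff_onFun hf' hg) h
  have e4 := P.onFun_sub (P.contMDiff_onFun hh hf) (P.contMDiff_onFun hh hf') g
  have e5 := P.onFun_sub_right hf hf' (P.onFun g h)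
  have h2 : P.onFun (fun y => P.onFun f g y - P.onFun f' g y) h x +
      P.onFun (P.onFun g h) (fun y => f y - f' y) x +
      P.onFun (fun y => P.onFun h f y - P.onFun h f' y) g x = 0 := by
    rw [← e1, ← e2]
    exact h1
  rw [e3, e4, e5] at h2
  have w1 : along X f x = along X f' x := by rw [along, along, hff]
  have w2 : P.onFun h f x = P.onFun h f' x := by rw [BivectorField.onFun, BivectorField.onFun, hff]
  have w3 : P.onFun f g x = P.onFun f' g x := by rw [BivectorField.onFun, BivectorField.onFun, hff]
  simp only [jacobiDefect, BivectorField.schouten, wedge, w1, w2, w3]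
  linarith

theorem schoutenVector_congr (X : VectorField I N) (P : BivectorField I N)
    {ι : Type*} {φ : ι → N → ℝ} (hφ : ∀ i, ContMDiff I 𝓘(ℝ, ℝ) ∞ (φ i)) {x : N}
    (hs : Submodule.span ℝ (range fun i => mvfderiv I (φ i) x) = ⊤)
    {f f' g : N → ℝ} (hf : ContMDiff I 𝓘(ℝ, ℝ) ∞ f) (hf' : ContMDiff I 𝓘(ℝ, ℝ) ∞ f')
    (hg : ContMDiff I 𝓘(ℝ, ℝ) ∞ g) (hff : mvfderiv I f x = mvfderiv I f' x) :
    schoutenVector X P f g x = schoutenVector X P f' g x := by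
  have h1 := schoutenVector_eq_zero X P hφ hs (hf.sub hf') hg (by
    rw [← sub_eq_zero.2 hff]; exact mvfderiv_fun_sub' hf hf' x)
  have h2 : along X (P.onFun (fun y => f y - f' y) g) x -
      P.onFun (along X fun y => f y - f' y) g x -
      P.onFun (fun y => f y - f' y) (along X g) x = 0 := h1
  rw [P.onFun_sub hf hf' g, along_sub X hf hf', P.onFun_sub hf hf' (along X g),
    along_sub X (P.contMDiff_onFun hf hg) (P.contMDiff_onFun hf' hg),
    P.onFun_sub (contMDiff_along X hf) (contMDiff_along X hf')] at h2
  simp only [schoutenVector]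
  linarith

/-- The Jacobi equations follow from the algebraic identities satisfied by a family of functions
whose differentials exhaust the cotangent spaces at the points of a dense set. -/
theorem jacobi_equations_of_generators (P : BivectorField I N) (X : VectorField I N)
    {𝔤 : Type*} (Φ : 𝔤 → N → ℝ) (br : 𝔤 → 𝔤 → 𝔤) (D : 𝔤 → 𝔤)
    (hΦ : ∀ a, ContMDiff I 𝓘(ℝ, ℝ) ∞ (Φ a))
    (hX : ∀ a, along X (Φ a) = Φ (D a))
    (hP : ∀ a b, P.onFun (Φ a) (Φ b) =
      fun x => Φ (br a b) x - Φ a x * Φ (D b) x + Φ b x * Φ (D a) x)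
    (hD : ∀ a b x, Φ (D (br a b)) x = Φ (br (D a) b) x + Φ (br a (D b)) x)
    (hJ : ∀ a b c x, Φ (br (br a b) c) x + Φ (br (br b c) a) x + Φ (br (br c a) b) x = 0)
    {s : Set N} (hs : Dense s) (hΦs : ∀ x ∈ s, ∀ α, ∃ a, mvfderiv I (Φ a) x = α)
    {f g h : N → ℝ} (hf : ContMDiff I 𝓘(ℝ, ℝ) ∞ f) (hg : ContMDiff I 𝓘(ℝ, ℝ) ∞ g)
    (hh : ContMDiff I 𝓘(ℝ, ℝ) ∞ h) (x : N) :
    P.schouten P f g h x = -2 * wedge X P f g h x ∧ schoutenVector X P f g x = 0 := by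
  have hspan : ∀ x ∈ s, Submodule.span ℝ (range fun a => mvfderiv I (Φ a) x) = ⊤ := by
    intro x hx
    rw [eq_top_iff]
    rintro α -
    obtain ⟨a, rfl⟩ := hΦs x hx α
    exact Submodule.subset_span ⟨a, rfl⟩
  have hd : ∀ a b x, mvfderiv I (P.onFun (Φ a) (Φ b)) x =
      mvfderiv I (Φ (br a b)) x
        - (Φ a x • mvfderiv I (Φ (D b)) x + Φ (D b) x • mvfderiv I (Φ a) x)
        + (Φ b x • mvfderiv I (Φ (D a)) x + Φ (D a) x • mvfderiv I (Φ b) x) := by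
    intro a b x
    have hm : ∀ c d, ContMDiff I 𝓘(ℝ, ℝ) ∞ fun y => Φ c y * Φ d y := fun c d => (hΦ c).mul (hΦ d)
    rw [hP, mvfderiv_fun_add' (f := fun y => Φ (br a b) y - Φ a y * Φ (D b) y)
        ((hΦ _).sub (hm _ _)) (hm _ _),
      mvfderiv_fun_sub' (hΦ _) (hm _ _), mvfderiv_fun_mul' (hΦ _) (hΦ _),
      mvfderiv_fun_mul' (hΦ _) (hΦ _)]
  have hPx : ∀ a b x, P x (mvfderiv I (Φ a) x) (mvfderiv I (Φ b) x) =
      Φ (br a b) x - Φ a x * Φ (D b) x + Φ b x * Φ (D a) x := fun a b x => congrFun (hP a b) x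
  have hXx : ∀ a x, mvfderiv I (Φ a) x (X x) = Φ (D a) x := fun a x => congrFun (hX a) x
  -- The quadratic terms in `hP` are antisymmetric in `a` and `b`, so the antisymmetry of `P` passes
  -- to `br` at the level of functions.
  have hanti : ∀ a b x, Φ (br b a) x = -Φ (br a b) x := by
    intro a b x
    have h1 := P.apply_swap (mvfderiv I (Φ a) x) (mvfderiv I (Φ b) x)
    rw [hPx, hPx] at h1
    linarith
  have h1 : ∀ a b c x, jacobiDefect P X (Φ a) (Φ b) (Φ c) x = 0 := by
    intro a b c x
    simp only [jacobiDefect, BivectorField.schouten, wedge, along, BivectorField.onFun]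
    change -(P x (mvfderiv I (P.onFun (Φ a) (Φ b)) x) _ + P x (mvfderiv I (P.onFun (Φ b) (Φ c)) x) _
      + P x (mvfderiv I (P.onFun (Φ c) (Φ a)) x) _ + P x (mvfderiv I (P.onFun (Φ a) (Φ b)) x) _
      + P x (mvfderiv I (P.onFun (Φ b) (Φ c)) x) _ + P x (mvfderiv I (P.onFun (Φ c) (Φ a)) x) _)
      + _ = 0
    simp only [hd, map_add, map_sub, map_smul, LinearMap.add_apply, LinearMap.sub_apply,
      LinearMap.smul_apply, smul_eq_mul, hPx, hXx]
    rw [hD, hD, hD]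
    -- For `P = Q` the Schouten bracket is minus twice the cyclic sum, whence the factor `-2`. The
    -- `hanti` terms bring the arguments of `br` into a common order after the cyclic permutations
    -- and the derivation rule.
    linear_combination (-2 : ℝ) * hJ a b c x + 2 * Φ (D c) x * hanti a b x
      + 2 * Φ (D b) x * hanti a c x + 2 * Φ (D a) x * hanti b c x
      - 2 * Φ c x * hanti a (D b) x - 2 * Φ a x * hanti b (D c) x - 2 * Φ b x * hanti (D a) c x
  have h2 : ∀ a b x, schoutenVector X P (Φ a) (Φ b) x = 0 := by
    intro a b x
    rw [schoutenVector, hX, hX, hP (D a) b, hP a (D b), along, hd]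
    simp only [add_apply, sub_apply, smul_apply, hXx, smul_eq_mul]
    rw [hD]
    ring
  have hc1 : Continuous fun x => jacobiDefect P X f g h x := by
    have k := fun {a b : N → ℝ} (ha : ContMDiff I 𝓘(ℝ, ℝ) ∞ a) (hb : ContMDiff I 𝓘(ℝ, ℝ) ∞ b) =>
      (P.contMDiff_onFun ha hb).continuous
    have l := fun {a : N → ℝ} (ha : ContMDiff I 𝓘(ℝ, ℝ) ∞ a) => (contMDiff_along X ha).continuous
    have m := fun {a b : N → ℝ} (ha : ContMDiff I 𝓘(ℝ, ℝ) ∞ a) (hb : ContMDiff I 𝓘(ℝ, ℝ) ∞ b) =>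
      P.contMDiff_onFun ha hb
    have c1 := k (m hf hg) hh
    have c2 := k (m hg hh) hf
    have c3 := k (m hh hf) hg
    exact ((((((c1.add c2).add c3).add c1).add c2).add c3).neg).add
      ((((l hf).mul (k hg hh)).add ((l hg).mul (k hh hf))).add ((l hh).mul (k hf hg)) |>.const_mul 2)
  have hc2 : Continuous fun x => schoutenVector X P f g x :=
    (((contMDiff_along X (P.contMDiff_onFun hf hg)).continuous).sub
      (P.contMDiff_onFun (contMDiff_along X hf) hg).continuous).sub
      (P.contMDiff_onFun hf (contMDiff_along X hg)).continuous
  have e1 : (fun x => jacobiDefect P X f g h x) = fun _ => 0 := by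
    -- At a point of `s` each argument is replaced by a generator with the same differential. Only
    -- the first slot can be replaced directly, so the arguments are rotated between replacements.
    refine Continuous.ext_on hs hc1 continuous_const fun x hx => ?_
    obtain ⟨a, ha⟩ := hΦs x hx (mvfderiv I f x)
    obtain ⟨b, hb⟩ := hΦs x hx (mvfderiv I g x)
    obtain ⟨c, hc⟩ := hΦs x hx (mvfderiv I h x)
    rw [jacobiDefect_congr P X hΦ (hspan x hx) hf (hΦ a) hg hh ha.symm, jacobiDefect_cycle,
      jacobiDefect_congr P X hΦ (hspan x hx) hg (hΦ b) hh (hΦ a) hb.symm, jacobiDefect_cycle,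
      jacobiDefect_congr P X hΦ (hspan x hx) hh (hΦ c) (hΦ a) (hΦ b) hc.symm, h1]
  have e2 : (fun x => schoutenVector X P f g x) = fun _ => 0 := by
    refine Continuous.ext_on hs hc2 continuous_const fun x hx => ?_
    obtain ⟨a, ha⟩ := hΦs x hx (mvfderiv I f x)
    obtain ⟨b, hb⟩ := hΦs x hx (mvfderiv I g x)
    rw [schoutenVector_congr X P hΦ (hspan x hx) hf (hΦ a) hg ha.symm, schoutenVector_swap,
      schoutenVector_congr X P hΦ (hspan x hx) hg (hΦ b) (hΦ a) hb.symm, h2, neg_zero]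
  refine ⟨?_, congrFun e2 x⟩
  have := congrFun e1 x
  simp only [jacobiDefect] at this
  linarith

end Calculus

/-! ### Functions and sections with prescribed germs -/

section TotalSpaces

variable {EB : Type*} [NormedAddCommGroup EB] [NormedSpace ℝ EB]
  {B : Type*} [TopologicalSpace B] [ChartedSpace EB B]

/-- A tangent vector of the total space of a fibre bundle vanishes if its projection to the base
and its fibre component vanish. -/
theorem tangent_totalSpace_eq_zero {F : Type*} [NormedAddCommGroup F] [NormedSpace ℝ F]
    {A : B → Type*} [TopologicalSpace (TotalSpace F A)] [∀ x, TopologicalSpace (A x)]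
    [FiberBundle F A] [IsManifold 𝓘(ℝ, EB) ∞ B]
    [IsManifold (𝓘(ℝ, EB).prod 𝓘(ℝ, F)) ∞ (TotalSpace F A)]
    {p : TotalSpace F A} {v : TangentSpace (𝓘(ℝ, EB).prod 𝓘(ℝ, F)) p}
    (h1 : mfderiv (𝓘(ℝ, EB).prod 𝓘(ℝ, F)) 𝓘(ℝ, EB) (fun q : TotalSpace F A => q.1) p v = 0)
    (h2 : mvfderiv (𝓘(ℝ, EB).prod 𝓘(ℝ, F))
      (fun q : TotalSpace F A => (trivializationAt F A p.1 q).2) p v = 0) : v = 0 := by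
  obtain ⟨Ψ, hΨ⟩ := exists_equiv_mvfderiv_extChartAt (I := 𝓘(ℝ, EB).prod 𝓘(ℝ, F)) p
  have hid : ContMDiffAt (𝓘(ℝ, EB).prod 𝓘(ℝ, F)) (𝓘(ℝ, EB).prod 𝓘(ℝ, F)) ∞
    (fun q : TotalSpace F A => q) p := contMDiffAt_id
  obtain ⟨hs1, hs2⟩ := contMDiffAt_totalSpace.1 hid
  have hE : MDifferentiableAt (𝓘(ℝ, EB).prod 𝓘(ℝ, F)) 𝓘(ℝ, EB × F)
      (extChartAt (𝓘(ℝ, EB).prod 𝓘(ℝ, F)) p) p :=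
    mdifferentiableAt_extChartAt (mem_chart_source _ p)
  have hfst := mvfderiv_comp_fderiv (g := Prod.fst) (x := p) differentiableAt_fst hE v
  have hsnd := mvfderiv_comp_fderiv (g := Prod.snd) (x := p) differentiableAt_snd hE v
  rw [fderiv_fst, hΨ] at hfst
  rw [fderiv_snd, hΨ] at hsnd
  have e1 : (fun q : TotalSpace F A => (extChartAt (𝓘(ℝ, EB).prod 𝓘(ℝ, F)) p q).1) =ᶠ[𝓝 p]
      fun q => extChartAt 𝓘(ℝ, EB) p.1 q.1 := by
    have ho := (FiberBundle.continuous_proj F A).isOpen_preimage _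
      (trivializationAt F A p.1).open_baseSet
    filter_upwards [ho.mem_nhds (mem_baseSet_trivializationAt F A p.1)] with q hq
    rw [FiberBundle.extChartAt]
    change extChartAt 𝓘(ℝ, EB) p.1 (trivializationAt F A p.1 q).1 = _
    rw [(trivializationAt F A p.1).coe_fst' hq]
  have e2 : (fun q : TotalSpace F A => (extChartAt (𝓘(ℝ, EB).prod 𝓘(ℝ, F)) p q).2) =
      fun q => (trivializationAt F A p.1 q).2 := by
    funext q
    rw [FiberBundle.extChartAt]
    rfl
  rw [mvfderiv_congr e1, mvfderiv_comp_apply' (g := extChartAt 𝓘(ℝ, EB) p.1) (x := p)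
    (mdifferentiableAt_extChartAt (mem_chart_source _ p.1)) (hs1.mdifferentiableAt (by simp)), h1,
    map_zero] at hfst
  rw [e2, h2] at hsnd
  have h0 : Ψ v = 0 := Prod.ext hfst.symm hsnd.symm
  exact (map_eq_zero_iff Ψ Ψ.injective).1 h0

variable [FiniteDimensional ℝ EB] [T2Space B] [IsManifold 𝓘(ℝ, EB) ∞ B]

theorem exists_cutoff {x : B} {s : Set B} (hs : s ∈ 𝓝 x) :
    ∃ χ : C^∞⟮𝓘(ℝ, EB), B; ℝ⟯, (∀ᶠ y in 𝓝 x, χ y = 1) ∧ tsupport χ ⊆ s := by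
  obtain ⟨χ, -, h⟩ := (SmoothBumpFunction.nhds_basis_tsupport (I := 𝓘(ℝ, EB)) x).mem_iff.1 hs
  exact ⟨⟨χ, χ.contMDiff⟩, χ.eventuallyEq_one, h⟩

theorem exists_contMDiffMap_eventuallyEq {x : B} {s : Set B} (hs : IsOpen s) (hx : x ∈ s)
    {f : B → ℝ} (hf : ContMDiffOn 𝓘(ℝ, EB) 𝓘(ℝ, ℝ) ∞ f s) :
    ∃ g : C^∞⟮𝓘(ℝ, EB), B; ℝ⟯, ∀ᶠ y in 𝓝 x, g y = f y := by
  obtain ⟨χ, hχ, hsupp⟩ := exists_cutoff (EB := EB) (hs.mem_nhds hx)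
  refine ⟨⟨fun y => χ y * f y, contMDiff_of_tsupport fun y hy => ?_⟩, ?_⟩
  · exact (χ.contMDiff y).mul (hf.contMDiffAt (hs.mem_nhds (hsupp (tsupport_mul_subset_left hy))))
  · filter_upwards [hχ] with y hy
    change χ y * f y = f y
    rw [hy, one_mul]

/-- The covector, read in the chart at `x`, is a linear function of the coordinates; it is cut off
to a global function with the same germ. -/
theorem exists_contMDiffMap_mvfderiv_eq (x : B) (α : TangentSpace 𝓘(ℝ, EB) x →L[ℝ] ℝ) :
    ∃ f : C^∞⟮𝓘(ℝ, EB), B; ℝ⟯, mvfderiv 𝓘(ℝ, EB) f x = α := by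
  obtain ⟨Ψ, hΨ⟩ := exists_equiv_mvfderiv_extChartAt (I := 𝓘(ℝ, EB)) x
  let β : EB →L[ℝ] ℝ := α.comp (Ψ.symm : EB →L[ℝ] TangentSpace 𝓘(ℝ, EB) x)
  obtain ⟨f, hf⟩ := exists_contMDiffMap_eventuallyEq (EB := EB) (f := fun y => β (extChartAt 𝓘(ℝ, EB) x y))
    (chartAt EB x).open_source (mem_chart_source EB x)
    (β.contDiff.contMDiff.comp_contMDiffOn contMDiffOn_extChartAt)
  refine ⟨f, ?_⟩
  rw [mvfderiv_congr hf]
  ext1 v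
  rw [mvfderiv_comp_fderiv β.differentiableAt (mdifferentiableAt_extChartAt (mem_chart_source EB x)),
    β.fderiv, hΨ]
  change α (Ψ.symm (Ψ v)) = α v
  rw [Ψ.symm_apply_apply]

variable {G : Type*} [NormedAddCommGroup G] [NormedSpace ℝ G]
  {E : B → Type*} [∀ x, AddCommGroup (E x)] [∀ x, Module ℝ (E x)]
  [∀ x, TopologicalSpace (E x)] [TopologicalSpace (TotalSpace G E)] [FiberBundle G E]
  [VectorBundle ℝ G E]

/-- The section which is constant in a local trivialization, cut off outside its domain. -/
def cutSection [ContMDiffVectorBundle ∞ G E 𝓘(ℝ, EB)] (e : Trivialization G (π G E))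
    [MemTrivializationAtlas e] (χ : C^∞⟮𝓘(ℝ, EB), B; ℝ⟯) (hχ : tsupport χ ⊆ e.baseSet) (w : G) :
    Sections (EB := EB) G E :=
  ⟨fun y => χ y • e.symm y w, by
    refine ContMDiffOn.smul_section_of_tsupport χ.contMDiff.contMDiffOn e.open_baseSet hχ ?_
    rw [e.contMDiffOn_section_baseSet_iff]
    refine (contMDiffOn_const (c := w)).congr fun y hy => ?_
    rw [e.apply_mk_symm hy]⟩

theorem exists_section_eventuallyEq [ContMDiffVectorBundle ∞ G E 𝓘(ℝ, EB)] (x : B) (w : G) :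
    ∃ X : Sections (EB := EB) G E, ∀ᶠ y in 𝓝 x, X y = (trivializationAt G E x).symm y w := by
  obtain ⟨χ, hχ, hsupp⟩ := exists_cutoff (EB := EB)
    ((trivializationAt G E x).open_baseSet.mem_nhds (mem_baseSet_trivializationAt G E x))
  refine ⟨cutSection (trivializationAt G E x) χ hsupp w, ?_⟩
  filter_upwards [hχ] with y hy
  change χ y • (trivializationAt G E x).symm y w = _
  rw [hy, one_smul]

/-- Near a point, a section is a combination of finitely many global sections. -/
theorem exists_section_decomposition [ContMDiffVectorBundle ∞ G E 𝓘(ℝ, EB)]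
    [FiniteDimensional ℝ G] (X : Sections (EB := EB) G E) (x : B) :
    ∃ (n : ℕ) (f : Fin n → C^∞⟮𝓘(ℝ, EB), B; ℝ⟯) (s : Fin n → Sections (EB := EB) G E)
      (χ : C^∞⟮𝓘(ℝ, EB), B; ℝ⟯), (∀ᶠ y in 𝓝 x, χ y = 0) ∧
      (X = mulSection χ X + ∑ i, mulSection (f i) (s i)) ∧ (X x = 0 → ∀ i, f i x = 0) := by
  set e := trivializationAt G E x with he
  obtain ⟨χ, hχ, hsupp⟩ := exists_cutoff (EB := EB)
    (e.open_baseSet.mem_nhds (mem_baseSet_trivializationAt G E x))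
  let b := Module.finBasis ℝ G
  have hXe : ContMDiffOn 𝓘(ℝ, EB) 𝓘(ℝ, G) ∞ (fun y => (e ⟨y, X y⟩).2) e.baseSet :=
    (e.contMDiffOn_section_baseSet_iff).1 X.contMDiff.contMDiffOn
  have hcoord : ∀ i, ContMDiffOn 𝓘(ℝ, EB) 𝓘(ℝ, ℝ) ∞ (fun y => b.coord i (e ⟨y, X y⟩).2)
      e.baseSet := fun i =>
    (LinearMap.toContinuousLinearMap (b.coord i)).contDiff.contMDiff.comp_contMDiffOn hXe
  -- The coefficients and the cut-off frame each carry one factor of the cutoff, so together they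
  -- give its square times `X`. The remainder has the coefficient `1 - χ * χ`, which vanishes near
  -- `x`. All terms are global, as the Leibniz rule for brackets of global sections requires.
  refine ⟨_, fun i => ⟨fun y => χ y * b.coord i (e ⟨y, X y⟩).2, contMDiff_of_tsupport fun y hy =>
    (χ.contMDiff y).mul ((hcoord i).contMDiffAt
      (e.open_baseSet.mem_nhds (hsupp (tsupport_mul_subset_left hy))))⟩,
    fun i => cutSection e χ hsupp (b i), 1 - χ * χ, ?_, ?_, ?_⟩
  · filter_upwards [hχ] with y hy
    change 1 - χ y * χ y = 0
    rw [hy]; ring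
  · ext y
    have hsum : ∀ t : Finset (Fin (Module.finrank ℝ G)), ∀ Z : Fin (Module.finrank ℝ G) →
        Sections (EB := EB) G E, (∑ i ∈ t, Z i) y = ∑ i ∈ t, Z i y := fun t Z =>
      map_sum ((Pi.evalAddMonoidHom (fun x => E x) y).comp (ContMDiffSection.coeAddHom _ _ _ _)) Z t
    rw [ContMDiffSection.coe_add, Pi.add_apply, hsum]
    change X y = (1 - χ y * χ y) • X y +
      ∑ i, (χ y * b.coord i (e ⟨y, X y⟩).2) • χ y • e.symm y (b i)
    by_cases hy : y ∈ e.baseSet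
    · have h1 : ∑ i, (χ y * b.coord i (e ⟨y, X y⟩).2) • χ y • e.symm y (b i) =
          (χ y * χ y) • e.symmL ℝ y (∑ i, b.coord i (e ⟨y, X y⟩).2 • b i) := by
        rw [map_sum, Finset.smul_sum]
        refine Finset.sum_congr rfl fun i _ => ?_
        rw [map_smul, e.symmL_apply hy, smul_smul, smul_smul]
        congr 1
        ring
      have h2 : ∑ i, b.coord i (e ⟨y, X y⟩).2 • b i = (e ⟨y, X y⟩).2 := b.sum_repr _
      rw [h1, h2, e.symmL_apply hy, e.symm_apply_apply_mk hy, ← add_smul]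
      simp
    · have : χ y = 0 := image_eq_zero_of_notMem_tsupport fun h => hy (hsupp h)
      simp [this]
  · intro h0 i
    change χ x * b.coord i (e ⟨x, X x⟩).2 = 0
    have h1 : (e ⟨x, X x⟩).2 = 0 := by
      rw [h0]
      have := e.zeroSection ℝ (mem_baseSet_trivializationAt G E x)
      exact congrArg Prod.snd this
    rw [h1, map_zero, mul_zero]

end TotalSpaces

/-! ### Linear functions on the dual of a vector bundle -/

section Dual

variable {EB : Type*} [NormedAddCommGroup EB] [NormedSpace ℝ EB]
  {B : Type*} [TopologicalSpace B] [ChartedSpace EB B]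
  {G : Type*} [NormedAddCommGroup G] [NormedSpace ℝ G]
  {E : B → Type*} [∀ x, AddCommGroup (E x)] [∀ x, Module ℝ (E x)]
  [∀ x, TopologicalSpace (E x)] [TopologicalSpace (TotalSpace G E)] [FiberBundle G E]
  [VectorBundle ℝ G E]

theorem trivializationAt_dual (x : B) (q : DualSpace G E) (w : G) :
    (trivializationAt (G →L[ℝ] ℝ) (DualBundle E) x q).2 w =
      q.2 ((trivializationAt G E x).symmL ℝ q.1 w) := by
  rw [hom_trivializationAt_apply]
  simp [ContinuousLinearMap.inCoordinates]

theorem contMDiff_linFun (X : Sections (EB := EB) G E) :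
    ContMDiff (𝓘(ℝ, EB).prod 𝓘(ℝ, G →L[ℝ] ℝ)) 𝓘(ℝ, ℝ) ∞ (linFun X) := by
  intro ψ
  have h1 : ContMDiffAt (𝓘(ℝ, EB).prod 𝓘(ℝ, G →L[ℝ] ℝ)) (𝓘(ℝ, EB).prod 𝓘(ℝ, G →L[ℝ] ℝ)) ∞
    (fun m : DualSpace G E => (TotalSpace.mk' (G →L[ℝ] ℝ) m.1 m.2 : DualSpace G E)) ψ :=
    contMDiffAt_id
  have h2 : ContMDiffAt (𝓘(ℝ, EB).prod 𝓘(ℝ, G →L[ℝ] ℝ)) (𝓘(ℝ, EB).prod 𝓘(ℝ, G)) ∞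
      (fun m : DualSpace G E => TotalSpace.mk' G m.1 (X m.1)) ψ :=
    X.contMDiff.contMDiffAt.comp ψ (contMDiffAt_proj (DualBundle E))
  have h3 := h1.clm_bundle_apply h2
  exact (contMDiffAt_totalSpace.1 h3).2

/-- The pull-back of a function on the base to the total space of the dual bundle. -/
def baseFun (f : C^∞⟮𝓘(ℝ, EB), B; ℝ⟯) (ψ : DualSpace G E) : ℝ := f ψ.1

theorem contMDiff_baseFun (f : C^∞⟮𝓘(ℝ, EB), B; ℝ⟯) :
    ContMDiff (𝓘(ℝ, EB).prod 𝓘(ℝ, G →L[ℝ] ℝ)) 𝓘(ℝ, ℝ) ∞ (baseFun (G := G) (E := E) f) :=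
  f.contMDiff.comp (contMDiff_proj (DualBundle E))

theorem mvfderiv_baseFun (f : C^∞⟮𝓘(ℝ, EB), B; ℝ⟯) (ψ : DualSpace G E)
    (v : TangentSpace (𝓘(ℝ, EB).prod 𝓘(ℝ, G →L[ℝ] ℝ)) ψ) :
    mvfderiv (𝓘(ℝ, EB).prod 𝓘(ℝ, G →L[ℝ] ℝ)) (baseFun f) ψ v =
      mvfderiv 𝓘(ℝ, EB) f ψ.1
        (mfderiv (𝓘(ℝ, EB).prod 𝓘(ℝ, G →L[ℝ] ℝ)) 𝓘(ℝ, EB) (fun q : DualSpace G E => q.1) ψ v) :=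
  mvfderiv_comp_apply' (g := f) (f := fun q : DualSpace G E => q.1)
    ((f.contMDiff _).mdifferentiableAt (by simp))
    ((contMDiff_proj (DualBundle E) ψ).mdifferentiableAt (n := ∞) (by simp)) v

theorem linFun_add (X Y : Sections (EB := EB) G E) :
    linFun (X + Y) = fun ψ => linFun X ψ + linFun Y ψ := funext fun ψ => map_add ψ.2 _ _

theorem linFun_smul (c : ℝ) (X : Sections (EB := EB) G E) :
    linFun (c • X) = fun ψ => c * linFun X ψ := funext fun ψ => map_smul ψ.2 _ _

theorem linFun_neg (X : Sections (EB := EB) G E) :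
    linFun (-X) = fun ψ => -linFun X ψ := funext fun ψ => map_neg ψ.2 _

theorem linFun_zero : linFun (0 : Sections (EB := EB) G E) = fun _ => 0 :=
  funext fun ψ => map_zero ψ.2

theorem linFun_mulSection (f : C^∞⟮𝓘(ℝ, EB), B; ℝ⟯) (X : Sections (EB := EB) G E) :
    linFun (mulSection f X) = fun ψ => baseFun f ψ * linFun X ψ :=
  funext fun ψ => map_smul ψ.2 _ _

/-- If `φ` kills `Z x` and `η` does not, then on the line `φ + t • η` the function takes the value
`t * η (Z x)`, nonzero for `t ≠ 0`. -/
theorem dense_linFun_ne_zero {Z : Sections (EB := EB) G E}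
    (hZ : ∀ x, ∃ η : E x →L[ℝ] ℝ, η (Z x) ≠ 0) : Dense {ψ : DualSpace G E | linFun Z ψ ≠ 0} := by
  rintro ⟨x, φ⟩
  by_cases hφ : φ (Z x) = 0
  swap
  · exact subset_closure hφ
  obtain ⟨η, hη⟩ := hZ x
  have h1 : Continuous (fun ξ : E x →L[ℝ] ℝ => (⟨x, ξ⟩ : DualSpace G E)) :=
    FiberBundle.continuous_totalSpaceMk (G →L[ℝ] ℝ) (DualBundle E) x
  have h2 : Continuous fun t : ℝ => (show E x →L[ℝ] ℝ from φ) + t • η := by fun_prop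
  have h3 := (h1.comp h2).tendsto 0
  rw [Function.comp_apply, zero_smul, add_zero] at h3
  refine mem_closure_of_tendsto (h3.mono_left (nhdsWithin_le_nhds (s := {0}ᶜ))) ?_
  filter_upwards [self_mem_nhdsWithin] with t ht
  change φ (Z x) + t * η (Z x) ≠ 0
  rw [hφ, zero_add]
  exact mul_ne_zero ht hη

variable (EB) in
/-- The differential at `ψ` of the function `ι_X + π^* f`. -/
def fiberwiseAffineDiff (ψ : DualSpace G E) :
    (Sections (EB := EB) G E × C^∞⟮𝓘(ℝ, EB), B; ℝ⟯) →ₗ[ℝ]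
      (TangentSpace (𝓘(ℝ, EB).prod 𝓘(ℝ, G →L[ℝ] ℝ)) ψ →L[ℝ] ℝ) where
  toFun p := mvfderiv _ (linFun p.1) ψ + mvfderiv _ (baseFun p.2) ψ
  map_add' p q := by
    have h : baseFun (G := G) (E := E) (p.2 + q.2) = fun ψ => baseFun p.2 ψ + baseFun q.2 ψ := rfl
    simp only [Prod.fst_add, Prod.snd_add]
    rw [linFun_add, h, mvfderiv_fun_add' (contMDiff_linFun _) (contMDiff_linFun _),
      mvfderiv_fun_add' (contMDiff_baseFun _) (contMDiff_baseFun _)]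
    abel
  map_smul' c p := by
    have h : baseFun (G := G) (E := E) (c • p.2) = fun ψ => c * baseFun p.2 ψ := rfl
    simp only [Prod.smul_fst, Prod.smul_snd, RingHom.id_apply]
    rw [linFun_smul, h, mvfderiv_fun_mul' contMDiff_const (contMDiff_linFun _),
      mvfderiv_fun_mul' contMDiff_const (contMDiff_baseFun _), mvfderiv_const]
    simp

variable [IsManifold 𝓘(ℝ, EB) ∞ B] [ContMDiffVectorBundle ∞ G E 𝓘(ℝ, EB)]
  [FiniteDimensional ℝ EB] [T2Space B]

/-- Functions from the base detect the projection of `v`. Sections that are constant in a local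
trivialization near `ψ.1` detect its fibre components. -/
theorem tangent_dual_eq_zero {ψ : DualSpace G E}
    {v : TangentSpace (𝓘(ℝ, EB).prod 𝓘(ℝ, G →L[ℝ] ℝ)) ψ}
    (h1 : ∀ f : C^∞⟮𝓘(ℝ, EB), B; ℝ⟯, mvfderiv _ (baseFun f) ψ v = 0)
    (h2 : ∀ X : Sections (EB := EB) G E, mvfderiv _ (linFun X) ψ v = 0) : v = 0 := by
  have hid : ContMDiffAt (𝓘(ℝ, EB).prod 𝓘(ℝ, G →L[ℝ] ℝ)) (𝓘(ℝ, EB).prod 𝓘(ℝ, G →L[ℝ] ℝ)) ∞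
    (fun q : DualSpace G E => q) ψ := contMDiffAt_id
  obtain ⟨hs1, hs2⟩ := contMDiffAt_totalSpace.1 hid
  refine tangent_totalSpace_eq_zero ?_ ?_
  · refine ext_of_covectors fun α => ?_
    obtain ⟨f, rfl⟩ := exists_contMDiffMap_mvfderiv_eq ψ.1 α
    rw [← mvfderiv_baseFun, h1, map_zero]
  · refine ContinuousLinearMap.ext fun w => ?_
    let ev : (G →L[ℝ] ℝ) →L[ℝ] ℝ := ContinuousLinearMap.apply ℝ ℝ w
    have h3 := mvfderiv_comp_fderiv (g := ev) (ev.differentiableAt)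
      (hs2.mdifferentiableAt (by simp)) v
    rw [ev.fderiv] at h3
    refine h3.symm.trans ?_
    obtain ⟨X, hX⟩ := exists_section_eventuallyEq (EB := EB) (E := E) ψ.1 w
    rw [zero_apply, ← h2 X]
    refine DFunLike.congr_fun (mvfderiv_congr ?_) v
    have hb := (trivializationAt G E ψ.1).open_baseSet.mem_nhds
      (mem_baseSet_trivializationAt G E ψ.1)
    filter_upwards [(FiberBundle.continuous_proj (G →L[ℝ] ℝ) (DualBundle E)).continuousAt.eventually
      (hX.and hb)] with q hq
    refine (trivializationAt_dual ψ.1 q w).trans ?_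
    rw [linFun, hq.1, (trivializationAt G E ψ.1).symmL_apply hq.2]

variable [FiniteDimensional ℝ G]

theorem span_linFun_baseFun (ψ : DualSpace G E) :
    Submodule.span ℝ (range fun p : Sections (EB := EB) G E × C^∞⟮𝓘(ℝ, EB), B; ℝ⟯ =>
      fiberwiseAffineDiff EB ψ p) = ⊤ := by
  refine span_eq_top_of_separating fun v hv => tangent_dual_eq_zero (fun f => ?_) fun X => ?_
  · have h := hv _ ⟨(0, f), rfl⟩
    change mvfderiv _ (linFun (0 : Sections (EB := EB) G E)) ψ v + mvfderiv _ (baseFun f) ψ v = 0 at h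
    rwa [linFun_zero, mvfderiv_const, zero_apply, zero_add] at h
  · have h := hv _ ⟨(X, 0), rfl⟩
    change mvfderiv _ (linFun X) ψ v + mvfderiv _ (fun _ => (0 : ℝ)) ψ v = 0 at h
    rwa [mvfderiv_const, zero_apply, add_zero] at h

theorem surjective_fiberwiseAffineDiff (ψ : DualSpace G E) :
    Function.Surjective (fiberwiseAffineDiff EB ψ) := by
  intro α
  have h := span_linFun_baseFun (EB := EB) ψ
  rw [show (range fun p => fiberwiseAffineDiff EB ψ p) =
    ((LinearMap.range (fiberwiseAffineDiff EB ψ) : Submodule ℝ _) : Set _) from rfl,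
    Submodule.span_eq] at h
  exact LinearMap.range_eq_top.1 h α

/-- Away from the zeros of a linear function, the differentials of linear functions exhaust the
cotangent spaces. -/
theorem exists_mvfderiv_linFun_eq {ψ : DualSpace G E} {Z : Sections (EB := EB) G E}
    (hZ : linFun Z ψ ≠ 0) (α : TangentSpace (𝓘(ℝ, EB).prod 𝓘(ℝ, G →L[ℝ] ℝ)) ψ →L[ℝ] ℝ) :
    ∃ X : Sections (EB := EB) G E, mvfderiv _ (linFun X) ψ = α := by
  obtain ⟨⟨X, f⟩, rfl⟩ := surjective_fiberwiseAffineDiff ψ α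
  set c := linFun Z ψ with hc
  -- At `ψ` one has `d ι_{fZ} = f dι_Z + c π^*df`, so `c⁻¹ ι_{fZ} - c⁻¹ f(ψ) ι_Z` is a linear
  -- function with differential `π^*df`.
  refine ⟨X + (c⁻¹ • mulSection f Z + (-(c⁻¹ * f ψ.1)) • Z), ?_⟩
  have hs : ∀ (a : ℝ) (W : Sections (EB := EB) G E),
      mvfderiv (𝓘(ℝ, EB).prod 𝓘(ℝ, G →L[ℝ] ℝ)) (linFun (a • W)) ψ =
        a • mvfderiv _ (linFun W) ψ := by
    intro a W
    rw [linFun_smul, mvfderiv_fun_mul' contMDiff_const (contMDiff_linFun _), mvfderiv_const]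
    simp
  rw [linFun_add, mvfderiv_fun_add' (contMDiff_linFun _) (contMDiff_linFun _), linFun_add,
    mvfderiv_fun_add' (contMDiff_linFun _) (contMDiff_linFun _), hs, hs, linFun_mulSection,
    mvfderiv_fun_mul' (contMDiff_baseFun _) (contMDiff_linFun _), ← hc]
  change _ = mvfderiv _ (linFun X) ψ + mvfderiv _ (baseFun f) ψ
  congr 1
  rw [smul_add, smul_smul, smul_smul, inv_mul_cancel₀ hZ]
  change (c⁻¹ * f ψ.1) • _ + _ + _ = _
  rw [neg_smul, one_smul]
  abel

end Dual

/-! ### Vertical vectors and the linear Poisson structure of a Lie algebroid -/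

section LinearPoisson

variable {EB : Type*} [NormedAddCommGroup EB] [NormedSpace ℝ EB]
  {B : Type*} [TopologicalSpace B] [ChartedSpace EB B]
  {G : Type*} [NormedAddCommGroup G] [NormedSpace ℝ G]
  {E : B → Type*} [∀ x, AddCommGroup (E x)] [∀ x, Module ℝ (E x)]
  [∀ x, TopologicalSpace (E x)] [TopologicalSpace (TotalSpace G E)] [FiberBundle G E]
  [VectorBundle ℝ G E]

theorem contMDiff_line {x : B} (φ η : E x →L[ℝ] ℝ) :
    ContMDiff 𝓘(ℝ, ℝ) (𝓘(ℝ, EB).prod 𝓘(ℝ, G →L[ℝ] ℝ)) ∞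
      (fun t : ℝ => (⟨x, φ + t • η⟩ : DualSpace G E)) := by
  intro t
  rw [contMDiffAt_totalSpace]
  refine ⟨contMDiffAt_const, ?_⟩
  have h : (fun s : ℝ => (trivializationAt (G →L[ℝ] ℝ) (DualBundle E) x
      (⟨x, φ + s • η⟩ : DualSpace G E)).2) = fun s =>
      φ.comp ((trivializationAt G E x).symmL ℝ x) +
        s • η.comp ((trivializationAt G E x).symmL ℝ x) := by
    funext s
    refine ContinuousLinearMap.ext fun w => ?_
    rw [trivializationAt_dual]
    rfl
  refine ContMDiffAt.congr_of_eventuallyEq (ContDiffAt.contMDiffAt ?_)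
    (Eventually.of_forall (congrFun h))
  fun_prop

theorem mvfderiv_line {x : B} (φ η : E x →L[ℝ] ℝ) {f : DualSpace G E → ℝ}
    (hf : ContMDiff (𝓘(ℝ, EB).prod 𝓘(ℝ, G →L[ℝ] ℝ)) 𝓘(ℝ, ℝ) ∞ f) {a b : ℝ}
    (h : ∀ s : ℝ, f (⟨x, φ + s • η⟩ : DualSpace G E) = a + s * b) (t : ℝ) :
    mvfderiv (𝓘(ℝ, EB).prod 𝓘(ℝ, G →L[ℝ] ℝ)) f ⟨x, φ + t • η⟩
      (mfderiv 𝓘(ℝ, ℝ) (𝓘(ℝ, EB).prod 𝓘(ℝ, G →L[ℝ] ℝ))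
        (fun t : ℝ => (⟨x, φ + t • η⟩ : DualSpace G E)) t (1 : ℝ)) = b := by
  have h1 := mvfderiv_comp_apply' (g := f) (f := fun t : ℝ => (⟨x, φ + t • η⟩ : DualSpace G E))
    (x := t) ((hf _).mdifferentiableAt (by simp))
    ((contMDiff_line (EB := EB) φ η t).mdifferentiableAt (by simp)) (1 : ℝ)
  refine h1.symm.trans ?_
  simp only [h]
  have h2 : HasDerivAt (fun s : ℝ => a + s * b) b t := by
    simpa using ((hasDerivAt_id t).mul_const b).const_add a
  have h3 : mfderiv 𝓘(ℝ, ℝ) 𝓘(ℝ, ℝ) (fun s : ℝ => a + s * b) t (1 : ℝ) = b := by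
    rw [mfderiv_eq_fderiv, h2.hasFDerivAt.fderiv]
    exact (one_smul ℝ b)
  exact h3

/-- The vector is the velocity at `t = 0` of the line `ψ + t • η` in the fibre. -/
theorem exists_vertical (ψ : DualSpace G E) (η : E ψ.1 →L[ℝ] ℝ) :
    ∃ v : TangentSpace (𝓘(ℝ, EB).prod 𝓘(ℝ, G →L[ℝ] ℝ)) ψ,
      (∀ X : Sections (EB := EB) G E, mvfderiv _ (linFun X) ψ v = η (X ψ.1)) ∧
      ∀ f : C^∞⟮𝓘(ℝ, EB), B; ℝ⟯, mvfderiv _ (baseFun f) ψ v = 0 := by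
  obtain ⟨x, φ⟩ := ψ
  have h : ∃ v : TangentSpace (𝓘(ℝ, EB).prod 𝓘(ℝ, G →L[ℝ] ℝ))
      (⟨x, φ + (0 : ℝ) • η⟩ : DualSpace G E),
      (∀ X : Sections (EB := EB) G E, mvfderiv _ (linFun X) ⟨x, φ + (0 : ℝ) • η⟩ v = η (X x)) ∧
      ∀ f : C^∞⟮𝓘(ℝ, EB), B; ℝ⟯, mvfderiv _ (baseFun f)
        (⟨x, φ + (0 : ℝ) • η⟩ : DualSpace G E) v = 0 :=
    ⟨_, fun X => mvfderiv_line φ η (contMDiff_linFun X) (a := φ (X x)) (fun _ => rfl) 0,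
      fun f => mvfderiv_line φ η (contMDiff_baseFun f) (a := f x) (b := 0)
        (fun _ => by rw [mul_zero, add_zero]; rfl) 0⟩
  rwa [show (⟨x, φ + (0 : ℝ) • η⟩ : DualSpace G E) = ⟨x, φ⟩ by rw [zero_smul, add_zero]] at h

/-- The Liouville vector is the velocity at `t = 1` of the line through `0` in the direction of `ψ`,
so `mvfderiv_line` applies after identifying `0 + 1 • ψ.2` with `ψ.2`. -/
theorem mvfderiv_liouville {f : DualSpace G E → ℝ}
    (hf : ContMDiff (𝓘(ℝ, EB).prod 𝓘(ℝ, G →L[ℝ] ℝ)) 𝓘(ℝ, ℝ) ∞ f) (ψ : DualSpace G E) {a b : ℝ}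
    (h : ∀ s : ℝ, f (⟨ψ.1, s • ψ.2⟩ : DualSpace G E) = a + s * b) :
    mvfderiv (𝓘(ℝ, EB).prod 𝓘(ℝ, G →L[ℝ] ℝ)) f ψ (liouville EB ψ) = b := by
  have h1 := mvfderiv_line (EB := EB) (0 : E ψ.1 →L[ℝ] ℝ) ψ.2 hf (a := a) (b := b)
    (fun s => by rw [zero_add]; exact h s) 1
  have h2 : (fun t : ℝ => (⟨ψ.1, (0 : E ψ.1 →L[ℝ] ℝ) + t • ψ.2⟩ : DualSpace G E)) =
      fun t : ℝ => ⟨ψ.1, t • ψ.2⟩ := by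
    funext t; rw [zero_add]
  have h3 : ∀ q : DualSpace G E, q = ψ → (mvfderiv (𝓘(ℝ, EB).prod 𝓘(ℝ, G →L[ℝ] ℝ)) f q :
      EB × (G →L[ℝ] ℝ) →L[ℝ] ℝ) = mvfderiv (𝓘(ℝ, EB).prod 𝓘(ℝ, G →L[ℝ] ℝ)) f ψ := by
    rintro q rfl; rfl
  rw [h2] at h1
  have h4 := h3 ⟨ψ.1, (0 : E ψ.1 →L[ℝ] ℝ) + (1 : ℝ) • ψ.2⟩ (by rw [zero_add, one_smul])
  exact (DFunLike.congr_fun h4 _).symm.trans h1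

theorem mvfderiv_linFun_liouville (X : Sections (EB := EB) G E) (ψ : DualSpace G E) :
    mvfderiv (𝓘(ℝ, EB).prod 𝓘(ℝ, G →L[ℝ] ℝ)) (linFun X) ψ (liouville EB ψ) = linFun X ψ :=
  mvfderiv_liouville (contMDiff_linFun X) ψ (a := 0) fun _ => (zero_add _).symm

theorem mvfderiv_baseFun_liouville (f : C^∞⟮𝓘(ℝ, EB), B; ℝ⟯) (ψ : DualSpace G E) :
    mvfderiv (𝓘(ℝ, EB).prod 𝓘(ℝ, G →L[ℝ] ℝ)) (baseFun f) ψ (liouville EB ψ) = 0 :=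
  mvfderiv_liouville (contMDiff_baseFun f) ψ (a := f ψ.1) fun _ => by
    rw [mul_zero, add_zero]; rfl

/-- A smooth local section `σ` through `ψ` recovers `f` near `ψ.1` as `π^* f ∘ σ`. -/
theorem mvfderiv_eq_zero_of_baseFun {f : C^∞⟮𝓘(ℝ, EB), B; ℝ⟯} {ψ : DualSpace G E}
    (h : mvfderiv (𝓘(ℝ, EB).prod 𝓘(ℝ, G →L[ℝ] ℝ)) (baseFun f) ψ = 0) :
    mvfderiv 𝓘(ℝ, EB) f ψ.1 = 0 := by
  set e := trivializationAt (G →L[ℝ] ℝ) (DualBundle E) ψ.1 with he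
  have hx : ψ.1 ∈ e.baseSet := mem_baseSet_trivializationAt (G →L[ℝ] ℝ) (DualBundle E) ψ.1
  set σ : B → DualSpace G E := fun y => e.toOpenPartialHomeomorph.symm (y, (e ψ).2) with hσ
  have hσx : σ ψ.1 = ψ := by
    have h1 : (ψ.1, (e ψ).2) = e ψ := Prod.ext (e.coe_fst' hx).symm rfl
    rw [hσ]
    beta_reduce
    rw [h1]
    exact e.toOpenPartialHomeomorph.left_inv (e.mem_source.2 hx)
  have hsm : ContMDiffAt 𝓘(ℝ, EB) (𝓘(ℝ, EB).prod 𝓘(ℝ, G →L[ℝ] ℝ)) ∞ σ ψ.1 :=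
    contMDiffAt_trivialization_symm ψ.1 (e ψ).2
  have hf : f =ᶠ[𝓝 ψ.1] fun y => baseFun f (σ y) := by
    filter_upwards [e.open_baseSet.mem_nhds hx] with y hy
    exact congrArg f (e.proj_symm_apply (x := (y, (e ψ).2)) (e.mem_target.2 hy)).symm
  rw [mvfderiv_congr hf]
  ext1 v
  rw [mvfderiv_comp_apply' ((contMDiff_baseFun f _).mdifferentiableAt (by simp))
    (hsm.mdifferentiableAt (by simp))]
  have h2 : mvfderiv (𝓘(ℝ, EB).prod 𝓘(ℝ, G →L[ℝ] ℝ)) (baseFun f) (σ ψ.1) = 0 := by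
    rw [hσx]; exact h
  rw [h2]
  rfl

theorem eq_zero_of_dual [FiniteDimensional ℝ G] {x : B} {w : E x}
    (h : ∀ η : E x →L[ℝ] ℝ, η w = 0) : w = 0 := by
  let e := (trivializationAt G E x).continuousLinearEquivAt ℝ x (mem_baseSet_trivializationAt G E x)
  refine e.injective ?_
  rw [map_zero]
  refine (Module.forall_dual_apply_eq_zero_iff ℝ _).1 fun l => ?_
  exact h ((LinearMap.toContinuousLinearMap l).comp (e : E x →L[ℝ] G))

variable (EB) in
/-- The differential at `x`, as a linear map on smooth functions. -/
def diffAt (x : B) : C^∞⟮𝓘(ℝ, EB), B; ℝ⟯ →ₗ[ℝ] (TangentSpace 𝓘(ℝ, EB) x →L[ℝ] ℝ) where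
  toFun f := mvfderiv 𝓘(ℝ, EB) f x
  map_add' f g := mvfderiv_fun_add' f.contMDiff g.contMDiff x
  map_smul' c f := by
    have h := mvfderiv_fun_mul' (contMDiff_const (c := c)) f.contMDiff x
    rw [mvfderiv_const, smul_zero, add_zero] at h
    exact h

theorem contMDiff_fiberwiseAffine (p : Sections (EB := EB) G E × C^∞⟮𝓘(ℝ, EB), B; ℝ⟯) :
    ContMDiff (𝓘(ℝ, EB).prod 𝓘(ℝ, G →L[ℝ] ℝ)) 𝓘(ℝ, ℝ) ∞
      fun ψ : DualSpace G E => linFun p.1 ψ + baseFun p.2 ψ :=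
  (contMDiff_linFun p.1).add (contMDiff_baseFun p.2)

theorem mvfderiv_fiberwiseAffine (p : Sections (EB := EB) G E × C^∞⟮𝓘(ℝ, EB), B; ℝ⟯)
    (ψ : DualSpace G E) :
    mvfderiv (𝓘(ℝ, EB).prod 𝓘(ℝ, G →L[ℝ] ℝ))
      (fun ψ : DualSpace G E => linFun p.1 ψ + baseFun p.2 ψ) ψ = fiberwiseAffineDiff EB ψ p :=
  mvfderiv_fun_add' (contMDiff_linFun p.1) (contMDiff_baseFun p.2) ψ

/-- At a zero of `f` the product rule leaves only the term in `df`. Thus, at the level of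
differentials, the section `f X` can be traded for the base function `ι_X(ψ) f`. -/
theorem fiberwiseAffineDiff_mulSection (ψ : DualSpace G E) (f : C^∞⟮𝓘(ℝ, EB), B; ℝ⟯)
    (X : Sections (EB := EB) G E) (hf : f ψ.1 = 0) :
    fiberwiseAffineDiff EB ψ (mulSection f X, 0) =
      linFun X ψ • fiberwiseAffineDiff EB ψ (0, f) := by
  change mvfderiv _ (linFun (mulSection f X)) ψ + mvfderiv _ (fun _ => (0 : ℝ)) ψ =
    linFun X ψ • (mvfderiv _ (linFun (0 : Sections (EB := EB) G E)) ψ + mvfderiv _ (baseFun f) ψ)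
  have h : baseFun (G := G) (E := E) f ψ = 0 := hf
  rw [linFun_mulSection, mvfderiv_fun_mul' (contMDiff_baseFun f) (contMDiff_linFun X), linFun_zero,
    mvfderiv_const, h, zero_smul, zero_add, zero_add, add_zero]

variable [IsManifold 𝓘(ℝ, EB) ∞ B]

theorem LieAlgebroid.bracket_swap (L : LieAlgebroid EB G E) (X Y : Sections (EB := EB) G E) :
    L.bracket X Y = -L.bracket Y X := by
  have h := L.bracket_self (X + Y)
  simp only [map_add, LinearMap.add_apply, L.bracket_self, zero_add, add_zero] at h
  exact eq_neg_of_add_eq_zero_right h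

/-- The bilinear form on pairs `(X, f)`, thought of as the functions `ι_X + π^* f`, which induces
the linear Poisson structure. -/
def LieAlgebroid.form (L : LieAlgebroid EB G E) (ψ : DualSpace G E) :
    (Sections (EB := EB) G E × C^∞⟮𝓘(ℝ, EB), B; ℝ⟯) →ₗ[ℝ]
      (Sections (EB := EB) G E × C^∞⟮𝓘(ℝ, EB), B; ℝ⟯) →ₗ[ℝ] ℝ :=
  LinearMap.mk₂ ℝ (fun p q => ψ.2 (L.bracket p.1 q.1 ψ.1) +
      diffAt EB ψ.1 q.2 (L.anchor ψ.1 (p.1 ψ.1)) - diffAt EB ψ.1 p.2 (L.anchor ψ.1 (q.1 ψ.1)))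
    (fun p p' q => by
      simp only [Prod.fst_add, Prod.snd_add, map_add, LinearMap.add_apply,
        ContMDiffSection.coe_add, Pi.add_apply, add_apply]
      ring)
    (fun c p q => by
      simp only [Prod.smul_fst, Prod.smul_snd, map_smul, LinearMap.smul_apply,
        ContMDiffSection.coe_smul, Pi.smul_apply, smul_apply, smul_eq_mul]
      ring)
    (fun p q q' => by
      simp only [Prod.fst_add, Prod.snd_add, map_add,
        ContMDiffSection.coe_add, Pi.add_apply, add_apply]
      ring)
    (fun c p q => by
      simp only [Prod.smul_fst, Prod.smul_snd, map_smul,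
        ContMDiffSection.coe_smul, Pi.smul_apply, smul_apply, smul_eq_mul]
      ring)

theorem LieAlgebroid.form_apply (L : LieAlgebroid EB G E) (ψ : DualSpace G E)
    (p q : Sections (EB := EB) G E × C^∞⟮𝓘(ℝ, EB), B; ℝ⟯) :
    L.form ψ p q = linFun (L.bracket p.1 q.1) ψ +
      mvfderiv 𝓘(ℝ, EB) q.2 ψ.1 (L.anchor ψ.1 (p.1 ψ.1)) -
      mvfderiv 𝓘(ℝ, EB) p.2 ψ.1 (L.anchor ψ.1 (q.1 ψ.1)) := rfl

theorem LieAlgebroid.form_self (L : LieAlgebroid EB G E) (ψ : DualSpace G E)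
    (p : Sections (EB := EB) G E × C^∞⟮𝓘(ℝ, EB), B; ℝ⟯) : L.form ψ p p = 0 := by
  rw [L.form_apply, L.bracket_self, linFun_zero]
  ring

theorem LieAlgebroid.contMDiff_form (L : LieAlgebroid EB G E)
    (p q : Sections (EB := EB) G E × C^∞⟮𝓘(ℝ, EB), B; ℝ⟯) :
    ContMDiff (𝓘(ℝ, EB).prod 𝓘(ℝ, G →L[ℝ] ℝ)) 𝓘(ℝ, ℝ) ∞ fun ψ => L.form ψ p q := by
  have h : ∀ (X : Sections (EB := EB) G E) (f : C^∞⟮𝓘(ℝ, EB), B; ℝ⟯),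
      ContMDiff (𝓘(ℝ, EB).prod 𝓘(ℝ, G →L[ℝ] ℝ)) 𝓘(ℝ, ℝ) ∞
        fun ψ : DualSpace G E => mvfderiv 𝓘(ℝ, EB) f ψ.1 (L.anchor ψ.1 (X ψ.1)) := by
    intro X f
    exact (contMDiff_along ⟨_, L.anchor_smooth X⟩ f.contMDiff).comp (contMDiff_proj (DualBundle E))
  exact ((contMDiff_linFun _).add (h _ _)).sub (h _ _)

variable [ContMDiffVectorBundle ∞ G E 𝓘(ℝ, EB)] [FiniteDimensional ℝ EB] [T2Space B]
  [FiniteDimensional ℝ G]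

/-- This is the well-definedness of the Poisson tensor on covectors. Vertical vectors show that `X`
vanishes at the base point, so up to a term vanishing near that point `X` is `∑ c_i s_i` with all
`c_i` zero there. Then `ι_X` has the same differential as the base function `g' = ∑ ι_{s_i}(ψ) c_i`,
so `d(g' + f) = 0` there. By the Leibniz rule the same `g'` satisfies `ι_[Y,X](ψ) = ρ(Y) g'`. The
form is therefore `-ρ(Y)(g' + f) = 0`. -/
theorem LieAlgebroid.form_eq_zero (L : LieAlgebroid EB G E) {ψ : DualSpace G E}
    {p : Sections (EB := EB) G E × C^∞⟮𝓘(ℝ, EB), B; ℝ⟯} (hp : fiberwiseAffineDiff EB ψ p = 0)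
    (q : Sections (EB := EB) G E × C^∞⟮𝓘(ℝ, EB), B; ℝ⟯) : L.form ψ p q = 0 := by
  obtain ⟨X, f⟩ := p
  obtain ⟨Y, g⟩ := q
  have hX : X ψ.1 = 0 := by
    refine eq_zero_of_dual (G := G) fun η => ?_
    obtain ⟨v, hv1, hv2⟩ := exists_vertical (EB := EB) ψ η
    rw [← hv1 X]
    have h1 := DFunLike.congr_fun hp v
    change mvfderiv _ (linFun X) ψ v + mvfderiv _ (baseFun f) ψ v = 0 at h1
    rwa [hv2, add_zero] at h1
  obtain ⟨n, c, s, χ, hχ, hdec, hc⟩ := exists_section_decomposition X ψ.1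
  replace hc := hc hX
  set g' : C^∞⟮𝓘(ℝ, EB), B; ℝ⟯ := ∑ i, linFun (s i) ψ • c i with hg'
  have h1 : fiberwiseAffineDiff EB ψ (X, 0) = fiberwiseAffineDiff EB ψ (0, g') := by
    have h2 : ((X, 0) : Sections (EB := EB) G E × C^∞⟮𝓘(ℝ, EB), B; ℝ⟯) =
        (mulSection χ X, 0) + ∑ i, (mulSection (c i) (s i), 0) := by
      conv_lhs => rw [hdec]
      ext1
      · simp [Prod.fst_sum]
      · simp [Prod.snd_sum]
    have h3 : ((0, g') : Sections (EB := EB) G E × C^∞⟮𝓘(ℝ, EB), B; ℝ⟯) =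
        ∑ i, linFun (s i) ψ • (0, c i) := by
      ext1
      · simp [Prod.fst_sum]
      · simp [Prod.snd_sum, hg']
    have h4 : linFun X ψ = 0 := by rw [linFun, hX, map_zero]
    rw [h2, h3, map_add, map_sum, map_sum, fiberwiseAffineDiff_mulSection _ _ _ hχ.self_of_nhds,
      h4, zero_smul, zero_add]
    refine Finset.sum_congr rfl fun i _ => ?_
    rw [fiberwiseAffineDiff_mulSection _ _ _ (hc i), map_smul]
  have h5 : mvfderiv 𝓘(ℝ, EB) (g' + f : C^∞⟮𝓘(ℝ, EB), B; ℝ⟯) ψ.1 = 0 := by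
    refine mvfderiv_eq_zero_of_baseFun (G := G) (E := E) ?_
    have h6 : fiberwiseAffineDiff EB ψ (0, g' + f) = 0 := by
      rw [← hp, ← zero_add (0 : Sections (EB := EB) G E), ← Prod.mk_add_mk, map_add, ← h1,
        ← map_add, Prod.mk_add_mk, add_zero, zero_add]
    change mvfderiv _ (linFun (0 : Sections (EB := EB) G E)) ψ + mvfderiv _ (baseFun (g' + f)) ψ = 0
      at h6
    rwa [linFun_zero, mvfderiv_const, zero_add] at h6
  have hsum : ∀ t : Finset (Fin n), ∀ Z : Fin n → Sections (EB := EB) G E,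
      (∑ i ∈ t, Z i) ψ.1 = ∑ i ∈ t, Z i ψ.1 := fun t Z =>
    map_sum ((Pi.evalAddMonoidHom (fun x => E x) ψ.1).comp (ContMDiffSection.coeAddHom _ _ _ _)) Z t
  have h7 : linFun (L.bracket Y X) ψ = diffAt EB ψ.1 g' (L.anchor ψ.1 (Y ψ.1)) := by
    rw [linFun, hdec, map_add, map_sum, ContMDiffSection.coe_add, Pi.add_apply, hsum, L.leibniz,
      hX, smul_zero, add_zero, hχ.self_of_nhds, zero_smul, zero_add, map_sum, hg', map_sum, sum_apply]
    refine Finset.sum_congr rfl fun i _ => ?_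
    rw [L.leibniz, hc, zero_smul, zero_add, map_smul, map_smul, smul_apply, smul_eq_mul, smul_eq_mul,
      mul_comm]
    rfl
  have h8 : diffAt EB ψ.1 g' (L.anchor ψ.1 (Y ψ.1)) +
      diffAt EB ψ.1 f (L.anchor ψ.1 (Y ψ.1)) = 0 := by
    rw [← add_apply, ← map_add]
    exact DFunLike.congr_fun h5 _
  have h9 : linFun (L.bracket X Y) ψ = -linFun (L.bracket Y X) ψ := by
    rw [L.bracket_swap, linFun_neg]
  rw [L.form_apply, h9, h7, hX, map_zero, map_zero]
  change -_ + 0 - diffAt EB ψ.1 f (L.anchor ψ.1 (Y ψ.1)) = 0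
  linarith

variable (EB) in
/-- A choice of functions `ι_X + π^* f` with given differential. -/
def covectorLift (ψ : DualSpace G E) :
    (TangentSpace (𝓘(ℝ, EB).prod 𝓘(ℝ, G →L[ℝ] ℝ)) ψ →L[ℝ] ℝ) →ₗ[ℝ]
      (Sections (EB := EB) G E × C^∞⟮𝓘(ℝ, EB), B; ℝ⟯) :=
  ((fiberwiseAffineDiff EB ψ).exists_rightInverse_of_surjective
    (LinearMap.range_eq_top.2 (surjective_fiberwiseAffineDiff ψ))).choose

theorem fiberwiseAffineDiff_covectorLift (ψ : DualSpace G E)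
    (α : TangentSpace (𝓘(ℝ, EB).prod 𝓘(ℝ, G →L[ℝ] ℝ)) ψ →L[ℝ] ℝ) :
    fiberwiseAffineDiff EB ψ (covectorLift EB ψ α) = α :=
  LinearMap.congr_fun ((fiberwiseAffineDiff EB ψ).exists_rightInverse_of_surjective
    (LinearMap.range_eq_top.2 (surjective_fiberwiseAffineDiff ψ))).choose_spec α

/-- Two pairs with the same differential differ by an element of the kernel; `form_eq_zero` settles
the first slot and antisymmetry the second. -/
theorem LieAlgebroid.form_covectorLift (L : LieAlgebroid EB G E) (ψ : DualSpace G E)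
    (p q : Sections (EB := EB) G E × C^∞⟮𝓘(ℝ, EB), B; ℝ⟯) :
    L.form ψ (covectorLift EB ψ (fiberwiseAffineDiff EB ψ p))
      (covectorLift EB ψ (fiberwiseAffineDiff EB ψ q)) = L.form ψ p q := by
  have h : ∀ p q p' : Sections (EB := EB) G E × C^∞⟮𝓘(ℝ, EB), B; ℝ⟯,
      fiberwiseAffineDiff EB ψ p = fiberwiseAffineDiff EB ψ p' → L.form ψ p q = L.form ψ p' q := by
    intro p q p' hpp
    have := L.form_eq_zero (p := p - p') (by rw [map_sub, hpp, sub_self]) q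
    rwa [map_sub, LinearMap.sub_apply, sub_eq_zero] at this
  have hswap : ∀ p q, L.form ψ p q = -L.form ψ q p := by
    intro p q
    have := L.form_self ψ (p + q)
    simp only [map_add, LinearMap.add_apply, L.form_self, zero_add, add_zero] at this
    linarith
  rw [h _ _ p (fiberwiseAffineDiff_covectorLift _ _), hswap,
    h _ _ q (fiberwiseAffineDiff_covectorLift _ _), ← hswap]

/-- The linear Poisson structure on the dual of a Lie algebroid. -/
def LieAlgebroid.poisson (L : LieAlgebroid EB G E) :
    BivectorField (𝓘(ℝ, EB).prod 𝓘(ℝ, G →L[ℝ] ℝ)) (DualSpace G E) where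
  toFun ψ := (L.form ψ).compl₁₂ (covectorLift EB ψ) (covectorLift EB ψ)
  alternating ψ α := L.form_self ψ _
  smooth f g hf hg := by
    refine contMDiff_bilinear
      (P := fun ψ => (L.form ψ).compl₁₂ (covectorLift EB ψ) (covectorLift EB ψ))
      (fun p => contMDiff_fiberwiseAffine (EB := EB) (G := G) (E := E) p) (fun ψ => ?_)
      (fun p q => ?_) hf hg
    · simp only [mvfderiv_fiberwiseAffine]
      exact span_linFun_baseFun ψ
    · simp only [mvfderiv_fiberwiseAffine, LinearMap.compl₁₂_apply, L.form_covectorLift]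
      exact L.contMDiff_form p q

theorem LieAlgebroid.poisson_onFun (L : LieAlgebroid EB G E) (X Y : Sections (EB := EB) G E) :
    L.poisson.onFun (linFun X) (linFun Y) = linFun (L.bracket X Y) := by
  funext ψ
  have h0 : ∀ Z : Sections (EB := EB) G E,
      mvfderiv (𝓘(ℝ, EB).prod 𝓘(ℝ, G →L[ℝ] ℝ)) (linFun Z) ψ = fiberwiseAffineDiff EB ψ (Z, 0) := by
    intro Z
    change _ = mvfderiv _ (linFun Z) ψ + mvfderiv _ (fun _ => (0 : ℝ)) ψ
    rw [mvfderiv_const, add_zero]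
  have h1 : ∀ v : TangentSpace 𝓘(ℝ, EB) ψ.1,
      mvfderiv 𝓘(ℝ, EB) (0 : C^∞⟮𝓘(ℝ, EB), B; ℝ⟯) ψ.1 v = 0 := fun v => by
    change diffAt EB ψ.1 0 v = 0
    rw [map_zero]; rfl
  rw [BivectorField.onFun, h0, h0]
  refine (L.form_covectorLift ψ (X, 0) (Y, 0)).trans ?_
  rw [L.form_apply, h1, h1, add_zero, sub_zero]

end LinearPoisson

/-! ### The Jacobi structure defined by a section of a Lie algebroid -/

section LinearJacobi

variable {EB : Type*} [NormedAddCommGroup EB] [NormedSpace ℝ EB]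
  {B : Type*} [TopologicalSpace B] [ChartedSpace EB B]
  {G : Type*} [NormedAddCommGroup G] [NormedSpace ℝ G]
  {E : B → Type*} [∀ x, AddCommGroup (E x)] [∀ x, Module ℝ (E x)]
  [∀ x, TopologicalSpace (E x)] [TopologicalSpace (TotalSpace G E)] [FiberBundle G E]
  [VectorBundle ℝ G E]

theorem isLinearFunction_linFun (X : Sections (EB := EB) G E) :
    IsLinearFunction EB (G →L[ℝ] ℝ) (DualBundle E) (linFun X) :=
  ⟨contMDiff_linFun X, fun _ => ⟨fun _ _ => rfl, fun _ _ => rfl⟩⟩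

/-- Linear functions on the dual bundle are given by sections. -/
theorem exists_eq_linFun [FiniteDimensional ℝ G] [ContMDiffVectorBundle ∞ G E 𝓘(ℝ, EB)]
    {f : DualSpace G E → ℝ}
    (hf : IsLinearFunction EB (G →L[ℝ] ℝ) (DualBundle E) f) :
    ∃ X : Sections (EB := EB) G E, f = linFun X := by
  have h1 : ∀ x, ∃ w : E x, ∀ φ : E x →L[ℝ] ℝ, f ⟨x, φ⟩ = φ w := by
    intro x
    let e := (trivializationAt G E x).continuousLinearEquivAt ℝ x
      (mem_baseSet_trivializationAt G E x)
    obtain ⟨w, hw⟩ := exists_apply_eq (E := G)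
      { toFun := fun l => f ⟨x, l.comp (e : E x →L[ℝ] G)⟩
        map_add' := fun l l' =>
          (hf.2 x).map_add (l.comp (e : E x →L[ℝ] G)) (l'.comp (e : E x →L[ℝ] G))
        map_smul' := fun c l => (hf.2 x).map_smul c (l.comp (e : E x →L[ℝ] G)) }
    refine ⟨e.symm w, fun φ => ?_⟩
    have h2 := hw (φ.comp (e.symm : G →L[ℝ] E x))
    have h3 : (φ.comp (e.symm : G →L[ℝ] E x)).comp (e : E x →L[ℝ] G) = φ := by
      ext w; simp
    change f ⟨x, (φ.comp (e.symm : G →L[ℝ] E x)).comp (e : E x →L[ℝ] G)⟩ = _ at h2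
    rw [h3] at h2
    exact h2
  choose X hX using h1
  refine ⟨⟨X, fun x => (contMDiffAt_section x).2 (contMDiffAt_of_dual fun l => ?_)⟩,
    funext fun ψ => hX _ _⟩
  set e := trivializationAt G E x with he
  have hx := e.open_baseSet.mem_nhds (mem_baseSet_trivializationAt G E x)
  -- The component of `X` along `l` is `f` evaluated on the local section of the dual bundle that is
  -- constantly `l` in the trivialization, hence smooth.
  have h2 : ContMDiffAt 𝓘(ℝ, EB) (𝓘(ℝ, EB).prod 𝓘(ℝ, G →L[ℝ] ℝ)) ∞
      (fun y => (⟨y, l.comp (e.continuousLinearMapAt ℝ y)⟩ : DualSpace G E)) x := by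
    refine (contMDiffAt_section (E := DualBundle E) x).2 ?_
    refine (contMDiffAt_const (c := l)).congr_of_eventuallyEq ?_
    filter_upwards [hx] with y hy
    refine ContinuousLinearMap.ext fun w => ?_
    refine (trivializationAt_dual x _ w).trans ?_
    exact congrArg l (e.continuousLinearMapAt_symmL hy w)
  refine ((hf.1 _).comp x h2).congr_of_eventuallyEq ?_
  filter_upwards [hx] with y hy
  refine Eq.trans ?_ (hX y _).symm
  change l _ = l (e.continuousLinearMapAt ℝ y (X y))
  rw [e.continuousLinearMapAt_apply_of_mem ℝ hy]

variable [IsManifold 𝓘(ℝ, EB) ∞ B]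

theorem LieAlgebroid.jacobi_cyclic (L : LieAlgebroid EB G E) (X Y Z : Sections (EB := EB) G E) :
    L.bracket (L.bracket X Y) Z + L.bracket (L.bracket Y Z) X + L.bracket (L.bracket Z X) Y = 0 := by
  rw [L.bracket_swap (L.bracket Y Z), L.jacobi X Y Z, L.bracket_swap (L.bracket Z X),
    L.bracket_swap Z X, map_neg]
  abel

theorem LieAlgebroid.linFun_jacobi (L : LieAlgebroid EB G E) (X Y Z : Sections (EB := EB) G E)
    (ψ : DualSpace G E) : linFun (L.bracket (L.bracket X Y) Z) ψ +
      linFun (L.bracket (L.bracket Y Z) X) ψ + linFun (L.bracket (L.bracket Z X) Y) ψ = 0 := by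
  have h1 : linFun (L.bracket (L.bracket X Y) Z + L.bracket (L.bracket Y Z) X +
    L.bracket (L.bracket Z X) Y) ψ = 0 := by rw [L.jacobi_cyclic, linFun_zero]
  rwa [linFun_add, linFun_add] at h1

theorem LieAlgebroid.linFun_derivation (L : LieAlgebroid EB G E)
    (Z X Y : Sections (EB := EB) G E) (ψ : DualSpace G E) :
    linFun (L.bracket Z (L.bracket X Y)) ψ =
      linFun (L.bracket (L.bracket Z X) Y) ψ + linFun (L.bracket X (L.bracket Z Y)) ψ := by
  rw [L.jacobi Z X Y, linFun_add]

variable [ContMDiffVectorBundle ∞ G E 𝓘(ℝ, EB)] [FiniteDimensional ℝ EB] [T2Space B]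
  [FiniteDimensional ℝ G]

theorem LieAlgebroid.poisson_isInducedBy (L : LieAlgebroid EB G E) : L.IsInducedBy L.poisson :=
  L.poisson_onFun

theorem LieAlgebroid.poisson_isLinear (L : LieAlgebroid EB G E) : L.poisson.IsLinear := by
  intro f g hf hg
  obtain ⟨X, rfl⟩ := exists_eq_linFun hf
  obtain ⟨Y, rfl⟩ := exists_eq_linFun hg
  rw [L.poisson_onFun]
  exact isLinearFunction_linFun _

/-- This is the generator criterion with vector field `0` and derivation `0`. The nowhere vanishing
`Z` provides the dense set on which linear functions generate all covectors. -/
theorem LieAlgebroid.poisson_isPoisson (L : LieAlgebroid EB G E) {Z : Sections (EB := EB) G E}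
    (hZ : ∀ x, ∃ η : E x →L[ℝ] ℝ, η (Z x) ≠ 0) : L.poisson.IsPoisson := by
  intro f g h hf hg hh ψ
  have key := jacobi_equations_of_generators L.poisson 0 linFun (fun X Y => L.bracket X Y)
    (fun _ => (0 : Sections (EB := EB) G E)) contMDiff_linFun
    (fun X => by rw [linFun_zero]; exact funext fun _ => ContinuousLinearMap.map_zero _)
    (fun X Y => by rw [L.poisson_onFun]; funext ψ; rw [linFun_zero]; ring)
    (fun X Y ψ => by
      rw [map_zero, map_zero, LinearMap.zero_apply, linFun_zero, add_zero])
    L.linFun_jacobi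
    (dense_linFun_ne_zero hZ) (fun ψ hψ α => exists_mvfderiv_linFun_eq hψ α) hf hg hh ψ
  rw [key.1]
  have h0 : ∀ k : DualSpace G E → ℝ, along (0 : VectorField (𝓘(ℝ, EB).prod 𝓘(ℝ, G →L[ℝ] ℝ))
      (DualSpace G E)) k ψ = 0 := fun k => ContinuousLinearMap.map_zero _
  rw [wedge, h0, h0, h0]
  ring

/-- Where `ι_Z ≠ 0` every covector is some `dι_X`, so the bracket fixes the tensor. At the remaining
points the covectors are extended to global functions `ι_X + π^* f`, and continuity concludes. -/
theorem LieAlgebroid.IsInducedBy.eq_poisson {L : LieAlgebroid EB G E}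
    {Z : Sections (EB := EB) G E} (hZ : ∀ x, ∃ η : E x →L[ℝ] ℝ, η (Z x) ≠ 0)
    {P : BivectorField (𝓘(ℝ, EB).prod 𝓘(ℝ, G →L[ℝ] ℝ)) (DualSpace G E)}
    (hP : L.IsInducedBy P) : P = L.poisson := by
  ext ψ α β
  obtain ⟨p, rfl⟩ := surjective_fiberwiseAffineDiff ψ α
  obtain ⟨q, rfl⟩ := surjective_fiberwiseAffineDiff ψ β
  rw [← mvfderiv_fiberwiseAffine, ← mvfderiv_fiberwiseAffine]
  have hp := contMDiff_fiberwiseAffine (EB := EB) (G := G) (E := E) p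
  have hq := contMDiff_fiberwiseAffine (EB := EB) (G := G) (E := E) q
  have h := Continuous.ext_on (dense_linFun_ne_zero hZ) (P.contMDiff_onFun hp hq).continuous
    (L.poisson.contMDiff_onFun hp hq).continuous fun ξ hξ => by
      obtain ⟨X, hX⟩ := exists_mvfderiv_linFun_eq hξ (mvfderiv (𝓘(ℝ, EB).prod 𝓘(ℝ, G →L[ℝ] ℝ))
        (fun ψ : DualSpace G E => linFun p.1 ψ + baseFun p.2 ψ) ξ)
      obtain ⟨Y, hY⟩ := exists_mvfderiv_linFun_eq hξ (mvfderiv (𝓘(ℝ, EB).prod 𝓘(ℝ, G →L[ℝ] ℝ))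
        (fun ψ : DualSpace G E => linFun q.1 ψ + baseFun q.2 ψ) ξ)
      rw [BivectorField.onFun, BivectorField.onFun, ← hX, ← hY]
      exact congrFun ((hP X Y).trans (L.poisson_onFun X Y).symm) ξ
  exact congrFun h ψ

/-- The hamiltonian vector field of the linear function defined by a section. -/
def LieAlgebroid.hamiltonian (L : LieAlgebroid EB G E) (Z : Sections (EB := EB) G E) :
    VectorField (𝓘(ℝ, EB).prod 𝓘(ℝ, G →L[ℝ] ℝ)) (DualSpace G E) :=
  ⟨fun ψ => (exists_tangent_apply_eq (L.poisson ψ (mvfderiv _ (linFun Z) ψ))).choose, by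
    refine contMDiff_vectorField
      (fun p => contMDiff_fiberwiseAffine (EB := EB) (G := G) (E := E) p) (fun ψ => ?_) fun p => ?_
    · simp only [mvfderiv_fiberwiseAffine]
      exact span_linFun_baseFun ψ
    · refine (L.poisson.contMDiff_onFun (contMDiff_linFun Z) (contMDiff_fiberwiseAffine p)).congr
        fun ψ => ?_
      exact ((exists_tangent_apply_eq (L.poisson ψ (mvfderiv _ (linFun Z) ψ))).choose_spec _).symm⟩

theorem LieAlgebroid.isHamiltonian_hamiltonian (L : LieAlgebroid EB G E)
    (Z : Sections (EB := EB) G E) : L.poisson.IsHamiltonian (linFun Z) (L.hamiltonian Z) :=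
  fun ψ α => ((exists_tangent_apply_eq
    (L.poisson ψ (mvfderiv _ (linFun Z) ψ))).choose_spec α).symm

theorem LieAlgebroid.along_hamiltonian (L : LieAlgebroid EB G E)
    (Z X : Sections (EB := EB) G E) :
    along (L.hamiltonian Z) (linFun X) = linFun (L.bracket Z X) := by
  rw [← L.poisson_onFun]
  exact funext fun ψ => L.isHamiltonian_hamiltonian Z ψ _

/-- It suffices to test on `ι_X + π^* f`, which `Δ` sends to the smooth function `ι_X`. -/
theorem contMDiff_apply_liouville {k : DualSpace G E → ℝ}
    (hk : ContMDiff (𝓘(ℝ, EB).prod 𝓘(ℝ, G →L[ℝ] ℝ)) 𝓘(ℝ, ℝ) ∞ k) :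
    ContMDiff (𝓘(ℝ, EB).prod 𝓘(ℝ, G →L[ℝ] ℝ)) 𝓘(ℝ, ℝ) ∞
      fun ψ => mvfderiv (𝓘(ℝ, EB).prod 𝓘(ℝ, G →L[ℝ] ℝ)) k ψ (liouville EB ψ) := fun ψ => by
  refine contMDiffAt_apply_mvfderiv (T := fun y => evalTangent (liouville EB y))
    (fun p => contMDiff_fiberwiseAffine (EB := EB) (G := G) (E := E) p ψ) ?_ (fun p => ?_) (hk ψ)
  · simp only [mvfderiv_fiberwiseAffine]
    exact span_linFun_baseFun ψ
  · refine (contMDiff_linFun p.1 ψ).congr_of_eventuallyEq (Eventually.of_forall fun ξ => ?_)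
    beta_reduce
    rw [mvfderiv_fiberwiseAffine]
    change mvfderiv _ (linFun p.1) ξ _ + mvfderiv _ (baseFun p.2) ξ _ = _
    rw [mvfderiv_linFun_liouville, mvfderiv_baseFun_liouville, add_zero]

/-- The `2`-vector field `Λ - Δ ∧ E`, where `E` is the hamiltonian vector field of `ι_Z`. -/
def LieAlgebroid.jacobiBivector (L : LieAlgebroid EB G E) (Z : Sections (EB := EB) G E) :
    BivectorField (𝓘(ℝ, EB).prod 𝓘(ℝ, G →L[ℝ] ℝ)) (DualSpace G E) where
  toFun ψ := L.poisson ψ - wedgeForm (liouville EB ψ) (L.hamiltonian Z ψ)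
  alternating ψ α := by
    rw [LinearMap.sub_apply, LinearMap.sub_apply, L.poisson.alternating, wedgeForm_apply,
      wedgeAt]
    ring
  smooth f g hf hg := by
    have hE := contMDiff_along (L.hamiltonian Z) hf
    have hE' := contMDiff_along (L.hamiltonian Z) hg
    exact (L.poisson.contMDiff_onFun hf hg).sub (((contMDiff_apply_liouville hf).mul hE').sub
      (hE.mul (contMDiff_apply_liouville hg)))

theorem LieAlgebroid.jacobiBivector_apply (L : LieAlgebroid EB G E)
    (Z : Sections (EB := EB) G E) (ψ : DualSpace G E)
    (α β : TangentSpace (𝓘(ℝ, EB).prod 𝓘(ℝ, G →L[ℝ] ℝ)) ψ →L[ℝ] ℝ) :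
    L.jacobiBivector Z ψ α β =
      L.poisson ψ α β - wedgeAt (liouville EB ψ) (L.hamiltonian Z ψ) α β := rfl

/-- From `Δ(ι_X) = ι_X` and `E(ι_X) = ι_[Z,X]`. The result has the shape that
`jacobi_equations_of_generators` expects, with `[Z, ·]` as the derivation. -/
theorem LieAlgebroid.jacobiBivector_onFun (L : LieAlgebroid EB G E)
    (Z X Y : Sections (EB := EB) G E) :
    (L.jacobiBivector Z).onFun (linFun X) (linFun Y) = fun ψ => linFun (L.bracket X Y) ψ -
      linFun X ψ * linFun (L.bracket Z Y) ψ + linFun Y ψ * linFun (L.bracket Z X) ψ := by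
  funext ψ
  rw [BivectorField.onFun, L.jacobiBivector_apply, wedgeAt, mvfderiv_linFun_liouville,
    mvfderiv_linFun_liouville, ← L.poisson_onFun, ← L.along_hamiltonian, ← L.along_hamiltonian]
  simp only [along, BivectorField.onFun]
  ring

/-- The Jacobi structure `(Λ - Δ ∧ E, E)`. -/
def LieAlgebroid.jacobiStructure (L : LieAlgebroid EB G E) (Z : Sections (EB := EB) G E)
    (hZ : ∀ x, ∃ η : E x →L[ℝ] ℝ, η (Z x) ≠ 0) :
    JacobiStructure (𝓘(ℝ, EB).prod 𝓘(ℝ, G →L[ℝ] ℝ)) (DualSpace G E) :=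
  -- The derivation rule for `[Z, ·]` and the cyclic identity required of the generators are both
  -- forms of the Jacobi identity of `L`.
  have key := fun (f g h : DualSpace G E → ℝ)
      (hf : ContMDiff (𝓘(ℝ, EB).prod 𝓘(ℝ, G →L[ℝ] ℝ)) 𝓘(ℝ, ℝ) ∞ f)
      (hg : ContMDiff (𝓘(ℝ, EB).prod 𝓘(ℝ, G →L[ℝ] ℝ)) 𝓘(ℝ, ℝ) ∞ g)
      (hh : ContMDiff (𝓘(ℝ, EB).prod 𝓘(ℝ, G →L[ℝ] ℝ)) 𝓘(ℝ, ℝ) ∞ h) =>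
    jacobi_equations_of_generators (L.jacobiBivector Z) (L.hamiltonian Z) linFun
      (fun X Y => L.bracket X Y) (fun X => L.bracket Z X) contMDiff_linFun
      (fun X => L.along_hamiltonian Z X) (fun X Y => L.jacobiBivector_onFun Z X Y)
      (L.linFun_derivation Z)
      L.linFun_jacobi
      (dense_linFun_ne_zero hZ) (fun _ hψ α => exists_mvfderiv_linFun_eq hψ α) hf hg hh
  { biv := L.jacobiBivector Z
    vec := L.hamiltonian Z
    schouten_biv_biv := fun f g h hf hg hh ψ => (key f g h hf hg hh ψ).1
    schouten_vec_biv := fun f g hf hg ψ => (key f g f hf hg hf ψ).2 }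

end LinearJacobi

/-! ### Restriction of Jacobi structures to immersed submanifolds -/

section Restriction

variable {E : Type*} [NormedAddCommGroup E] [NormedSpace ℝ E]
  {H : Type*} [TopologicalSpace H] {I : ModelWithCorners ℝ E H}
  {N : Type*} [TopologicalSpace N] [ChartedSpace H N]
  {E' : Type*} [NormedAddCommGroup E'] [NormedSpace ℝ E']
  {H' : Type*} [TopologicalSpace H'] {I' : ModelWithCorners ℝ E' H'}
  {N' : Type*} [TopologicalSpace N'] [ChartedSpace H' N']

variable (I I') in
/-- The pull-back of covectors. -/
def covectorPullback (j : N → N') (x : N) :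
    (TangentSpace I' (j x) →L[ℝ] ℝ) →ₗ[ℝ] (TangentSpace I x →L[ℝ] ℝ) where
  toFun α := α ∘L mfderiv I I' j x
  map_add' _ _ := rfl
  map_smul' _ _ := rfl

theorem mvfderiv_comp_eq_pullback {j : N → N'} (hj : ContMDiff I I' ∞ j) {f : N' → ℝ}
    (hf : ContMDiff I' 𝓘(ℝ, ℝ) ∞ f) (x : N) :
    mvfderiv I (fun y => f (j y)) x = covectorPullback I I' j x (mvfderiv I' f (j x)) :=
  ContinuousLinearMap.ext fun v => mvfderiv_comp_apply' ((hf _).mdifferentiableAt (by simp))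
    ((hj _).mdifferentiableAt (by simp)) v

section

variable [FiniteDimensional ℝ E']

theorem surjective_covectorPullback {j : N → N'} {x : N}
    (h : Function.Injective (mfderiv I I' j x)) :
    Function.Surjective (covectorPullback I I' j x) := by
  intro β
  obtain ⟨g, hg⟩ := LinearMap.exists_leftInverse_of_injective
    (mfderiv I I' j x : TangentSpace I x →ₗ[ℝ] TangentSpace I' (j x)) (LinearMap.ker_eq_bot.2 h)
  let g' : E' →L[ℝ] E := LinearMap.toContinuousLinearMap g
  refine ⟨ContinuousLinearMap.comp (show E →L[ℝ] ℝ from β) g', ContinuousLinearMap.ext fun v => ?_⟩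
  exact congrArg β (LinearMap.congr_fun hg v)

end

variable [IsManifold I ∞ N]

section

variable [IsManifold I' ∞ N']

theorem JacobiStructure.IsRestriction.bracket_comp {J : JacobiStructure I N}
    {J' : JacobiStructure I' N'} {j : N → N'} (h : J.IsRestriction j J') (hj : ContMDiff I I' ∞ j)
    {f g : N' → ℝ} (hf : ContMDiff I' 𝓘(ℝ, ℝ) ∞ f) (hg : ContMDiff I' 𝓘(ℝ, ℝ) ∞ g) (x : N) :
    J.bracket (fun y => f (j y)) (fun y => g (j y)) x = J'.bracket f g (j x) := by
  have h1 : ∀ {k : N' → ℝ}, ContMDiff I' 𝓘(ℝ, ℝ) ∞ k →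
      along J.vec (fun y => k (j y)) x = along J'.vec k (j x) := by
    intro k hk
    rw [along, mvfderiv_comp_eq_pullback hj hk, along, (h x).2]
    rfl
  rw [JacobiStructure.bracket, JacobiStructure.bracket, h1 hf, h1 hg, BivectorField.onFun,
    BivectorField.onFun, mvfderiv_comp_eq_pullback hj hf, mvfderiv_comp_eq_pullback hj hg, (h x).1]
  rfl

end

variable [FiniteDimensional ℝ E]

/-- A Jacobi structure is determined by the brackets of functions whose differentials exhaust the
cotangent spaces. -/
theorem JacobiStructure.ext_of_bracket {J J' : JacobiStructure I N} {s : Set (N → ℝ)}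
    (h1 : (fun _ => 1) ∈ s) (hs : ∀ x α, ∃ f ∈ s, mvfderiv I f x = α)
    (h : ∀ f ∈ s, ∀ g ∈ s, J.bracket f g = J'.bracket f g) : J = J' := by
  -- Bracketing with the constant `1` isolates the vector field; once that is known, the remaining
  -- brackets give the bivector.
  have hv : ∀ (K : JacobiStructure I N) (f : N → ℝ) (x : N),
      K.bracket (fun _ => 1) f x = mvfderiv I f x (K.vec x) := by
    intro K f x
    rw [JacobiStructure.bracket, BivectorField.onFun, along, along, mvfderiv_const, map_zero,
      LinearMap.zero_apply, zero_apply]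
    ring
  have hvec : ∀ x, J.vec x = J'.vec x := fun x => ext_of_covectors fun α => by
    obtain ⟨f, hf, rfl⟩ := hs x α
    rw [← hv, ← hv, h _ h1 f hf]
  refine JacobiStructure.ext (BivectorField.ext (funext fun x => ?_)) (ContMDiffSection.ext hvec)
  refine LinearMap.ext fun α => LinearMap.ext fun β => ?_
  obtain ⟨f, hf, rfl⟩ := hs x α
  obtain ⟨g, hg, rfl⟩ := hs x β
  have h2 := congrFun (h f hf g hg) x
  simp only [JacobiStructure.bracket, along, hvec, BivectorField.onFun] at h2
  linarith

variable [I.Boundaryless] [FiniteDimensional ℝ E'] [IsManifold I' ∞ N']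

/-- If the tensors of a Jacobi structure are tangent to an immersed submanifold, then they restrict
to a Jacobi structure on it. -/
theorem JacobiStructure.exists_restriction (J' : JacobiStructure I' N') {j : N → N'}
    (hj : ContMDiff I I' ∞ j) (hinj : ∀ x, Function.Injective (mfderiv I I' j x))
    (hker : ∀ x α, covectorPullback I I' j x α = 0 →
      (∀ β, J'.biv (j x) α β = 0) ∧ α (J'.vec (j x)) = 0)
    {𝔤 : Type*} (Φ : 𝔤 → N' → ℝ) (br : 𝔤 → 𝔤 → 𝔤) (D : 𝔤 → 𝔤)
    (hΦ : ∀ a, ContMDiff I' 𝓘(ℝ, ℝ) ∞ (Φ a))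
    (hX : ∀ a, along J'.vec (Φ a) = Φ (D a))
    (hP : ∀ a b, J'.biv.onFun (Φ a) (Φ b) =
      fun x => Φ (br a b) x - Φ a x * Φ (D b) x + Φ b x * Φ (D a) x)
    (hD : ∀ a b x, Φ (D (br a b)) x = Φ (br (D a) b) x + Φ (br a (D b)) x)
    (hJ : ∀ a b c x, Φ (br (br a b) c) x + Φ (br (br b c) a) x + Φ (br (br c a) b) x = 0)
    (hΦs : ∀ x α, ∃ a, mvfderiv I' (Φ a) (j x) = α) :
    ∃ J : JacobiStructure I N, J.IsRestriction j J' := by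
  -- Covectors of `N` are lifted to `N'` by an arbitrary linear right inverse of the pull-back. By
  -- `hker` the values of the tensors do not depend on the lift, so no smoothness in `x` is asked of
  -- `r`; the smoothness of the restricted tensors is tested on the functions `Φ a ∘ j`.
  choose r hr using fun x => (covectorPullback I I' j x).exists_rightInverse_of_surjective
    (LinearMap.range_eq_top.2 (surjective_covectorPullback (hinj x)))
  have hr' : ∀ x α, covectorPullback I I' j x (r x (covectorPullback I I' j x α) - α) = 0 := by
    intro x α
    rw [map_sub, sub_eq_zero]
    exact LinearMap.congr_fun (hr x) _
  choose v hv using fun x => exists_tangent_apply_eq (evalTangent (J'.vec (j x)) ∘ₗ r x)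
  have hv' : ∀ x α, covectorPullback I I' j x α (v x) = α (J'.vec (j x)) := by
    intro x α
    rw [← hv]
    have h := (hker x _ (hr' x α)).2
    exact sub_eq_zero.1 h
  have hb : ∀ x α β, J'.biv (j x) (r x (covectorPullback I I' j x α))
      (r x (covectorPullback I I' j x β)) = J'.biv (j x) α β := by
    intro x α β
    have h1 := (hker x _ (hr' x α)).1 (r x (covectorPullback I I' j x β))
    have h2 := (hker x _ (hr' x β)).1 α
    rw [map_sub, LinearMap.sub_apply, sub_eq_zero] at h1 h2
    rw [h1, J'.biv.apply_swap, h2, ← J'.biv.apply_swap]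
  have hΦj : ∀ a, ContMDiff I 𝓘(ℝ, ℝ) ∞ fun y => Φ a (j y) := fun a => (hΦ a).comp hj
  have hex : ∀ x α, ∃ a, mvfderiv I (fun y => Φ a (j y)) x = α := by
    intro x α
    obtain ⟨β, rfl⟩ := surjective_covectorPullback (hinj x) α
    obtain ⟨a, rfl⟩ := hΦs x β
    exact ⟨a, mvfderiv_comp_eq_pullback hj (hΦ a) x⟩
  have hspan : ∀ x, Submodule.span ℝ (range fun a => mvfderiv I (fun y => Φ a (j y)) x) = ⊤ := by
    intro x
    rw [eq_top_iff]
    rintro α -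
    obtain ⟨a, rfl⟩ := hex x α
    exact Submodule.subset_span ⟨a, rfl⟩
  let X : VectorField I N := ⟨v, by
    refine contMDiff_vectorField hΦj hspan fun a => ?_
    simp only [mvfderiv_comp_eq_pullback hj (hΦ a), hv']
    exact (contMDiff_along J'.vec (hΦ a)).comp hj⟩
  let P : BivectorField I N :=
    { toFun := fun x => (J'.biv (j x)).compl₁₂ (r x) (r x)
      alternating := fun x α => J'.biv.alternating _ _
      smooth := fun f g hf hg => by
        refine contMDiff_bilinear (P := fun x => (J'.biv (j x)).compl₁₂ (r x) (r x)) hΦj hspan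
          (fun a b => ?_) hf hg
        simp only [mvfderiv_comp_eq_pullback hj (hΦ _), LinearMap.compl₁₂_apply, hb]
        exact (J'.biv.contMDiff_onFun (hΦ a) (hΦ b)).comp hj }
  -- The functions `Φ a ∘ j` obey the same algebraic identities, and their differentials exhaust the
  -- cotangent space at every point of `N`.
  have key := fun (f g h : N → ℝ) (hf : ContMDiff I 𝓘(ℝ, ℝ) ∞ f)
      (hg : ContMDiff I 𝓘(ℝ, ℝ) ∞ g) (hh : ContMDiff I 𝓘(ℝ, ℝ) ∞ h) =>
    jacobi_equations_of_generators P X (fun a y => Φ a (j y)) br D hΦj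
      (fun a => funext fun x => by
        rw [along, mvfderiv_comp_eq_pullback hj (hΦ a)]
        exact (hv' x _).trans (congrFun (hX a) (j x)))
      (fun a b => funext fun x => by
        rw [BivectorField.onFun, mvfderiv_comp_eq_pullback hj (hΦ a),
          mvfderiv_comp_eq_pullback hj (hΦ b)]
        exact (hb x _ _).trans (congrFun (hP a b) (j x)))
      (fun a b x => hD a b (j x)) (fun a b c x => hJ a b c (j x)) dense_univ
      (fun x _ α => hex x α) hf hg hh
  refine ⟨⟨P, X, fun f g h hf hg hh x => (key f g h hf hg hh x).1,
    fun f g hf hg x => (key f g f hf hg hf x).2⟩, fun x => ⟨fun α β => (hb x α β).symm, ?_⟩⟩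
  exact ext_of_covectors fun α => (hv' x α).symm

end Restriction

/-! ### The inclusion of an affine bundle in its vector hull -/

section VectorHull

/-- The range of `T` lies in the kernel of `ζ` and has the same dimension, so `α` vanishes on that
kernel; the factor is `α u`. -/
theorem exists_eq_smul_of_comp_eq_zero {W W' : Type*} [NormedAddCommGroup W] [NormedSpace ℝ W]
    [NormedAddCommGroup W'] [NormedSpace ℝ W'] [FiniteDimensional ℝ W] [FiniteDimensional ℝ W']
    {T : W →L[ℝ] W'} {ζ α : W' →L[ℝ] ℝ} {u : W'}
    (hd : Module.finrank ℝ W' = Module.finrank ℝ W + 1) (hT : Function.Injective T)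
    (hζ : ζ ∘L T = 0) (hu : ζ u = 1) (hα : α ∘L T = 0) : ∃ c : ℝ, α = c • ζ := by
  have hker : LinearMap.range T.toLinearMap = LinearMap.ker ζ.toLinearMap := by
    refine Submodule.eq_of_le_of_finrank_eq ?_ ?_
    · rintro _ ⟨v, rfl⟩
      exact DFunLike.congr_fun hζ v
    have h2 := LinearMap.finrank_range_of_inj (f := T.toLinearMap) hT
    have h3 := LinearMap.finrank_range_add_finrank_ker ζ.toLinearMap
    have h4 : LinearMap.range ζ.toLinearMap = ⊤ := LinearMap.range_eq_top.2 fun c => ⟨c • u, by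
      simp [hu]⟩
    rw [h4, finrank_top, Module.finrank_self] at h3
    omega
  refine ⟨α u, ContinuousLinearMap.ext fun v => ?_⟩
  have h5 : v - ζ v • u ∈ LinearMap.ker ζ.toLinearMap := by simp [hu]
  rw [← hker] at h5
  obtain ⟨w, hw⟩ := h5
  have h6 : α (v - ζ v • u) = 0 := (congrArg α hw).symm.trans (DFunLike.congr_fun hα w)
  rw [map_sub, map_smul, sub_eq_zero] at h6
  rw [h6, smul_apply, smul_eq_mul, smul_eq_mul, mul_comm]

theorem finrank_prod_eq (W W' : Type*) [NormedAddCommGroup W] [NormedSpace ℝ W]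
    [NormedAddCommGroup W'] [NormedSpace ℝ W'] [FiniteDimensional ℝ W] [FiniteDimensional ℝ W'] :
    Module.finrank ℝ (W × W') = Module.finrank ℝ W + Module.finrank ℝ W' :=
  Module.finrank_prod

theorem finrank_dual_affModel {F : Type*} [NormedAddCommGroup F] [NormedSpace ℝ F]
    [FiniteDimensional ℝ F] :
    Module.finrank ℝ (AffModel F →L[ℝ] ℝ) = Module.finrank ℝ F + 1 := by
  have h : ∀ (W : Type _) [NormedAddCommGroup W] [NormedSpace ℝ W] [FiniteDimensional ℝ W],
      Module.finrank ℝ (W →L[ℝ] ℝ) = Module.finrank ℝ W := fun W _ _ _ =>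
    (LinearMap.toContinuousLinearMap : (W →ₗ[ℝ] ℝ) ≃ₗ[ℝ] _).finrank_eq.symm.trans
      (Subspace.dual_finrank_eq (K := ℝ) (V := W))
  rw [h, Module.finrank_prod, h, Module.finrank_self, add_comm]

variable {EB : Type*} [NormedAddCommGroup EB] [NormedSpace ℝ EB]
  {B : Type*} [TopologicalSpace B] [ChartedSpace EB B]
  {F : Type*} [NormedAddCommGroup F] [NormedSpace ℝ F] [FiniteDimensional ℝ F]
  {V : B → Type*} [∀ x, AddCommGroup (V x)] [∀ x, Module ℝ (V x)]
  {A : B → Type*} [∀ x, AddTorsor (V x) (A x)]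
  [TopologicalSpace (TotalSpace F A)] [∀ x, TopologicalSpace (A x)] [FiberBundle F A]
  [AffineBundle F V A]

theorem linFun_oneSection_hullIncl (p : TotalSpace F A) :
    linFun (oneSection EB F V A) (hullIncl F V A p) = 1 :=
  toSection_apply (isAffineFunction_one EB F V A) p.1 p.2

theorem exists_oneSection_ne_zero (x : B) :
    ∃ η : AffDual F V A x →L[ℝ] ℝ, η (oneSection EB F V A x) ≠ 0 := by
  obtain ⟨q⟩ := (inferInstance : Nonempty (A x))
  exact ⟨evalAt q, (linFun_oneSection_hullIncl (EB := EB) (V := V) ⟨x, q⟩).trans_ne one_ne_zero⟩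

/-- In fibre coordinates the inclusion sends `y` to the functional `(c, l) ↦ c + l y`. Its
smoothness and injective differential are read off from this formula. -/
theorem trivializationAt_hullIncl {x : B} {p : TotalSpace F A}
    (hp : p.1 ∈ (trivializationAt F A x).baseSet) (w : AffModel F) :
    (trivializationAt (AffModel F →L[ℝ] ℝ) (DualBundle (AffDual F V A)) x
      (hullIncl F V A p)).2 w = w.1 + w.2 (trivializationAt F A x p).2 := by
  rw [trivializationAt_dual]
  have h1 : (trivializationAt (AffModel F) (AffDual F V A) x).symmL ℝ p.1 w =
      (coordEquiv V (trivializationAt F A x) hp).symm w :=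
    ((trivializationAt (AffModel F) (AffDual F V A) x).symmL_apply (R := ℝ) (b := p.1) hp w).trans
      (affDualTriv_symm (trivializationAt F A x) hp w)
  exact (congrArg (fun φ : AffDual F V A p.1 => φ p.2) h1).trans
    (coordEquiv_symm_apply (trivializationAt F A x) hp w p.2)

variable (EB F V A) in
theorem contMDiff_hullIncl : ContMDiff (𝓘(ℝ, EB).prod 𝓘(ℝ, F))
    (𝓘(ℝ, EB).prod 𝓘(ℝ, AffModel F →L[ℝ] ℝ)) ∞ (hullIncl F V A) := by
  intro p
  rw [contMDiffAt_totalSpace]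
  refine ⟨contMDiff_proj A p, contMDiffAt_of_dual fun l => ?_⟩
  have hid : ContMDiffAt (𝓘(ℝ, EB).prod 𝓘(ℝ, F)) (𝓘(ℝ, EB).prod 𝓘(ℝ, F)) ∞
    (fun q : TotalSpace F A => q) p := contMDiffAt_id
  have h1 := (contMDiffAt_totalSpace.1 hid).2
  have h2 : ContDiff ℝ ∞ fun y : F => l (ContinuousLinearMap.fst ℝ ℝ (F →L[ℝ] ℝ) +
      (ContinuousLinearMap.apply ℝ ℝ y).comp (ContinuousLinearMap.snd ℝ ℝ (F →L[ℝ] ℝ))) := by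
    fun_prop
  refine (h2.contMDiff.contMDiffAt.comp p h1).congr_of_eventuallyEq ?_
  have hb := (FiberBundle.continuous_proj F A).continuousAt.preimage_mem_nhds
    ((trivializationAt F A p.1).open_baseSet.mem_nhds (mem_baseSet_trivializationAt F A p.1))
  filter_upwards [hb] with q hq
  exact congrArg l (ContinuousLinearMap.ext fun w => trivializationAt_hullIncl hq w)

variable [SmoothTransitions EB F A] [IsManifold 𝓘(ℝ, EB) ∞ B]

set_option synthInstance.maxHeartbeats 100000 in
variable (EB V) in
-- The inclusion covers the identity of the base, so a vector in the kernel has zero projection.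
-- Evaluating the hull coordinates at `(0, η)` recovers `η` of the fibre coordinate, so its fibre
-- component vanishes too.
theorem injective_mfderiv_hullIncl (p : TotalSpace F A) :
    Function.Injective (mfderiv (𝓘(ℝ, EB).prod 𝓘(ℝ, F))
      (𝓘(ℝ, EB).prod 𝓘(ℝ, AffModel F →L[ℝ] ℝ)) (hullIncl F V A) p) := by
  have hsub : ∀ f : EB × F →L[ℝ] EB × (AffModel F →L[ℝ] ℝ), (∀ v, f v = 0 → v = 0) →
      Function.Injective f := fun f => (injective_iff_map_eq_zero f).2
  refine hsub _ fun v hv => ?_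
  have hd := (contMDiff_hullIncl EB F V A p).mdifferentiableAt (by simp)
  have hv' : ∀ f : TangentSpace (𝓘(ℝ, EB).prod 𝓘(ℝ, AffModel F →L[ℝ] ℝ)) (hullIncl F V A p) →L[ℝ] ℝ,
      f (mfderiv (𝓘(ℝ, EB).prod 𝓘(ℝ, F)) (𝓘(ℝ, EB).prod 𝓘(ℝ, AffModel F →L[ℝ] ℝ))
        (hullIncl F V A) p v) = 0 := fun f => (congrArg f hv).trans f.map_zero
  refine tangent_totalSpace_eq_zero (F := F) (A := A) (p := p) ?_ ?_
  · have h1 := mfderiv_comp (I'' := 𝓘(ℝ, EB)) p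
      (g := fun m : Hull F V A => m.1) (f := hullIncl F V A)
      ((contMDiff_proj (DualBundle (AffDual F V A)) _).mdifferentiableAt (n := ∞) (by simp)) hd
    refine (DFunLike.congr_fun h1 v).trans ?_
    exact (congrArg _ hv).trans (ContinuousLinearMap.map_zero _)
  · have hid : ContMDiffAt (𝓘(ℝ, EB).prod 𝓘(ℝ, F)) (𝓘(ℝ, EB).prod 𝓘(ℝ, F)) ∞
      (fun q : TotalSpace F A => q) p := contMDiffAt_id
    have hid' : ContMDiffAt (𝓘(ℝ, EB).prod 𝓘(ℝ, AffModel F →L[ℝ] ℝ))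
      (𝓘(ℝ, EB).prod 𝓘(ℝ, AffModel F →L[ℝ] ℝ)) ∞
      (fun q : Hull F V A => q) (hullIncl F V A p) := contMDiffAt_id
    have h1 := (contMDiffAt_totalSpace.1 hid).2.mdifferentiableAt (by simp)
    have h2 := (contMDiffAt_totalSpace.1 hid').2
    have hb := (FiberBundle.continuous_proj F A).continuousAt.preimage_mem_nhds
      ((trivializationAt F A p.1).open_baseSet.mem_nhds (mem_baseSet_trivializationAt F A p.1))
    refine (Module.forall_dual_apply_eq_zero_iff ℝ (V := F) _).1 fun φ => ?_
    set η : F →L[ℝ] ℝ := LinearMap.toContinuousLinearMap φ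
    let ev : (AffModel F →L[ℝ] ℝ) →L[ℝ] ℝ := ContinuousLinearMap.apply ℝ ℝ ((0, η) : AffModel F)
    have h3 := mvfderiv_comp_fderiv (g := η) η.differentiableAt h1 v
    rw [η.fderiv] at h3
    refine h3.symm.trans ?_
    have h4 : (fun q : TotalSpace F A => η (trivializationAt F A p.1 q).2) =ᶠ[𝓝 p] fun q =>
        ev (trivializationAt (AffModel F →L[ℝ] ℝ) (DualBundle (AffDual F V A)) p.1
          (hullIncl F V A q)).2 := by
      filter_upwards [hb] with q hq
      have h5 := trivializationAt_hullIncl (V := V) hq (0, η)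
      rw [zero_add] at h5
      exact h5.symm
    rw [mvfderiv_congr h4]
    have h6 := mvfderiv_comp_apply' (f := hullIncl F V A) (x := p) (g := fun m => ev
      (trivializationAt (AffModel F →L[ℝ] ℝ) (DualBundle (AffDual F V A)) p.1 m).2)
      ((ev.contDiff.contMDiff.contMDiffAt.comp _ h2).mdifferentiableAt (n := ∞) (by simp)) hd v
    rw [h6]
    exact hv' _

variable [FiniteDimensional ℝ EB]

set_option synthInstance.maxHeartbeats 100000 in
/-- The tangent spaces of `A` are the kernels of the differential of `ι_1`. -/
theorem exists_smul_of_covectorPullback_eq_zero {p : TotalSpace F A}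
    {α : TangentSpace (𝓘(ℝ, EB).prod 𝓘(ℝ, AffModel F →L[ℝ] ℝ)) (hullIncl F V A p) →L[ℝ] ℝ}
    (hα : covectorPullback (𝓘(ℝ, EB).prod 𝓘(ℝ, F)) (𝓘(ℝ, EB).prod 𝓘(ℝ, AffModel F →L[ℝ] ℝ))
      (hullIncl F V A) p α = 0) :
    ∃ c : ℝ, α = c • mvfderiv (𝓘(ℝ, EB).prod 𝓘(ℝ, AffModel F →L[ℝ] ℝ))
      (linFun (oneSection EB F V A)) (hullIncl F V A p) := by
  have h0 : covectorPullback (𝓘(ℝ, EB).prod 𝓘(ℝ, F)) (𝓘(ℝ, EB).prod 𝓘(ℝ, AffModel F →L[ℝ] ℝ))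
      (hullIncl F V A) p (mvfderiv (𝓘(ℝ, EB).prod 𝓘(ℝ, AffModel F →L[ℝ] ℝ))
        (linFun (oneSection EB F V A)) (hullIncl F V A p)) = 0 := by
    rw [← mvfderiv_comp_eq_pullback (contMDiff_hullIncl EB F V A) (contMDiff_linFun _)]
    simp only [linFun_oneSection_hullIncl]
    exact mvfderiv_const _
  -- The hull has one dimension more than `A`, and the transversal vector `u` is the Liouville
  -- vector: `dι_1(Δ) = ι_1 = 1` on `A`.
  exact exists_eq_smul_of_comp_eq_zero (W := EB × F) (W' := EB × (AffModel F →L[ℝ] ℝ))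
    ((finrank_prod_eq _ _).trans (by rw [Module.finrank_prod, finrank_dual_affModel, add_assoc]))
    (injective_mfderiv_hullIncl EB V p) h0
    ((mvfderiv_linFun_liouville _ _).trans (linFun_oneSection_hullIncl p)) hα

end VectorHull

/-! ### Affine Jacobi structures -/

section AffineJacobiStructures

variable {EB : Type*} [NormedAddCommGroup EB] [NormedSpace ℝ EB]
  {B : Type*} [TopologicalSpace B] [ChartedSpace EB B]
  {F : Type*} [NormedAddCommGroup F] [NormedSpace ℝ F] [FiniteDimensional ℝ F]
  {V : B → Type*} [∀ x, AddCommGroup (V x)] [∀ x, Module ℝ (V x)]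
  {A : B → Type*} [∀ x, AddTorsor (V x) (A x)]
  [TopologicalSpace (TotalSpace F A)] [∀ x, TopologicalSpace (A x)] [FiberBundle F A]
  [AffineBundle F V A]

theorem isAffineFunction_linFun_hullIncl (X : Sections (EB := EB) (AffModel F) (AffDual F V A)) :
    IsAffineFunction EB V fun p => linFun X (hullIncl F V A p) :=
  ⟨(contMDiff_linFun X).comp (contMDiff_hullIncl EB F V A), fun x => ⟨X x, fun _ => rfl⟩⟩

theorem linFun_toSection_hullIncl {a : TotalSpace F A → ℝ} (ha : IsAffineFunction EB V a) :
    (fun p => linFun (toSection ha) (hullIncl F V A p)) = a :=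
  funext fun p => toSection_apply ha p.1 p.2

theorem toSection_eq {a : TotalSpace F A → ℝ} (ha : IsAffineFunction EB V a)
    {X : Sections (EB := EB) (AffModel F) (AffDual F V A)}
    (h : a = fun p => linFun X (hullIncl F V A p)) : toSection ha = X := by
  refine ContMDiffSection.ext fun x => DFunLike.coe_injective (funext fun q => ?_)
  rw [toSection_apply, h]
  rfl

variable [SmoothTransitions EB F A] [IsManifold 𝓘(ℝ, EB) ∞ B] [FiniteDimensional ℝ EB] [T2Space B]

/-- Affine functions are restrictions of linear ones. Since `ι_1 = 1` on `A`, their differentials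
exhaust the cotangent spaces of `A`, so `ext_of_bracket` applies. -/
theorem JacobiStructure.eq_of_matches {L : LieAlgebroid EB (AffModel F) (AffDual F V A)}
    {J J' : JacobiStructure (𝓘(ℝ, EB).prod 𝓘(ℝ, F)) (TotalSpace F A)}
    (hJ : J.Matches L) (hJ' : J'.Matches L) : J = J' := by
  refine JacobiStructure.ext_of_bracket (s := {a | IsAffineFunction EB V a})
    (isAffineFunction_one EB F V A) (fun p α => ?_) fun a ha b hb => ?_
  · obtain ⟨β, rfl⟩ := surjective_covectorPullback (injective_mfderiv_hullIncl EB V p) α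
    obtain ⟨X, rfl⟩ := exists_mvfderiv_linFun_eq (Z := oneSection EB F V A)
      ((linFun_oneSection_hullIncl p).trans_ne one_ne_zero) β
    exact ⟨_, isAffineFunction_linFun_hullIncl X,
      mvfderiv_comp_eq_pullback (contMDiff_hullIncl EB F V A) (contMDiff_linFun X) p⟩
  · obtain ⟨h1, h2⟩ := hJ a b ha hb
    obtain ⟨h3, h4⟩ := hJ' a b ha hb
    rw [← linFun_toSection_hullIncl h1, ← linFun_toSection_hullIncl h3, h2, h4]

/-- The contribution of `-Δ ∧ E` is `-ι_X E(ι_Y) + ι_Y E(ι_X)`, exactly opposite to the terms that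
the Jacobi bracket adds to the bivector. -/
theorem LieAlgebroid.jacobiStructure_bracket (L : LieAlgebroid EB (AffModel F) (AffDual F V A))
    (X Y : Sections (EB := EB) (AffModel F) (AffDual F V A)) :
    (L.jacobiStructure (oneSection EB F V A) exists_oneSection_ne_zero).bracket
      (linFun X) (linFun Y) = linFun (L.bracket X Y) := by
  funext ψ
  have h1 := congrFun (L.jacobiBivector_onFun (oneSection EB F V A) X Y) ψ
  have h2 := fun X => congrFun (L.along_hamiltonian (oneSection EB F V A) X) ψ
  change (L.jacobiBivector _).onFun _ _ ψ + linFun X ψ * along (L.hamiltonian _) (linFun Y) ψ -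
    linFun Y ψ * along (L.hamiltonian _) (linFun X) ψ = _
  rw [h1, h2, h2]
  ring

/-- The Jacobi structure on the vector hull is tangent to the affine bundle. -/
theorem LieAlgebroid.exists_restriction (L : LieAlgebroid EB (AffModel F) (AffDual F V A)) :
    ∃ J : JacobiStructure (𝓘(ℝ, EB).prod 𝓘(ℝ, F)) (TotalSpace F A), J.IsRestriction
      (hullIncl F V A) (L.jacobiStructure (oneSection EB F V A) exists_oneSection_ne_zero) := by
  refine JacobiStructure.exists_restriction _ (contMDiff_hullIncl EB F V A)
    (injective_mfderiv_hullIncl EB V) (fun p α hα => ?_) linFun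
    (fun X Y => L.bracket X Y) (fun X => L.bracket (oneSection EB F V A) X) contMDiff_linFun
    (fun X => L.along_hamiltonian _ X) (fun X Y => L.jacobiBivector_onFun _ X Y)
    (L.linFun_derivation _) L.linFun_jacobi
    (fun p α => exists_mvfderiv_linFun_eq
      ((linFun_oneSection_hullIncl (EB := EB) (V := V) p).trans_ne one_ne_zero) α)
  -- Only multiples of `dι_1` need checking. Here `E(ι_1) = ι_[1,1] = 0`, and `(Λ - Δ ∧ E)(dι_1, β)
  -- = β(E) - Δ(ι_1) β(E)`, which vanishes because `Δ(ι_1) = ι_1 = 1` on `A`.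
  obtain ⟨c, rfl⟩ := exists_smul_of_covectorPullback_eq_zero hα
  have h0 := congrFun (L.along_hamiltonian (oneSection EB F V A) (oneSection EB F V A))
    (hullIncl F V A p)
  rw [L.bracket_self, linFun_zero] at h0
  refine ⟨fun β => ?_, ?_⟩
  · rw [map_smul, LinearMap.smul_apply]
    change c • L.jacobiBivector (oneSection EB F V A) (hullIncl F V A p) _ β = 0
    rw [L.jacobiBivector_apply, wedgeAt, ← L.isHamiltonian_hamiltonian, mvfderiv_linFun_liouville,
      linFun_oneSection_hullIncl]
    change c • (_ - (1 * _ - along (L.hamiltonian _) (linFun _) _ * _)) = 0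
    rw [h0]
    ring_nf
  · change c • along (L.hamiltonian _) (linFun _) _ = 0
    rw [h0, smul_zero]

end AffineJacobiStructures

end

end AffineJacobi

/-! ### The main theorem. -/

theorem theorem3p5
    {EM : Type*} [NormedAddCommGroup EM] [NormedSpace ℝ EM] [FiniteDimensional ℝ EM]
    {M : Type*} [TopologicalSpace M] [ChartedSpace EM M] [IsManifold 𝓘(ℝ, EM) ∞ M]
    [T2Space M] [SecondCountableTopology M]
    {F : Type*} [NormedAddCommGroup F] [NormedSpace ℝ F] [FiniteDimensional ℝ F]
    (hrank : 0 < Module.finrank ℝ F)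
    {V : M → Type*} [∀ x, AddCommGroup (V x)] [∀ x, Module ℝ (V x)]
    {A : M → Type*} [∀ x, AddTorsor (V x) (A x)]
    [TopologicalSpace (TotalSpace F A)] [∀ x, TopologicalSpace (A x)] [FiberBundle F A]
    [AffineBundle F V A] [SmoothTransitions EM F A]
    (L : LieAlgebroid EM (AffModel F) (AffDual F V A)) :
    ∃ J : JacobiStructure (𝓘(ℝ, EM).prod 𝓘(ℝ, F)) (TotalSpace F A),
      (J.IsAffine V ∧ J.Matches L ∧
        ∀ J' : JacobiStructure (𝓘(ℝ, EM).prod 𝓘(ℝ, F)) (TotalSpace F A),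
          J'.IsAffine V → J'.Matches L → J' = J) ∧
      ∃ P : BivectorField (𝓘(ℝ, EM).prod 𝓘(ℝ, AffModel F →L[ℝ] ℝ)) (Hull F V A),
        (P.IsPoisson ∧ P.IsLinear ∧ L.IsInducedBy P ∧
          ∀ P' : BivectorField (𝓘(ℝ, EM).prod 𝓘(ℝ, AffModel F →L[ℝ] ℝ)) (Hull F V A),
            P'.IsPoisson → P'.IsLinear → L.IsInducedBy P' → P' = P) ∧
        ∃ JHat : JacobiStructure (𝓘(ℝ, EM).prod 𝓘(ℝ, AffModel F →L[ℝ] ℝ)) (Hull F V A),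
          P.IsHamiltonian (linFun (oneSection EM F V A)) JHat.vec ∧
          (∀ ψ α β, JHat.biv ψ α β = P ψ α β - wedgeAt (liouville EM ψ) (JHat.vec ψ) α β) ∧
          J.IsRestriction (hullIncl F V A) JHat := by 
  obtain ⟨J, hJ⟩ := L.exists_restriction
  -- Each affine function is the restriction of the linear function of its section, and Jacobi
  -- brackets commute with restriction, so the bracket is computed on the hull.
  have hbr : ∀ {a b : TotalSpace F A → ℝ} (ha : IsAffineFunction EM V a)
      (hb : IsAffineFunction EM V b), J.bracket a b = fun p =>
        linFun (L.bracket (toSection ha) (toSection hb)) (hullIncl F V A p) := by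
    intro a b ha hb
    funext p
    rw [← L.jacobiStructure_bracket, ← hJ.bracket_comp (contMDiff_hullIncl EM F V A)
      (contMDiff_linFun _) (contMDiff_linFun _), linFun_toSection_hullIncl,
      linFun_toSection_hullIncl]
  have haff : J.IsAffine V := fun a b ha hb => by
    rw [hbr ha hb]
    exact isAffineFunction_linFun_hullIncl _
  have hmatch : J.Matches L := fun a b ha hb => ⟨haff a b ha hb, toSection_eq _ (hbr ha hb)⟩
  exact ⟨J, ⟨haff, hmatch, fun J' _ h => JacobiStructure.eq_of_matches h hmatch⟩, L.poisson,
    ⟨L.poisson_isPoisson exists_oneSection_ne_zero, L.poisson_isLinear, L.poisson_isInducedBy,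
      fun _ _ _ h => h.eq_poisson exists_oneSection_ne_zero⟩,
    L.jacobiStructure (oneSection EM F V A) exists_oneSection_ne_zero,
    L.isHamiltonian_hamiltonian _, L.jacobiBivector_apply _, hJ⟩
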